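/- **Trees.** A *good tree* is a meet-semilattice $(T,\le,\wedge)$ in which the elements below any given element form a chain, every element lies below a maximal element (a *leaf*), and every element is a leaf or a *node* (of the form $x\wedge y$ with $x\neq y$). $L_T$, $N_T$ are the sets of leaves and nodes. $q$ is the *predecessor* $p(x)$ of $x$ if $q<x$ and nothing lies strictly between; a leaf is *isolated* if it has a predecessor. For $x<y$ the *cone* of $y$ at $x$ is $\{t: x<t\wedge y\}$. A good tree with more than one element is *1-colored* if one of the following holds: (0) it consists of exactly one node and $m$ leaves, $2\le m\le\infty$; (1.a) it has no root (no least element), and there is $2\le\mu\le\infty$ such that for every leaf $\alpha$ the chain $]-\infty,\alpha[$ is densely ordered, and at each node there are exactly $\mu$ cones, all infinite; (1.b) it has no root, and there are $1\le m,\mu\le\infty$ such that every leaf $\alpha$ has a predecessor, $]-\infty,p(\alpha)]$ is densely ordered, and at each node there are exactly $m$ leaves (having that node as predecessor) and $\mu$ infinite cones. **Data.** Let $T$ be a good tree with more than one element and $T_0$ a 1-colored good tree with more than one element, such that: $(\star)$ all leaves of $T$ are isolated, or none is; $(\star\star)$ if $T$ has non isolated leaves, $T_0$ has a root; $(\star\star\star)$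 if all leaves of $T$ are isolated, $p(L_T)$ is convex. Let $\mathcal F$ be a finite set of unary partial functions on $T$ such that, for $f\in\mathcal F$ with domain $D_f$ and image $F_f$: $D_f=\{x:\exists y\in F_f,\ y\le x\}$, $F_f\cap L_T=\emptyset$, $f(t)\le t$ for $t\in D_f$, and $f(t)=t$ for $t\in F_f$. If $T_0$ has no root, assume moreover $f(\alpha)=f(p(\alpha))$ for all $f\in\mathcal F$ and $\alpha\in L_T$ (both sides being undefined, or defined and equal). **Languages.** $\mathcal L_1=\{\le,\wedge,N,L\}$, $\mathcal L_2=\mathcal L_1\cup\{e,E,E_\ge\}$, $\mathcal L=\mathcal L_1\cup\{f,D_f,F_f: f\in\mathcal F\}$, $\mathcal L'=\mathcal L_2\cup\{f,D_f,F_f:f\in\mathcal F\}$. Here $e$ and the $f$ are partial unary functions, $D_f$, $F_f$ always denote the domain and image of $f$, and $E_\ge$, $E$ those of $e$. Put $E_>=E_\ge\setminus E$, $E_<$ the complement of $E_\ge$, $E_\le=E_<\cup E$. **Extension.** $T\rtimes T_0$ is the tree with underlying set $N_T\,\dot\cup\,(L_T\times T_0)$, ordered by: the order of $T$ on $N_T$;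 $(\alpha,t)\le(\alpha',t')$ iff $\alpha=\alpha'$ and $t\le t'$; $x\le(\alpha,t)$ iff $x\le\alpha$ in $T$, for $x\in N_T$. If $T_0$ has a root $r_0$, $e$ has domain $L_T\times T_0$ and $e(\alpha,t)=(\alpha,r_0)$. If $T_0$ has no root, $e$ has domain $(L_T\times T_0)\cup p(L_T)$, $e(\alpha,t)=p(\alpha)$, and $e(x)=x$ for $x\in p(L_T)$. For $f\in\mathcal F$, $f$ on $T\rtimes T_0$ is given by $f(x)=f^T(x)$ for $x\in N_T\cap D_f$ and $f(\alpha,t)=f^T(\alpha)$ for $\alpha\in L_T\cap D_f$, and is undefined elsewhere. **Theories.** $\Sigma''$ is the $\mathcal L_2$-theory saying: $(\le,\wedge)$ is a good tree with $L$, $N$ the sets of leaves and nodes; $E$ is convex; $E_\ge=\{x:\exists y\in E,\ y\le x\}$; $E_\ge$ is the domain and $E$ the image of $e$; $L\subseteq E_\ge$ and $E\cap L=\emptyset$; for $x\in E_\ge$, $e(x)\le x$ and $e(x)$ is the greatest element of $\{y\in E:y\le x\}$. In an $\mathcal L'$-structure, "$T_0$ has a root" stands for the sentence: every leaf has a predecessor,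 and $p(\alpha)<p(\beta)$ for no leaves $\alpha,\beta$. Let $x\sim y$ mean: $x=y$; or $x,y\in E_\ge$, $e(x)=e(y)$ and, if "$T_0$ has a root" fails, moreover $e(x)<x\wedge y$. $\Sigma'$ is the $\mathcal L'$-theory consisting of $\Sigma''$ and of: - for $x\in E_\ge$ (if "$T_0$ has a root"), resp. $x\in E_>$ (otherwise), the $\sim$-class of $x$ is elementarily equivalent to $T_0$ as a pure tree; - the quotient modulo $\sim$, with the induced $\mathcal L$-structure, is elementarily equivalent to $T$; - if "$T_0$ has a root" fails, then in the quotient every leaf has a predecessor and the image $\bar E$ of $E$ is the set of predecessors of leaves; - for $f\in\mathcal F$: for $x\in E_\le$, $f$ is defined at $x$ iff the induced function $\bar f$ is defined at the class $\bar x$, and then $f(x)$ is the unique $y\in E_\le$ with $\bar y=\bar f(\bar x)$; for $x\in E_\ge$, $f(x)=f(e(x))$ (one side being defined iff the other is). **Proposition.** $\Sigma'$ is a complete axiomatization of $T\rtimes T_0$, i.e. $T\rtimes T_0\models\Sigma'$ and $\Sigma'$ is complete. If (the theory of) $T$ is $\aleph_0$-categorical, then so is $\Sigma'$. If $T$ eliminates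 quantifiers in $\mathcal L\cup\{p,D,F\}$, where $p$ is the predecessor function, $D$ its domain and $F$ its image, then $\Sigma'$ eliminates quantifiers in $\mathcal L'\cup\{p,D,F\}$. -/

import Mathlib

namespace GoodTree

open FirstOrder FirstOrder.Language

universe u v

/-! ## Trees -/

section Trees

/-- A node: an element of the form `y ⊓ z` with `y ≠ z`. -/
def IsNode {T : Type u} [SemilatticeInf T] (x : T) : Prop :=
  ∃ y z : T, y ≠ z ∧ x = y ⊓ z

/-- Good trees: meet-semilattices in which the elements below a given one form a chain, every
element lies below a leaf (a maximal element), and every element is a leaf or a node. -/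
structure IsGoodTree (T : Type u) [SemilatticeInf T] : Prop where
  chain_below : ∀ x y z : T, y ≤ x → z ≤ x → y ≤ z ∨ z ≤ y
  leaf_above : ∀ x : T, ∃ y, x ≤ y ∧ IsMax y
  leaf_or_node : ∀ x : T, IsMax x ∨ IsNode x

/-- The tree has a root. -/
def HasRoot (T : Type u) [LE T] : Prop := ∃ r : T, IsBot r

/-- The cone of `y` at `x`. -/
def cone {T : Type u} [SemilatticeInf T] (x y : T) : Set T := {t | x < t ⊓ y}

/-- The set of all cones at `x`. -/
def conesAt {T : Type u} [SemilatticeInf T] (x : T) : Set (Set T) :=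
  {C | ∃ y, x < y ∧ C = cone x y}

/-- Type (0): a unique node, and `m` leaves with `2 ≤ m ≤ ∞`. -/
def IsType0 (T : Type u) [SemilatticeInf T] : Prop :=
  (∃! r : T, IsNode r) ∧ ∃ m : ℕ∞, 2 ≤ m ∧ {x : T | IsMax x}.encard = m

/-- Type (1.a): there is `μ` with `2 ≤ μ ≤ ∞` such that, for each leaf `α`, the set `]-∞, α[` is
densely ordered and unbounded on the left, and at each node there are exactly `μ` cones, all
infinite. -/
def IsType1a (T : Type u) [SemilatticeInf T] : Prop :=
  ¬ HasRoot T ∧ ∃ μ : ℕ∞, 2 ≤ μ ∧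
    (∀ α : T, IsMax α → DenselyOrdered (Set.Iio α)) ∧
    ∀ x : T, IsNode x → (conesAt x).encard = μ ∧ ∀ C ∈ conesAt x, C.Infinite

/-- Type (1.b): there are `m, μ` with `1 ≤ m, μ ≤ ∞` such that each leaf `α` has a predecessor
`p(α)`, the set `]-∞, p(α)]` is densely ordered and unbounded on the left, and at each node there
are exactly `m` leaves and `μ` infinite cones. -/
def IsType1b (T : Type u) [SemilatticeInf T] : Prop :=
  ¬ HasRoot T ∧ ∃ m μ : ℕ∞, 1 ≤ m ∧ 1 ≤ μ ∧
    (∀ α : T, IsMax α → ∃ q, q ⋖ α ∧ DenselyOrdered (Set.Iic q)) ∧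
    ∀ x : T, IsNode x →
      {α : T | IsMax α ∧ x ⋖ α}.encard = m ∧ {C ∈ conesAt x | C.Infinite}.encard = μ

/-- `1`-colored good trees which are not singletons. -/
structure IsOneColored (T : Type u) [SemilatticeInf T] : Prop where
  good : IsGoodTree T
  nontrivial : Nontrivial T
  type : IsType0 T ∨ IsType1a T ∨ IsType1b T

/-- An element is isolated if it has a predecessor. -/
def Isolated {T : Type u} [Preorder T] (α : T) : Prop := ∃ q, q ⋖ α

/-- The set `p(L)` of the predecessors of leaves. -/
def predLeaves (T : Type u) [Preorder T] : Set T := {x | ∃ α, IsMax α ∧ x ⋖ α}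

/-- The conditions on the pair `T`, `T₀` under which the extension is formed. -/
structure Compatible (T : Type u) (T₀ : Type v) [SemilatticeInf T] [SemilatticeInf T₀] :
    Prop where
  /-- All leaves are isolated, or all leaves are non isolated. -/
  star : (∀ α : T, IsMax α → Isolated α) ∨ (∀ α : T, IsMax α → ¬ Isolated α)
  /-- If `T` has non isolated leaves, `T₀` has a root. -/
  star₂ : (∃ α : T, IsMax α ∧ ¬ Isolated α) → HasRoot T₀
  /-- If all leaves of `T` are isolated, `p(L)` is convex. -/
  star₃ : (∀ α : T, IsMax α → Isolated α) →
    ∀ x y z : T, x ∈ predLeaves T → z ∈ predLeaves T → x < y → y < z → y ∈ predLeaves T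

end Trees

/-! ## Partial functions on a tree -/

section PartialFunctions

/-- The partial function with a given (functional) graph. -/
noncomputable def ofGraph {A : Type u} {B : Type v} (R : A → B → Prop) : A →. B :=
  fun a => ⟨∃ b, R a b, fun h => h.choose⟩

/-- The predecessor function. -/
noncomputable def pred (T : Type u) [Preorder T] : T →. T := ofGraph fun x y => y ⋖ x

/-- Conditions on a family of partial functions `f` (with domain `D_f` and image `F_f`):
`D_f = {x | ∃ y ∈ F_f, y ≤ x}`, `F_f` contains no leaf, `f t ≤ t` on `D_f`, `f t = t` on `F_f`. -/
structure FourStar {T : Type u} [SemilatticeInf T] {ι : Type} (f : ι → T →. T) : Prop where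
  dom_eq : ∀ i x, x ∈ (f i).Dom ↔ ∃ y ∈ (f i).ran, y ≤ x
  ran_not_leaf : ∀ i, ∀ y ∈ (f i).ran, ¬ IsMax y
  apply_le : ∀ i t s, s ∈ f i t → s ≤ t
  apply_ran : ∀ i, ∀ t ∈ (f i).ran, t ∈ f i t

end PartialFunctions

/-! ## The extension `T ⋊ T₀` -/

section Extension

/-- The underlying set of `T ⋊ T₀`: the disjoint union of the set of nodes of `T` and of the
product of the set of leaves of `T` with `T₀`. (In a good tree the nodes are the elements which are
not leaves.) -/
inductive Ext (T : Type u) (T₀ : Type v) [SemilatticeInf T] : Type (max u v)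
  | node (x : T) (h : ¬ IsMax x) : Ext T T₀
  | copy (α : T) (h : IsMax α) (t : T₀) : Ext T T₀

namespace Ext

variable {T : Type u} {T₀ : Type v} [SemilatticeInf T]

/-- The projection on `T`. -/
def base : Ext T T₀ → T
  | node x _ => x
  | copy α _ _ => α

/-- The order of `T ⋊ T₀`. -/
protected def le [LE T₀] : Ext T T₀ → Ext T T₀ → Prop
  | node x _, node y _ => x ≤ y
  | node x _, copy α _ _ => x ≤ α
  | copy _ _ _, node _ _ => False
  | copy α _ t, copy β _ s => α = β ∧ t ≤ s

theorem not_isMax_inf {x y : T} (h : ¬ IsMax x) : ¬ IsMax (x ⊓ y) := fun hm =>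
  h (by rwa [← hm.eq_of_le inf_le_left])

theorem not_isMax_inf_of_ne {x y : T} (h : x ≠ y) :
    ¬ IsMax (x ⊓ y) := fun hm =>
  h ((hm.eq_of_le inf_le_left).symm.trans (hm.eq_of_le inf_le_right))

open Classical in
/-- The meet of `T ⋊ T₀`. -/
protected noncomputable def inf [SemilatticeInf T₀] : Ext T T₀ → Ext T T₀ → Ext T T₀
  | node x h, node y _ => node (x ⊓ y) (not_isMax_inf h)
  | node x h, copy α _ _ => node (x ⊓ α) (not_isMax_inf h)
  | copy α _ _, node x h => node (x ⊓ α) (not_isMax_inf h)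
  | copy α hα t, copy β _ s =>
      if h : α = β then copy α hα (t ⊓ s) else node (α ⊓ β) (not_isMax_inf_of_ne h)

noncomputable instance [SemilatticeInf T₀] : SemilatticeInf (Ext T T₀) where
  le := Ext.le
  le_refl a := by cases a <;> simp [Ext.le]
  le_trans a b c := by
    cases a <;> cases b <;> cases c <;> simp only [Ext.le, false_imp_iff, imp_false,
      not_false_eq_true, imp_true_iff]
    · exact le_trans
    · exact le_trans
    · rintro h ⟨rfl, -⟩; exact h
    · rintro ⟨rfl, h⟩ ⟨rfl, h'⟩; exact ⟨rfl, h.trans h'⟩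
  le_antisymm a b := by
    cases a <;> cases b <;> simp only [Ext.le, false_imp_iff, node.injEq, copy.injEq,
      imp_true_iff]
    · exact le_antisymm
    · rintro ⟨rfl, h⟩ ⟨-, h'⟩; exact ⟨rfl, h.antisymm h'⟩
  inf := Ext.inf
  inf_le_left a b := by
    cases a <;> cases b <;> simp only [Ext.inf]
    · exact inf_le_left
    · exact inf_le_left
    · exact inf_le_right
    · split_ifs with h
      · exact ⟨rfl, inf_le_left⟩
      · exact inf_le_left
  inf_le_right a b := by
    cases a <;> cases b <;> simp only [Ext.inf]
    · exact inf_le_right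
    · exact inf_le_right
    · exact inf_le_left
    · split_ifs with h
      · exact ⟨h, inf_le_right⟩
      · exact inf_le_right
  le_inf a b c := by
    cases a <;> cases b <;> cases c <;> simp only [Ext.inf]
    · exact le_inf
    · exact le_inf
    · exact fun h h' => le_inf h' h
    · intro h h'
      split_ifs
      · exact h
      · exact le_inf h h'
    · exact fun h => h.elim
    · exact fun h => h.elim
    · exact fun _ h => h.elim
    · rintro ⟨rfl, h⟩ ⟨rfl, h'⟩
      rw [dif_pos rfl]
      exact ⟨rfl, le_inf h h'⟩

end Ext

/-- The function symbols indexed by `ι`, together with the new symbol `e`. -/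
inductive AddE (ι : Type) : Type
  | old (i : ι) : AddE ι
  | e : AddE ι

/-- The function symbols indexed by `ι`, together with the new symbol `p`. -/
inductive AddP (ι : Type) : Type
  | old (i : ι) : AddP ι
  | p : AddP ι

variable {T : Type u} {T₀ : Type v} [SemilatticeInf T] [SemilatticeInf T₀]

/-- The graph of the function `e` of `T ⋊ T₀`. If `T₀` has a root `r₀`, then `e (α, t) = (α, r₀)`,
and `e` is undefined elsewhere. If `T₀` has no root, then `e (α, t) = p(α)` and `e x = x` for
`x ∈ p(L)`, and `e` is undefined elsewhere. -/
def eGraph : Ext T T₀ → Ext T T₀ → Prop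
  | .copy α h _, z =>
      (∃ r : T₀, IsBot r ∧ z = .copy α h r) ∨
      (¬ HasRoot T₀ ∧ ∃ (q : T) (hq : ¬ IsMax q), q ⋖ α ∧ z = .node q hq)
  | .node x h, z => ¬ HasRoot T₀ ∧ x ∈ predLeaves T ∧ z = .node x h

/-- The partial functions on `T ⋊ T₀`: each `f` of `T` is extended by `f x = f^T x` for a node `x`
of `T` and `f (α, t) = f^T α` (note that the values of `f^T` are nodes); and `e` is as above. -/
noncomputable def extFun {ι : Type} (f : ι → T →. T) : AddE ι → Ext T T₀ →. Ext T T₀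
  | .old i => ofGraph fun x z => ∃ (y : T) (hy : ¬ IsMax y), y ∈ f i x.base ∧ z = .node y hy
  | .e => ofGraph eGraph

/-- Expansion of a family of partial functions by the predecessor function. -/
noncomputable def withPred {M : Type u} [Preorder M] {ι : Type} (f : ι → M →. M) :
    AddP ι → M →. M
  | .old i => f i
  | .p => pred M

end Extension

/-! ## Languages

A partial function `f` is given by a function symbol together with unary predicates for its domain
`D_f` and its image `F_f`; outside the domain the function symbol is interpreted by the identity,
so that quantifier free formulas have the same meaning as for partial functions. -/

section Languages

/-- Function symbols: `∧` and the `f_i`. -/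
inductive TreeFunc (ι : Type) : ℕ → Type
  | meet : TreeFunc ι 2
  | fn (i : ι) : TreeFunc ι 1

/-- Relation symbols: `≤`, `N`, `L`, the `D_{f_i}` and the `F_{f_i}`. -/
inductive TreeRel (ι : Type) : ℕ → Type
  | le : TreeRel ι 2
  | node : TreeRel ι 1
  | leaf : TreeRel ι 1
  | dom (i : ι) : TreeRel ι 1
  | im (i : ι) : TreeRel ι 1

/-- The language `{≤, ∧, N, L} ∪ {f_i, D_{f_i}, F_{f_i} ; i ∈ ι}`. -/
def treeLang (ι : Type) : FirstOrder.Language.{0, 0} := ⟨TreeFunc ι, TreeRel ι⟩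

/-- Inclusion of languages induced by a map of the index sets. -/
def treeMap {ι κ : Type} (g : ι → κ) : treeLang ι →ᴸ treeLang κ where
  onFunction := fun _ s => match s with
    | .meet => TreeFunc.meet
    | .fn i => TreeFunc.fn (g i)
  onRelation := fun _ s => match s with
    | .le => TreeRel.le
    | .node => TreeRel.node
    | .leaf => TreeRel.leaf
    | .dom i => TreeRel.dom (g i)
    | .im i => TreeRel.im (g i)

open Classical in
/-- A tree with partial functions as a structure. -/
@[reducible]
noncomputable def treeStructure {M : Type u} [SemilatticeInf M] {ι : Type} (f : ι → M →. M) :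
    (treeLang ι).Structure M where
  funMap := fun {_} s => match s with
    | .meet => fun v => v 0 ⊓ v 1
    | .fn i => fun v => if h : (f i (v 0)).Dom then (f i (v 0)).get h else v 0
  RelMap := fun {_} s => match s with
    | .le => fun v => v 0 ≤ v 1
    | .node => fun v => IsNode (v 0)
    | .leaf => fun v => IsMax (v 0)
    | .dom i => fun v => v 0 ∈ (f i).Dom
    | .im i => fun v => v 0 ∈ (f i).ran

/-- The complete theory of a tree with partial functions. -/
noncomputable def theoryOf {M : Type u} [SemilatticeInf M] {ι : Type} (f : ι → M →. M) :
    (treeLang ι).Theory :=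
  letI := treeStructure f
  (treeLang ι).completeTheory M

/-- The complete theory of an ordered set in the language `{≤}`. -/
def orderTheoryOf (M : Type u) [LE M] : FirstOrder.Language.order.Theory :=
  letI := orderStructure M
  FirstOrder.Language.order.completeTheory M

/-- A theory eliminates quantifiers. -/
def EliminatesQuantifiers {L : FirstOrder.Language.{0, 0}} (S : L.Theory) : Prop :=
  ∀ (n : ℕ) (φ : L.Formula (Fin n)), ∃ ψ : L.Formula (Fin n),
    BoundedFormula.IsQF ψ ∧ S ⊨ᵇ BoundedFormula.iff φ ψ

end Languages

/-! ## Formulas -/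

section Formulas

variable {ι : Type} {n : ℕ}

/-- Terms in the variables `&0, …, &(n-1)`. -/
abbrev Tm (ι : Type) (n : ℕ) := (treeLang ι).Term (Empty ⊕ Fin n)

/-- Formulas in the free variables `&0, …, &(n-1)`. -/
abbrev Fm (ι : Type) (n : ℕ) := (treeLang ι).BoundedFormula Empty n

/-- A term, seen under one more quantifier. -/
def up (t : Tm ι n) : Tm ι (n + 1) := t.relabel (Sum.map id Fin.castSucc)

/-- The variable bound by the innermost quantifier. -/
def new : Tm ι (n + 1) := Term.var (Sum.inr (Fin.last n))

/-- `s ∧ t` (meet). -/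
def meet (s t : Tm ι n) : Tm ι n := Functions.apply₂ (L := treeLang ι) TreeFunc.meet s t

/-- `f_i(t)`. -/
def app (i : ι) (t : Tm ι n) : Tm ι n := Functions.apply₁ (L := treeLang ι) (TreeFunc.fn i) t

/-- `s ≤ t`. -/
def le (s t : Tm ι n) : Fm ι n := Relations.boundedFormula₂ (L := treeLang ι) TreeRel.le s t

/-- `s < t`. -/
def lt (s t : Tm ι n) : Fm ι n := le s t ⊓ ∼(s =' t)

/-- `N(t)`. -/
def node (t : Tm ι n) : Fm ι n := Relations.boundedFormula₁ (L := treeLang ι) TreeRel.node t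

/-- `L(t)`. -/
def leaf (t : Tm ι n) : Fm ι n := Relations.boundedFormula₁ (L := treeLang ι) TreeRel.leaf t

/-- `D_{f_i}(t)`. -/
def dom (i : ι) (t : Tm ι n) : Fm ι n :=
  Relations.boundedFormula₁ (L := treeLang ι) (TreeRel.dom i) t

/-- `F_{f_i}(t)`. -/
def im (i : ι) (t : Tm ι n) : Fm ι n :=
  Relations.boundedFormula₁ (L := treeLang ι) (TreeRel.im i) t

/-- `s` is a predecessor of `t`. -/
def cov (s t : Tm ι n) : Fm ι n := lt s t ⊓ ∀' ∼(lt (up s) new ⊓ lt new (up t))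

/-- The axioms of good trees, in the language `{≤, ∧, N, L}`. -/
def goodTreeAxioms (ι : Type) : (treeLang ι).Theory :=
  { -- `≤` is a partial order
    ∀' le &0 &0,
    ∀' ∀' (le &0 &1 ⟹ le &1 &0 ⟹ &0 =' &1),
    ∀' ∀' ∀' (le &0 &1 ⟹ le &1 &2 ⟹ le &0 &2),
    -- the elements below a given one form a chain
    ∀' ∀' ∀' (le &1 &0 ⟹ le &2 &0 ⟹ le &1 &2 ⊔ le &2 &1),
    -- `∧` is the meet
    ∀' ∀' (le (meet &0 &1) &0 ⊓ le (meet &0 &1) &1),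
    ∀' ∀' ∀' (le &2 &0 ⟹ le &2 &1 ⟹ le &2 (meet &0 &1)),
    -- `L` is the set of leaves, `N` the set of nodes
    ∀' (leaf &0 ⇔ ∀' (le &0 &1 ⟹ le &1 &0)),
    ∀' (node &0 ⇔ ∃' ∃' (∼(&1 =' &2) ⊓ &0 =' meet &1 &2)),
    -- there are leaves everywhere, and each element is a leaf or a node
    ∀' ∃' (le &0 &1 ⊓ leaf &1),
    ∀' (leaf &0 ⊔ node &0) }

/-- The axioms expressing that `D_{f_i}` and `F_{f_i}` are the domain and the image of the partial
function `f_i` (and that the function symbol is the identity outside of the domain). -/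
def partialFunAxioms (i : ι) : (treeLang ι).Theory :=
  { ∀' (∼(dom i &0) ⟹ app i &0 =' &0),
    ∀' (im i &0 ⇔ ∃' (dom i &1 ⊓ app i &1 =' &0)) }

/-- The definition of the predecessor function `p`, of its domain and of its image. -/
def predAxioms (ι : Type) : (treeLang (AddP ι)).Theory :=
  partialFunAxioms AddP.p ∪
  { ∀' (dom AddP.p &0 ⇔ ∃' cov &1 &0),
    ∀' (dom AddP.p &0 ⟹ cov (app AddP.p &0) &0) }

/-! ### The symbols `e`, `E`, `E_≥` -/

/-- `e(t)`. -/
def eFn (t : Tm (AddE ι) n) : Tm (AddE ι) n := app AddE.e t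

/-- `E(t)`, where `E` is the image of `e`. -/
def inE (t : Tm (AddE ι) n) : Fm (AddE ι) n := im AddE.e t

/-- `E_≥(t)`, where `E_≥` is the domain of `e`. -/
def inEge (t : Tm (AddE ι) n) : Fm (AddE ι) n := dom AddE.e t

/-- `E_>(t)`. -/
def inEgt (t : Tm (AddE ι) n) : Fm (AddE ι) n := inEge t ⊓ ∼(inE t)

/-- `E_≤(t)`. -/
def inEle (t : Tm (AddE ι) n) : Fm (AddE ι) n := ∼(inEge t) ⊔ inE t

/-- The theory `Σ''`. -/
def sigma2 (ι : Type) : (treeLang (AddE ι)).Theory :=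
  goodTreeAxioms (AddE ι) ∪
  -- `E_≥ = Dom(e)` and `E = Im(e)`
  partialFunAxioms AddE.e ∪
  { -- `E` is convex
    ∀' ∀' ∀' (inE &0 ⟹ inE &2 ⟹ lt &0 &1 ⟹ lt &1 &2 ⟹ inE &1),
    -- `E_≥ = {x | ∃ y ∈ E, y ≤ x}`
    ∀' (inEge &0 ⇔ ∃' (inE &1 ⊓ le &1 &0)),
    -- `L ⊆ E_≥` and `E ∩ L = ∅`
    ∀' (leaf &0 ⟹ inEge &0),
    ∀' ∼(inE &0 ⊓ leaf &0),
    -- `e(x) ≤ x` for `x ∈ E_≥`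
    ∀' (inEge &0 ⟹ le (eFn &0) &0),
    -- for `x ∈ E_≥`, `e(x)` is the greatest element of `E ∩ br(x)`
    ∀' (inEge &0 ⟹
      (inE (eFn &0) ⊓ le (eFn &0) &0 ⊓ ∀' (inE &1 ⟹ le &1 &0 ⟹ le &1 (eFn &0)))) }

/-- The conjunction of both sentences expressing that "`T₀` has a root": each leaf has a
predecessor, and `p(α) < p(β)` for no leaves `α` and `β`. -/
def rooted : Fm (AddE ι) n :=
  ∀' (leaf new ⟹ ∃' cov new (up new)) ⊓
  -- the variables bound below are, from left to right, `α`, `β`, `p(α)`, `p(β)`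
  ∀' ∀' ∀' ∀' (leaf (up (up (up new))) ⟹ leaf (up (up new)) ⟹
    cov (up new) (up (up (up new))) ⟹ cov new (up (up new)) ⟹ ∼(lt (up new) new))

/-- The relation `s ∼ t`: either `s = t`, or `s, t ∈ E_≥` and `e(s) = e(t)`, with moreover
`e(s) < s ∧ t` if "`T₀` has no root". -/
def sim (s t : Tm (AddE ι) n) : Fm (AddE ι) n :=
  s =' t ⊔ (inEge s ⊓ inEge t ⊓ eFn s =' eFn t ⊓ (rooted ⊔ lt (eFn s) (meet s t)))

/-! ### The `∼`-classes -/

/-- For a formula `φ(y_0, …, y_{n-1})` in the language `{≤}`, the formula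
`φ*(x, y_0, …, y_{n-1})` expressing that `φ` is true in the `∼`-class of `x`. Here `x` is the
variable `&0`. -/
def inClass {ι : Type} : {n : ℕ} → FirstOrder.Language.order.BoundedFormula Empty n → Fm (AddE ι) (n + 1)
  | _, .falsum => ⊥
  | _, .equal s t => tm s =' tm t
  | _, .rel R ts => match R with
    | .le => le (tm (ts 0)) (tm (ts 1))
  | _, .imp φ ψ => inClass φ ⟹ inClass ψ
  | _, .all φ => ∀' (sim new &0 ⟹ inClass φ)
where
  /-- Terms in the language `{≤}` are variables. -/
  tm {ι : Type} {n : ℕ} : FirstOrder.Language.order.Term (Empty ⊕ Fin n) → Tm (AddE ι) (n + 1)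
    | .var (.inl x) => x.elim
    | .var (.inr k) => .var (.inr k.succ)
    | .func f _ => Empty.elim f

/-- The axiom scheme: for `x ∈ E_≥` if "`T₀` has a root", `x ∈ E_>` otherwise, the `∼`-class of `x`
is elementarily equivalent, as a pure tree, to a tree of theory `S₀`. -/
def classAxioms (ι : Type) (S₀ : FirstOrder.Language.order.Theory) : (treeLang (AddE ι)).Theory :=
  (fun φ : FirstOrder.Language.order.Sentence =>
    ∀' (((rooted ⊓ inEge &0) ⊔ (∼rooted ⊓ inEgt &0)) ⟹ inClass φ)) '' S₀

/-! ### The quotient modulo `∼`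

The domain of the quotient is coded by the whole structure, with `∼` for the equality. -/

/-- `s̄ ≤ t̄` in the quotient: some `u ∼ s` and some `v ∼ t` satisfy `u ≤ v`. -/
def leBar (s t : Tm (AddE ι) n) : Fm (AddE ι) n :=
  ∃' ∃' (sim (up new) (up (up s)) ⊓ sim new (up (up t)) ⊓ le (up new) new)

/-- `t̄` is a leaf of the quotient. -/
def leafBar (t : Tm (AddE ι) n) : Fm (AddE ι) n :=
  ∀' (leBar (up t) new ⟹ sim new (up t))

/-- `t̄` is a node of the quotient. -/
def nodeBar (t : Tm (AddE ι) n) : Fm (AddE ι) n :=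
  ∃' ∃' (∼(sim (up new) new) ⊓ sim (up (up t)) (meet (up new) new))

/-- `s̄` is a predecessor of `t̄` in the quotient. -/
def covBar (s t : Tm (AddE ι) n) : Fm (AddE ι) n :=
  leBar s t ⊓ ∼(sim s t) ⊓
    ∀' (leBar (up s) new ⟹ leBar new (up t) ⟹ sim new (up s) ⊔ sim new (up t))

/-- `t̄` belongs to the domain of `f̄`: the class of `t` meets `D_f`. -/
def domBar (i : AddE ι) (t : Tm (AddE ι) n) : Fm (AddE ι) n :=
  ∃' (sim new (up t) ⊓ dom i new)

/-- `t̄` belongs to the image of `f̄`: the class of `t` meets `F_f`. -/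
def imBar (i : AddE ι) (t : Tm (AddE ι) n) : Fm (AddE ι) n :=
  ∃' (sim new (up t) ⊓ im i new)

/-- `f̄(s̄) = t̄`: there is `u ∼ s` with `u ∈ D_f` and `f(u) ∼ t`. -/
def appBar (i : AddE ι) (s t : Tm (AddE ι) n) : Fm (AddE ι) n :=
  ∃' (sim new (up s) ⊓ dom i new ⊓ sim (app i new) (up t))

/-- The interpretation of the relation symbols in the quotient. -/
def quotientRel {l : ℕ} (R : TreeRel ι l) (ts : Fin l → Tm (AddE ι) n) : Fm (AddE ι) n :=
  match R with
  | .le => leBar (ts 0) (ts 1)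
  | .node => nodeBar (ts 0)
  | .leaf => leafBar (ts 0)
  | .dom i => domBar (.old i) (ts 0)
  | .im i => imBar (.old i) (ts 0)

/-- For a formula `φ` in the language `ℒ`, the formula expressing that `φ` is true in the quotient
modulo `∼`. The functions of the quotient are computed on representatives: for `∧` this is allowed
by `Σ''` and the axioms on the `∼`-classes, and for the `f_i` by the axioms on `f_i` below. -/
def inQuotient {ι : Type} : {n : ℕ} → Fm ι n → Fm (AddE ι) n
  | _, .falsum => ⊥
  | _, .equal s t => sim ((treeMap AddE.old).onTerm s) ((treeMap AddE.old).onTerm t)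
  | _, .rel R ts => quotientRel R fun k => (treeMap AddE.old).onTerm (ts k)
  | _, .imp φ ψ => inQuotient φ ⟹ inQuotient ψ
  | _, .all φ => ∀' inQuotient φ

/-- The axiom scheme: the quotient modulo `∼` is elementarily equivalent to a structure of theory
`S`. -/
def quotientAxioms {ι : Type} (S : (treeLang ι).Theory) : (treeLang (AddE ι)).Theory :=
  (fun φ : (treeLang ι).Sentence => (inQuotient φ : Fm (AddE ι) 0)) '' S

/-- If "`T₀` has no root", then the leaves of the quotient have a predecessor, and the image `Ē` of
`E` in the quotient is the set of the predecessors of the leaves. -/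
def noRootAxioms (ι : Type) : (treeLang (AddE ι)).Theory :=
  { ∼rooted ⟹ ∀' (leafBar &0 ⟹ ∃' covBar &1 &0),
    ∼rooted ⟹ ∀' (imBar AddE.e &0 ⇔ ∃' (leafBar &1 ⊓ covBar &0 &1)) }

/-- The axioms about the function symbol `f_i` of `ℒ`. -/
def funAxioms (i : ι) : (treeLang (AddE ι)).Theory :=
  -- `D_f` and `F_f` are the domain and the image of `f`
  partialFunAxioms (AddE.old i) ∪
  { -- for `x ∈ E_≤`, `f` is defined at `x` iff `f̄` is defined at `x̄`, and then
    -- `f(x)` is the unique `y ∈ E_≤` with `ȳ = f̄(x̄)`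
    ∀' (inEle &0 ⟹ (dom (AddE.old i) &0 ⇔ domBar (AddE.old i) &0)),
    ∀' (inEle &0 ⟹ dom (AddE.old i) &0 ⟹
      ∀' ((inEle &1 ⊓ appBar (AddE.old i) &0 &1) ⇔ &1 =' app (AddE.old i) &0)),
    -- for `x ∈ E_≥`, `f(x) = f(e(x))` (one side is defined iff the other is)
    ∀' (inEge &0 ⟹ (dom (AddE.old i) &0 ⇔ dom (AddE.old i) (eFn &0))),
    ∀' (inEge &0 ⟹ dom (AddE.old i) &0 ⟹
      app (AddE.old i) &0 =' app (AddE.old i) (eFn &0)) }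

/-- The theory `Σ'`, formed from the theory `S` of `T` in the language `ℒ` and the theory `S₀` of
the pure tree `T₀`. -/
def sigma' {ι : Type} (S : (treeLang ι).Theory) (S₀ : FirstOrder.Language.order.Theory) :
    (treeLang (AddE ι)).Theory :=
  sigma2 ι ∪ classAxioms ι S₀ ∪ quotientAxioms S ∪ noRootAxioms ι ∪ ⋃ i : ι, funAxioms i

/-- The expansion by definitions of a theory of trees to the language with `p`, its domain `D` and
its image `F`. -/
def addPred {κ : Type} (S : (treeLang κ).Theory) : (treeLang (AddP κ)).Theory :=
  (treeMap AddP.old).onTheory S ∪ predAxioms κ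

end Formulas

end GoodTree

/-! The relation `∼` cuts a model `M` of `Σ'` into a quotient tree `Q` and its fibres: every class
is a singleton except those over the leaves of `Q`, and these are elementarily equivalent to `T₀`.
`exists_decomp` extracts this from the axioms. `Decomp` records it so that the order of `M`, the set
`E`, the function `e` and the graphs of the `f` are all expressed through `Q` and the order inside
the classes.

Back-and-forth systems can therefore be glued. Given a system `S` between two quotients and a system
for each pair of classes over leaves, take the relations whose projection lies in `S` and whose
trace on each such pair of classes lies in the corresponding system. These form a back-and-forth
system between the two models (`Decomp.exists_isBackForth`). The systems between classes need no
saturation (`exists_isClassSystem`). If `T₀` has a root, a class is a root with leaves above it, and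
only its size matters up to finite counts. Otherwise a class is a dense tree without root, all of
whose nodes carry the same numbers of leaves and of infinite cones, and finite partial isomorphisms
closed under meets and predecessors of leaves can always be extended.

Each part of the theorem is then a choice of `S`. For completeness, pass to `ℵ₀`-saturated
elementary extensions: the quotients, being interpretable, are saturated too, and equality of types
is a system between them. For `ℵ₀`-categoricity, the quotients of countable models are isomorphic if
infinite and saturated if finite, and the glued system is run along enumerations. For quantifier
elimination, two tuples with the same quantifier-free type generate a relation closed under the
function symbols. Its projection is closed under the functions of `ℒ` and `p`
(`Decomp.isTreeClosed_map`), so elimination for `T` makes the projected tuples have the same type,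
while on the classes the finite parts of the relation belong to the class systems.
`eliminatesQuantifiers_of_qf` concludes.

Finally, `T ⋊ T₀` is a model because `∼` is there equality of the projections on `T`
(`ext_sim_iff`), so that its quotient is `T` itself. -/

namespace GoodTree

open FirstOrder FirstOrder.Language

universe u v w w'

/-! ## Back-and-forth systems -/

section BackForth

variable {L : FirstOrder.Language.{u, v}} {M : Type w} {N : Type w'}

/-- A family of relations between `M` and `N`, with the back-and-forth property. -/
structure IsBackForth (S : Set (M × N) → Prop) : Prop where
  forth : ∀ s, S s → ∀ a, ∃ b, S (insert (a, b) s)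
  back : ∀ s, S s → ∀ b, ∃ a, S (insert (a, b) s)

/-- A relation which preserves equality, the relation symbols and the graphs of the function
symbols. -/
structure PreservesAtoms (L : FirstOrder.Language.{u, v}) [L.Structure M] [L.Structure N]
    (s : Set (M × N)) : Prop where
  eq : ∀ p ∈ s, ∀ q ∈ s, p.1 = q.1 ↔ p.2 = q.2
  rel : ∀ {n : ℕ} (R : L.Relations n) (x : Fin n → M × N), (∀ i, x i ∈ s) →
    (Structure.RelMap R (fun i => (x i).1) ↔ Structure.RelMap R fun i => (x i).2)
  fn : ∀ {n : ℕ} (F : L.Functions n) (x : Fin n → M × N), (∀ i, x i ∈ s) → ∀ p ∈ s,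
    (Structure.funMap F (fun i => (x i).1) = p.1 ↔ Structure.funMap F (fun i => (x i).2) = p.2)

variable [L.Structure M] [L.Structure N]

/-- The requirements survive enlargement, so they can be met one after another. This brings all
arguments of a symbol into one member of the system. -/
theorem exists_superset_forall {S : Set (M × N) → Prop} {n : ℕ} (P : Fin n → Set (M × N) → Prop)
    (hP : ∀ i s t, s ⊆ t → P i s → P i t) (s : Set (M × N)) (hs : S s)
    (h : ∀ i t, s ⊆ t → S t → ∃ t', t ⊆ t' ∧ S t' ∧ P i t') :
    ∃ t, s ⊆ t ∧ S t ∧ ∀ i, P i t := by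
  suffices ∀ I : Finset (Fin n), ∃ t, s ⊆ t ∧ S t ∧ ∀ i ∈ I, P i t by
    obtain ⟨t, h1, h2, h3⟩ := this Finset.univ
    exact ⟨t, h1, h2, fun i => h3 i (Finset.mem_univ i)⟩
  intro I
  induction I using Finset.induction_on with
  | empty => exact ⟨s, subset_rfl, hs, by simp⟩
  | insert i I _ ih =>
    obtain ⟨t, h1, h2, h3⟩ := ih
    obtain ⟨t', h4, h5, h6⟩ := h i t h1 h2
    refine ⟨t', h1.trans h4, h5, fun j hj => ?_⟩
    rcases Finset.mem_insert.1 hj with rfl | hj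
    · exact h6
    · exact hP j _ _ h4 (h3 j hj)

/-- A member of the system need not be closed under the functions, so values of subterms are
adjoined by forth steps; preservation of graphs forces the partner of such a value to be the
corresponding value. -/
theorem IsBackForth.exists_term_mem {S : Set (M × N) → Prop} (hS : IsBackForth S)
    (hL : ∀ s, S s → PreservesAtoms L s) {α : Type*} (t : L.Term α) (s : Set (M × N)) (hs : S s)
    (v : α → M × N) (hv : ∀ i, v i ∈ s) :
    ∃ s', s ⊆ s' ∧ S s' ∧ (t.realize (fun i => (v i).1), t.realize fun i => (v i).2) ∈ s' := by
  induction t generalizing s with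
  | var i => exact ⟨s, subset_rfl, hs, hv i⟩
  | func F ts ih =>
    obtain ⟨s₁, h1, h2, h3⟩ := exists_superset_forall (S := S)
      (fun i s' => ((ts i).realize (fun i => (v i).1), (ts i).realize fun i => (v i).2) ∈ s')
      (fun i s t hst h => hst h) s hs
      (fun i t hst ht => ih i t ht fun j => hst (hv j))
    obtain ⟨b, hb⟩ := hS.forth s₁ h2
      (Structure.funMap F fun i => (ts i).realize fun i => (v i).1)
    refine ⟨_, h1.trans (Set.subset_insert _ _), hb, ?_⟩
    have := ((hL _ hb).fn F _ (fun i => Set.mem_insert_of_mem _ (h3 i)) _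
      (Set.mem_insert _ _)).1 rfl
    simp only [Term.realize]
    simp only at this
    rw [this]
    exact Set.mem_insert _ _

/-- Atomic formulas are handled by first adjoining the values of their terms; a quantifier is one
back or forth step. -/
theorem IsBackForth.realize_iff {S : Set (M × N) → Prop} (hS : IsBackForth S)
    (hL : ∀ s, S s → PreservesAtoms L s) {α : Type*} {n : ℕ} (φ : L.BoundedFormula α n)
    (s : Set (M × N)) (hs : S s) (v : α → M × N) (hv : ∀ i, v i ∈ s)
    (x : Fin n → M × N) (hx : ∀ i, x i ∈ s) :
    φ.Realize (fun i => (v i).1) (fun i => (x i).1) ↔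
      φ.Realize (fun i => (v i).2) (fun i => (x i).2) := by
  have helim : ∀ {n : ℕ} (x : Fin n → M × N),
      (Sum.elim (fun i => (v i).1) fun i => (x i).1) = fun i => (Sum.elim v x i).1 := by
    intro n x; ext (i | i) <;> rfl
  have helim' : ∀ {n : ℕ} (x : Fin n → M × N),
      (Sum.elim (fun i => (v i).2) fun i => (x i).2) = fun i => (Sum.elim v x i).2 := by
    intro n x; ext (i | i) <;> rfl
  induction φ generalizing s with
  | falsum => rfl
  | equal t₁ t₂ =>
    have hvx : ∀ i, Sum.elim v x i ∈ s := by rintro (i | i); exacts [hv i, hx i]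
    obtain ⟨s₁, h1, h2, h3⟩ := hS.exists_term_mem hL t₁ s hs _ hvx
    obtain ⟨s₂, h4, h5, h6⟩ := hS.exists_term_mem hL t₂ s₁ h2 _ fun i => h1 (hvx i)
    simp only [BoundedFormula.Realize, helim, helim']
    exact (hL _ h5).eq _ (h4 h3) _ h6
  | rel R ts =>
    have hvx : ∀ i, Sum.elim v x i ∈ s := by rintro (i | i); exacts [hv i, hx i]
    obtain ⟨s₁, h1, h2, h3⟩ := exists_superset_forall (S := S)
      (fun i s' => ((ts i).realize (fun i => (Sum.elim v x i).1),
        (ts i).realize fun i => (Sum.elim v x i).2) ∈ s')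
      (fun i s t hst h => hst h) s hs
      (fun i t hst ht => hS.exists_term_mem hL (ts i) t ht _ fun j => hst (hvx j))
    simp only [BoundedFormula.Realize, helim, helim']
    exact (hL _ h2).rel R _ h3
  | imp φ ψ ih₁ ih₂ =>
    simp only [BoundedFormula.Realize]
    exact imp_congr (ih₁ s hs hv x hx) (ih₂ s hs hv x hx)
  | all φ ih =>
    simp only [BoundedFormula.Realize]
    have key : ∀ p : M × N, S (insert p s) →
        (φ.Realize (fun i => (v i).1) (Fin.snoc (fun i => (x i).1) p.1) ↔
          φ.Realize (fun i => (v i).2) (Fin.snoc (fun i => (x i).2) p.2)) := by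
      intro p hp
      have := ih _ hp (fun i => Set.mem_insert_of_mem _ (hv i)) (Fin.snoc x p) (by
        intro i
        refine Fin.lastCases ?_ (fun i => ?_) i
        · simp
        · simpa using Or.inr (hx i))
      have h1 : (fun i => ((Fin.snoc x p : Fin _ → M × N) i).1) =
          Fin.snoc (fun i => (x i).1) p.1 := by
        ext i; refine Fin.lastCases ?_ (fun i => ?_) i <;> simp
      have h2 : (fun i => ((Fin.snoc x p : Fin _ → M × N) i).2) =
          Fin.snoc (fun i => (x i).2) p.2 := by
        ext i; refine Fin.lastCases ?_ (fun i => ?_) i <;> simp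
      rwa [h1, h2] at this
    constructor
    · intro h b
      obtain ⟨a, ha⟩ := hS.back s hs b
      exact (key _ ha).1 (h a)
    · intro h a
      obtain ⟨b, hb⟩ := hS.forth s hs a
      exact (key _ hb).2 (h b)

theorem IsBackForth.realize_formula_iff {S : Set (M × N) → Prop} (hS : IsBackForth S)
    (hL : ∀ s, S s → PreservesAtoms L s) {n : ℕ} (φ : L.Formula (Fin n)) (a : Fin n → M)
    (b : Fin n → N) (h : S (Set.range fun i => (a i, b i))) : φ.Realize a ↔ φ.Realize b := by
  have := hS.realize_iff hL φ _ h (fun i => (a i, b i)) (fun i => ⟨i, rfl⟩) Fin.elim0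
    (fun i => i.elim0)
  simp only [Formula.Realize]
  convert! this using 2

theorem IsBackForth.elementarilyEquivalent {S : Set (M × N) → Prop} (hS : IsBackForth S)
    (hL : ∀ s, S s → PreservesAtoms L s) (h : S ∅) : M ≅[L] N := by
  rw [elementarilyEquivalent_iff]
  intro φ
  have := hS.realize_iff hL φ _ h (fun i => i.elim) (fun i => i.elim) Fin.elim0 (fun i => i.elim0)
  simp only [Sentence.Realize, Formula.Realize]
  convert! this using 2

-- A chain of members takes in the enumerations of both sides alternately; its union is the graph of
-- an isomorphism.
open Classical in
theorem IsBackForth.nonempty_equiv [Countable M] [Countable N] [Nonempty M] [Nonempty N]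
    {S : Set (M × N) → Prop} (hS : IsBackForth S)
    (hL : ∀ s, S s → PreservesAtoms L s) (h : S ∅) : Nonempty (M ≃[L] N) := by
  obtain ⟨a, ha⟩ := exists_surjective_nat M
  obtain ⟨b, hb⟩ := exists_surjective_nat N
  choose F hF using fun s : {s // S s} => hS.forth s.1 s.2
  choose G hG using fun s : {s // S s} => hS.back s.1 s.2
  let step (k : ℕ) (s : {s // S s}) : {s // S s} :=
    ⟨_, hG ⟨_, hF s (a k)⟩ (b k)⟩
  let c : ℕ → {s // S s} := fun k => Nat.rec ⟨∅, h⟩ step k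
  have hstep : ∀ k, (c k).1 ⊆ (c (k + 1)).1 := fun k p hp =>
    Set.mem_insert_of_mem _ (Set.mem_insert_of_mem _ hp)
  have hmono : Monotone fun k => (c k).1 := monotone_nat_of_le_succ hstep
  have hdir : ∀ {n : ℕ} (x : Fin n → M × N), (∀ i, ∃ k, x i ∈ (c k).1) →
      ∃ k, ∀ i, x i ∈ (c k).1 := by
    intro n x hx
    choose k hk using hx
    exact ⟨Finset.univ.sup k, fun i => hmono (Finset.le_sup (Finset.mem_univ i)) (hk i)⟩
  have htot : ∀ x, ∃ y, ∃ k, (x, y) ∈ (c k).1 := by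
    intro x
    obtain ⟨k, rfl⟩ := ha x
    exact ⟨_, k + 1, Set.mem_insert_of_mem _ (Set.mem_insert _ _)⟩
  have hsur : ∀ y, ∃ x, ∃ k, (x, y) ∈ (c k).1 := by
    intro y
    obtain ⟨k, rfl⟩ := hb y
    exact ⟨_, k + 1, Set.mem_insert _ _⟩
  choose f hf using htot
  choose g hg using hsur
  have hpair : ∀ p q : M × N, (∃ k, p ∈ (c k).1) → (∃ k, q ∈ (c k).1) →
      (p.1 = q.1 ↔ p.2 = q.2) := by
    rintro p q ⟨k, hk⟩ ⟨l, hl⟩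
    exact (hL _ (c (max k l)).2).eq p (hmono (le_max_left k l) hk) q (hmono (le_max_right k l) hl)
  refine ⟨⟨⟨f, g, fun x => ?_, fun y => ?_⟩, fun {n} φ x => ?_, fun {n} R x => ?_⟩⟩
  · exact (hpair (g (f x), f x) (x, f x) (hg _) (hf _)).2 rfl
  · exact (hpair (g y, f (g y)) (g y, y) (hf _) (hg _)).1 rfl
  · obtain ⟨k, hk⟩ := hdir (fun i => (x i, f (x i))) fun i => hf _
    obtain ⟨l, hl⟩ := hf (Structure.funMap φ x)
    exact (((hL _ (c (max k l)).2).fn φ _ (fun i => hmono (le_max_left k l) (hk i)) _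
      (hmono (le_max_right k l) hl)).1 rfl).symm
  · obtain ⟨k, hk⟩ := hdir (fun i => (x i, f (x i))) fun i => hf _
    exact ((hL _ (c k).2).rel R _ hk).symm

end BackForth

/-! ## Relations closed under the function symbols -/

section Closed

variable {L : FirstOrder.Language.{u, v}} {M : Type w} {N : Type w'}

/-- A relation between two structures which preserves equality and the relation symbols, and is
closed under the function symbols. -/
structure IsClosedPartialIso (L : FirstOrder.Language.{u, v}) [L.Structure M] [L.Structure N]
    (r : Set (M × N)) : Prop where
  eq : ∀ p ∈ r, ∀ q ∈ r, p.1 = q.1 ↔ p.2 = q.2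
  rel : ∀ {n : ℕ} (R : L.Relations n) (x : Fin n → M × N), (∀ i, x i ∈ r) →
    (Structure.RelMap R (fun i => (x i).1) ↔ Structure.RelMap R fun i => (x i).2)
  fn : ∀ {n : ℕ} (F : L.Functions n) (x : Fin n → M × N), (∀ i, x i ∈ r) →
    (Structure.funMap F (fun i => (x i).1), Structure.funMap F (fun i => (x i).2)) ∈ r

variable [L.Structure M] [L.Structure N]

theorem IsClosedPartialIso.term_mem {r : Set (M × N)} (hr : IsClosedPartialIso L r) {α : Type*}
    (t : L.Term α) (v : α → M × N) (hv : ∀ i, v i ∈ r) :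
    (t.realize (fun i => (v i).1), t.realize fun i => (v i).2) ∈ r := by
  induction t with
  | var i => exact hv i
  | func F ts ih => exact hr.fn F _ ih

theorem IsClosedPartialIso.realize_iff {r : Set (M × N)} (hr : IsClosedPartialIso L r) {n : ℕ}
    {φ : L.Formula (Fin n)} (hφ : BoundedFormula.IsQF φ) (v : Fin n → M × N) (hv : ∀ i, v i ∈ r) :
    φ.Realize (fun i => (v i).1) ↔ φ.Realize fun i => (v i).2 := by
  have helim : (Sum.elim (fun i => (v i).1) (default : Fin 0 → M)) =
      fun i => (Sum.elim v (Fin.elim0 : Fin 0 → M × N) i).1 := by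
    ext (i | i); exacts [rfl, i.elim0]
  have helim' : (Sum.elim (fun i => (v i).2) (default : Fin 0 → N)) =
      fun i => (Sum.elim v (Fin.elim0 : Fin 0 → M × N) i).2 := by
    ext (i | i); exacts [rfl, i.elim0]
  have hvx : ∀ i, Sum.elim v (Fin.elim0 : Fin 0 → M × N) i ∈ r := by
    rintro (i | i); exacts [hv i, i.elim0]
  simp only [Formula.Realize]
  induction hφ with
  | falsum => rfl
  | of_isAtomic h =>
    cases h with
    | equal t₁ t₂ =>
      simp only [BoundedFormula.realize_bdEqual, helim, helim']
      exact hr.eq _ (hr.term_mem t₁ _ hvx) _ (hr.term_mem t₂ _ hvx)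
    | rel R ts =>
      simp only [BoundedFormula.realize_rel, helim, helim']
      exact hr.rel R _ fun i => hr.term_mem (ts i) _ hvx
  | imp _ _ ih₁ ih₂ => simp only [BoundedFormula.realize_imp, ih₁, ih₂]

/-- The generated substructures are matched by evaluating the same term on both sides. Equality and
relations between such values are atomic formulas in the tuple, and applying a function symbol gives
another term. -/
theorem isClosedPartialIso_of_qf {n : ℕ} (a : Fin n → M) (b : Fin n → N)
    (h : ∀ φ : L.Formula (Fin n), BoundedFormula.IsQF φ → (φ.Realize a ↔ φ.Realize b)) :
    IsClosedPartialIso L {p : M × N | ∃ t : L.Term (Fin n), p = (t.realize a, t.realize b)} where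
  eq := by
    rintro _ ⟨t, rfl⟩ _ ⟨t', rfl⟩
    have := h (Term.equal t t') (BoundedFormula.IsAtomic.equal _ _).isQF
    simpa only [Formula.realize_equal] using this
  rel := by
    intro k R x hx
    choose t ht using hx
    have := h (R.formula t) (BoundedFormula.IsAtomic.rel _ _).isQF
    simpa only [Formula.realize_rel, ht] using this
  fn := by
    intro k F x hx
    choose t ht using hx
    exact ⟨Term.func F t, by simp only [ht, Term.realize]⟩

end Closed

/-! ## Saturation -/

section Saturation

variable (L : FirstOrder.Language.{u, v}) (M : Type w)

/-- `ℵ₀`-saturation. -/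
def IsSaturated [L.Structure M] : Prop :=
  ∀ (n : ℕ) (x : Fin n → M) (p : Set (L.Formula (Fin (n + 1)))),
    (∀ q : Finset (L.Formula (Fin (n + 1))), ↑q ⊆ p → ∃ y, ∀ φ ∈ q, φ.Realize (Fin.snoc x y)) →
      ∃ y, ∀ φ ∈ p, φ.Realize (Fin.snoc x y : Fin (n + 1) → M)

/-- If each element violated some formula of the type, the finitely many violated formulas would be
a finite part without solution. -/
theorem isSaturated_of_finite [L.Structure M] [Finite M] : IsSaturated L M := by
  classical
  intro n x p hp
  by_contra! h
  choose φ hφ hφ' using h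
  have := Fintype.ofFinite M
  obtain ⟨y, hy⟩ := hp (Finset.univ.image φ) (by
    intro ψ hψ
    obtain ⟨y, -, rfl⟩ := Finset.mem_image.1 (Finset.mem_coe.1 hψ)
    exact hφ y)
  exact hφ' y (hy _ (Finset.mem_image_of_mem _ (Finset.mem_univ y)))

/-- The ultrapower over a nonprincipal ultrafilter on `ℕ` works: in coordinate `k`, choose an
element satisfying as long an initial segment of the enumerated type as possible, up to index `k`.
-/
theorem exists_isSaturated [Countable L.Symbols] [L.Structure M] [Nonempty M] :
    ∃ (N : Type w) (_ : L.Structure N) (_ : M ↪ₑ[L] N), IsSaturated L N := by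
  classical
  let U := Filter.hyperfilter ℕ
  let N := (U : Filter ℕ).Product fun _ => M
  refine ⟨N, inferInstanceAs (L.Structure ((U : Filter ℕ).Product fun _ => M)), ?_, ?_⟩
  · refine ⟨fun m => ((fun _ => m : ℕ → M) : (U : Filter ℕ).Product fun _ => M), fun n φ x => ?_⟩
    have := Ultraproduct.realize_formula_cast (u := U) φ (fun i (_ : ℕ) => x i)
    refine Iff.trans this ?_
    simp
  · intro n x p hp
    have hsurj : ∀ z : N, ∃ y : ℕ → M, z = (y : (U : Filter ℕ).Product fun _ => M) := fun z =>
      ⟨_, (Quotient.out_eq z).symm⟩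
    choose x' hx' using fun i => hsurj (x i)
    have hsnoc : ∀ y : ℕ → M,
        (Fin.snoc x (y : (U : Filter ℕ).Product fun _ => M) : Fin (n + 1) → N) =
        fun i => ((fun k => (Fin.snoc (fun i => x' i k) (y k) : Fin (n + 1) → M) i : ℕ → M) :
          (U : Filter ℕ).Product fun _ => M) := by
      intro y
      ext i
      refine Fin.lastCases ?_ (fun i => ?_) i
      · simp only [Fin.snoc_last]
        exact Fin.snoc_last (α := fun _ => N) _ _
      · simp only [Fin.snoc_castSucc]
        exact (Fin.snoc_castSucc (α := fun _ => N) _ _ _).trans (hx' i)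
    have hreal : ∀ (φ : L.Formula (Fin (n + 1))) (y : ℕ → M),
        φ.Realize (Fin.snoc x (y : (U : Filter ℕ).Product fun _ => M) : Fin (n + 1) → N) ↔
        ∀ᶠ k in U, φ.Realize (Fin.snoc (fun i => x' i k) (y k) : Fin (n + 1) → M) := by
      intro φ y
      rw [hsnoc]
      exact Ultraproduct.realize_formula_cast (u := U) φ
        (fun i k => (Fin.snoc (fun i => x' i k) (y k) : Fin (n + 1) → M) i)
    rcases p.eq_empty_or_nonempty with rfl | hne
    · obtain ⟨y, -⟩ := hp ∅ (by simp)
      exact ⟨y, by simp⟩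
    obtain ⟨φ, hφ⟩ := (Set.to_countable p).exists_eq_range hne
    let good (k j : ℕ) : Prop :=
      ∃ y : M, ∀ i ≤ j, (φ i).Realize (Fin.snoc (fun i => x' i k) y : Fin (n + 1) → M)
    have hgood : ∀ j, ∀ᶠ k in U, good k j := by
      intro j
      obtain ⟨z, hz⟩ := hp ((Finset.range (j + 1)).image φ) (by
        intro ψ hψ
        obtain ⟨i, -, rfl⟩ := Finset.mem_image.1 (Finset.mem_coe.1 hψ)
        rw [hφ]; exact ⟨i, rfl⟩)
      obtain ⟨y, rfl⟩ := hsurj z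
      have : ∀ᶠ k in (U : Filter ℕ), ∀ i ∈ Finset.range (j + 1),
          (φ i).Realize (Fin.snoc (fun i => x' i k) (y k) : Fin (n + 1) → M) := by
        rw [Filter.eventually_all_finset]
        intro i hi
        exact (hreal _ _).1 (hz _ (Finset.mem_image_of_mem _ hi))
      filter_upwards [this] with k hk
      exact ⟨y k, fun i hi => hk i (Finset.mem_range.2 (by omega))⟩
    -- The cut-off at `k` makes a largest good index exist, and costs nothing since almost every `k`
    -- exceeds a given `j`. If no index is good, the element is arbitrary.
    have hchoice : ∀ k, ∃ y : M, ∀ j ≤ k, good k j →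
        (φ j).Realize (Fin.snoc (fun i => x' i k) y : Fin (n + 1) → M) := by
      intro k
      by_cases h : ∃ j ≤ k, good k j
      · let j₀ := Nat.findGreatest (fun j => good k j) k
        have hj₀ : good k j₀ := by
          obtain ⟨j, hj, hj'⟩ := h
          exact Nat.findGreatest_spec (P := fun j => good k j) hj hj'
        obtain ⟨y, hy⟩ := hj₀
        exact ⟨y, fun j hj hj' => hy j (Nat.le_findGreatest hj hj')⟩
      · push Not at h
        exact ⟨Classical.arbitrary M, fun j hj hj' => absurd hj' (h j hj)⟩
    choose y hy using hchoice
    refine ⟨(y : (U : Filter ℕ).Product fun _ => M), ?_⟩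
    rw [hφ]
    rintro _ ⟨j, rfl⟩
    rw [hreal]
    have hev : ∀ᶠ k in (U : Filter ℕ), j ≤ k := by
      have := Filter.hyperfilter_le_cofinite (α := ℕ)
      rw [Nat.cofinite_eq_atTop] at this
      exact this (Filter.eventually_ge_atTop j)
    filter_upwards [hgood j, hev] with k hk hk'
    exact hy k j hk' hk

end Saturation

/-! ### Equality of types as a back-and-forth system. -/

/-- The finite relations between two structures, all of whose tuples have the same type. -/
structure SameType (L : FirstOrder.Language.{u, v}) {M : Type w} {N : Type w'} [L.Structure M]
    [L.Structure N] (s : Set (M × N)) : Prop where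
  finite : s.Finite
  realize_iff : ∀ (n : ℕ) (x : Fin n → M × N), (∀ i, x i ∈ s) → ∀ φ : L.Formula (Fin n),
    φ.Realize (fun i => (x i).1) ↔ φ.Realize fun i => (x i).2

section SameType

variable {L : FirstOrder.Language.{u, v}} {M : Type w} {N : Type w'} [L.Structure M]
  [L.Structure N]

theorem SameType.symm {s : Set (M × N)} (h : SameType L s) : SameType L (Prod.swap '' s) where
  finite := h.finite.image _
  realize_iff n x hx φ := by
    have := h.realize_iff n (fun i => (x i).swap) (fun i => by
      obtain ⟨p, hp, hp'⟩ := hx i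
      simpa [← hp'] using hp) φ
    exact this.symm

theorem sameType_of_tuple {n : ℕ} (a : Fin n → M) (b : Fin n → N)
    (h : ∀ φ : L.Formula (Fin n), φ.Realize a ↔ φ.Realize b) :
    SameType L (Set.range fun i => (a i, b i)) where
  finite := Set.finite_range _
  realize_iff k x hx φ := by
    choose g hg using hx
    have := h (φ.relabel g)
    rw [Formula.realize_relabel, Formula.realize_relabel] at this
    simpa only [← hg, Function.comp_def] using this

theorem sameType_empty (h : M ≅[L] N) : SameType L (∅ : Set (M × N)) := by
  have := sameType_of_tuple (L := L) (M := M) (N := N) (n := 0) Fin.elim0 Fin.elim0 (by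
    intro φ
    have := (elementarilyEquivalent_iff.1 h) (φ.relabel (fun i => i.elim0))
    simp only [Sentence.Realize, Formula.realize_relabel] at this
    convert! this using 2)
  simpa using this

/-- The formula saying that some element satisfies a finite set of formulas. -/
noncomputable def existsAll {n : ℕ} (q : Finset (L.Formula (Fin (n + 1)))) : L.Formula (Fin n) :=
  Formula.iExs (Fin 1) ((Formula.iInf fun φ : q => φ.1).relabel
    (Fin.snoc Sum.inl (Sum.inr 0) : Fin (n + 1) → Fin n ⊕ Fin 1))

theorem realize_existsAll {n : ℕ} (q : Finset (L.Formula (Fin (n + 1)))) (z : Fin n → M) :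
    (existsAll q).Realize z ↔ ∃ y, ∀ φ ∈ q, φ.Realize (Fin.snoc z y : Fin (n + 1) → M) := by
  have hz : ∀ i : Fin 1 → M, (Sum.elim z i ∘
      (Fin.snoc Sum.inl (Sum.inr 0) : Fin (n + 1) → Fin n ⊕ Fin 1)) =
      (Fin.snoc z (i 0) : Fin (n + 1) → M) := by
    intro i
    ext j
    refine Fin.lastCases ?_ (fun j => ?_) j <;> simp
  simp only [existsAll, Formula.realize_iExs, Formula.realize_relabel, hz, Formula.realize_iInf,
    Subtype.forall]
  constructor
  · rintro ⟨i, hi⟩; exact ⟨i 0, hi⟩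
  · rintro ⟨y, hy⟩; exact ⟨fun _ => y, hy⟩

/-- The type of `a` over the first coordinates, read over the second ones, is finitely satisfiable:
for a finite part this is a formula about the old tuple. -/
theorem SameType.forth (hN : IsSaturated L N) {s : Set (M × N)} (h : SameType L s) (a : M) :
    ∃ b, SameType L (insert (a, b) s) := by
  classical
  obtain ⟨n, x, hx⟩ := h.finite.fin_param
  obtain ⟨-, hx⟩ := hx
  have hxs : ∀ i, x i ∈ s := fun i => hx ▸ ⟨i, rfl⟩
  obtain ⟨b, hb⟩ := hN n (fun i => (x i).2)
    {φ | φ.Realize (Fin.snoc (fun i => (x i).1) a : Fin (n + 1) → M)} (by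
      intro q hq
      rw [← realize_existsAll, ← h.realize_iff n x hxs, realize_existsAll]
      exact ⟨a, fun φ hφ => hq hφ⟩)
  have hsnoc : ∀ φ : L.Formula (Fin (n + 1)),
      φ.Realize (Fin.snoc (fun i => (x i).1) a : Fin (n + 1) → M) ↔
      φ.Realize (Fin.snoc (fun i => (x i).2) b : Fin (n + 1) → N) := by
    intro φ
    refine ⟨hb φ, fun h1 => ?_⟩
    -- The type is complete, so it contains the negation of every formula failing at `a`.
    by_contra h2
    exact (Formula.realize_not.1 (hb φ.not (Formula.realize_not.2 h2))) h1
  have := sameType_of_tuple _ _ hsnoc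
  refine ⟨b, ?_⟩
  convert this using 1
  ext p
  simp only [Set.mem_insert_iff, Set.mem_range]
  constructor
  · rintro (rfl | hp)
    · exact ⟨Fin.last n, by simp⟩
    · rw [← hx] at hp
      obtain ⟨i, rfl⟩ := hp
      exact ⟨i.castSucc, by simp⟩
  · rintro ⟨i, rfl⟩
    refine Fin.lastCases ?_ (fun i => ?_) i
    · simp
    · right; simpa using hxs i

theorem isBackForth_sameType (hM : IsSaturated L M) (hN : IsSaturated L N) :
    IsBackForth (SameType L : Set (M × N) → Prop) where
  forth s hs a := hs.forth hN a
  back s hs b := by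
    obtain ⟨a, ha⟩ := hs.symm.forth hM b
    refine ⟨a, ?_⟩
    convert ha.symm using 1
    rw [Set.image_insert_eq, ← Set.image_comp]
    simp

theorem SameType.preservesAtoms {s : Set (M × N)} (h : SameType L s) : PreservesAtoms L s where
  eq p hp q hq := by
    have := h.realize_iff 2 ![p, q] (by intro i; fin_cases i <;> assumption)
      (Term.equal (.var 0) (.var 1))
    simpa [Formula.realize_equal] using this
  rel {n} R x hx := by
    have := h.realize_iff n x hx (R.formula fun i => .var i)
    simpa [Formula.realize_rel] using this
  fn {n} F x hx p hp := by
    have := h.realize_iff (n + 1) (Fin.snoc x p) (by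
      intro i
      refine Fin.lastCases ?_ (fun i => ?_) i
      · simpa using hp
      · simpa using hx i)
      (Term.equal (Term.func F fun i => .var i.castSucc) (.var (Fin.last n)))
    simpa [Formula.realize_equal] using this

end SameType

/-! ## A criterion of quantifier elimination -/

section QuantifierElimination

variable {L : FirstOrder.Language.{0, 0}}

/-- Compactness, with the free variables turned into new constants. -/
theorem exists_model_realize (S : L.Theory) {n : ℕ} (p : Set (L.Formula (Fin n)))
    (h : ∀ q : Finset (L.Formula (Fin n)), ↑q ⊆ p →
      ∃ (M : Theory.ModelType.{0, 0, 0} S) (v : Fin n → M), ∀ φ ∈ q, φ.Realize v) :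
    ∃ (M : Theory.ModelType.{0, 0, 0} S) (v : Fin n → M), ∀ φ ∈ p, φ.Realize v := by
  classical
  let T' : (L[[Fin n]]).Theory :=
    (L.lhomWithConstants (Fin n)).onTheory S ∪ Formula.equivSentence '' p
  have hT' : T'.IsSatisfiable := by
    rw [Theory.isSatisfiable_iff_isFinitelySatisfiable]
    intro T₀ hT₀
    let q : Finset (L.Formula (Fin n)) :=
      (T₀.image Formula.equivSentence.symm).filter fun φ => φ ∈ p
    obtain ⟨M, v, hv⟩ := h q (by
      intro φ hφ
      exact (Finset.mem_filter.1 (Finset.mem_coe.1 hφ)).2)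
    letI := constantsOn.structure v
    have : M ⊨ (T₀ : (L[[Fin n]]).Theory) := by
      refine ⟨fun φ hφ => ?_⟩
      rcases hT₀ hφ with h1 | ⟨ψ, hψ, rfl⟩
      · have : M ⊨ (L.lhomWithConstants (Fin n)).onTheory S :=
          (LHom.onTheory_model _ _).2 M.is_model
        exact this.realize_of_mem φ h1
      · rw [Formula.realize_equivSentence]
        refine hv ψ (Finset.mem_filter.2 ⟨Finset.mem_image.2 ⟨_, hφ, ?_⟩, hψ⟩)
        exact Equiv.symm_apply_apply _ _
    exact Theory.Model.isSatisfiable M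
  obtain ⟨M⟩ := hT'
  letI : L.Structure M := (L.lhomWithConstants (Fin n)).reduct M
  have : (L.lhomWithConstants (Fin n)).IsExpansionOn M := LHom.isExpansionOn_reduct _ _
  have hM := M.is_model
  have h1 : M ⊨ S := (LHom.onTheory_model (L.lhomWithConstants (Fin n)) S).1
    (hM.mono Set.subset_union_left)
  refine ⟨Theory.ModelType.of S M, fun i => ((L.con i : (L[[Fin n]]).Constants) : M),
    fun φ hφ => ?_⟩
  have := hM.realize_of_mem (Formula.equivSentence φ) (Or.inr ⟨φ, hφ, rfl⟩)
  rwa [Formula.realize_equivSentence] at this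

theorem exists_isQF_conj {n : ℕ} (q : Finset (L.Formula (Fin n)))
    (hq : ∀ φ ∈ q, BoundedFormula.IsQF φ) :
    ∃ ψ : L.Formula (Fin n), BoundedFormula.IsQF ψ ∧
      ∀ (M : Type) [L.Structure M] (v : Fin n → M), ψ.Realize v ↔ ∀ φ ∈ q, φ.Realize v := by
  classical
  induction q using Finset.induction_on with
  | empty => exact ⟨⊤, BoundedFormula.IsQF.top, by simp⟩
  | insert φ q _ ih =>
    obtain ⟨ψ, h1, h2⟩ := ih fun φ hφ => hq φ (Finset.mem_insert_of_mem hφ)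
    refine ⟨φ ⊓ ψ, (hq φ (Finset.mem_insert_self _ _)).inf h1, fun M _ v => ?_⟩
    rw [Formula.realize_inf, h2, Finset.forall_mem_insert]

/-- Two uses of compactness. If no quantifier-free consequence of `φ` implies `φ`, some `b`
satisfies all of them but not `φ`. Then the quantifier-free type of `b` is consistent with `φ`, and
a realization `a` of both contradicts the hypothesis. -/
theorem eliminatesQuantifiers_of_qf (S : L.Theory)
    (h : ∀ (M N : Theory.ModelType.{0, 0, 0} S) (n : ℕ) (a : Fin n → M) (b : Fin n → N),
      (∀ ψ : L.Formula (Fin n), BoundedFormula.IsQF ψ → (ψ.Realize a ↔ ψ.Realize b)) →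
      ∀ φ : L.Formula (Fin n), φ.Realize a → φ.Realize b) :
    EliminatesQuantifiers S := by
  classical
  intro n φ
  let Γ : Set (L.Formula (Fin n)) := {ψ | BoundedFormula.IsQF ψ ∧
    ∀ (M : Theory.ModelType.{0, 0, 0} S) (v : Fin n → M), φ.Realize v → ψ.Realize v}
  by_cases hΓ : ∃ ψ ∈ Γ, ∀ (M : Theory.ModelType.{0, 0, 0} S) (v : Fin n → M),
      ψ.Realize v → φ.Realize v
  · obtain ⟨ψ, ⟨h1, h2⟩, h3⟩ := hΓ
    refine ⟨ψ, h1, fun M v xs => ?_⟩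
    rw [BoundedFormula.realize_iff, Subsingleton.elim xs default]
    exact ⟨h2 M v, h3 M v⟩
  exfalso
  push Not at hΓ
  obtain ⟨N, b, hb⟩ := exists_model_realize S (Γ ∪ {φ.not}) (by
    intro q hq
    obtain ⟨ψ, h1, h2⟩ := exists_isQF_conj (q.filter (· ∈ Γ))
      fun φ hφ => (Finset.mem_filter.1 hφ).2.1
    obtain ⟨M, v, hv, hv'⟩ := hΓ ψ ⟨h1, fun M v hv => (h2 M v).2 fun χ hχ =>
      (Finset.mem_filter.1 hχ).2.2 M v hv⟩
    refine ⟨M, v, fun χ hχ => ?_⟩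
    rcases hq hχ with h3 | h3
    · exact (h2 M v).1 hv χ (Finset.mem_filter.2 ⟨hχ, h3⟩)
    · rw [Set.mem_singleton_iff.1 h3]
      exact Formula.realize_not.2 hv')
  have hbφ : ¬ φ.Realize b := Formula.realize_not.1 (hb _ (Or.inr rfl))
  obtain ⟨M, a, ha⟩ := exists_model_realize S
    ({ψ | BoundedFormula.IsQF ψ ∧ ψ.Realize b} ∪ {φ}) (by
    intro q hq
    obtain ⟨ψ, h1, h2⟩ := exists_isQF_conj
      (q.filter fun χ => BoundedFormula.IsQF χ ∧ χ.Realize b)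
      fun φ hφ => (Finset.mem_filter.1 hφ).2.1
    by_contra! hcon
    have hψb : ψ.Realize b := (h2 N b).2 fun χ hχ => (Finset.mem_filter.1 hχ).2.2
    -- If `φ` refutes the finite part `ψ` of the quantifier-free type of `b`, then `¬ψ` is a
    -- quantifier-free consequence of `φ`, hence true at `b`.
    have : ψ.not ∈ Γ := by
      refine ⟨h1.not, fun M v hv => Formula.realize_not.2 fun hψ => ?_⟩
      obtain ⟨χ, hχ, hχ'⟩ := hcon M v
      rcases hq hχ with h3 | h3
      · exact hχ' ((h2 M v).1 hψ χ (Finset.mem_filter.2 ⟨hχ, h3⟩))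
      · rw [Set.mem_singleton_iff.1 h3] at hχ'
        exact hχ' hv
    exact Formula.realize_not.1 (hb _ (Or.inl this)) hψb)
  refine hbφ (h M N n a b (fun ψ hψ => ⟨fun h1 => ?_, fun h1 => ha ψ (Or.inl ⟨hψ, h1⟩)⟩) φ
    (ha φ (Or.inr rfl)))
  by_contra h2
  exact Formula.realize_not.1 (ha ψ.not (Or.inl ⟨hψ.not, Formula.realize_not.2 h2⟩)) h1

end QuantifierElimination

/-! ## Realization of formulas in the languages of trees -/

section Realize

variable {M : Type u}

theorem snoc_default (a : M) : (Fin.snoc (default : Fin 0 → M) a : Fin 1 → M) = ![a] := by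
  ext i; fin_cases i; rfl

theorem snoc_one (a b : M) : (Fin.snoc ![a] b : Fin 2 → M) = ![a, b] := by
  ext i; fin_cases i <;> rfl

theorem snoc_two (a b c : M) : (Fin.snoc ![a, b] c : Fin 3 → M) = ![a, b, c] := by
  ext i; fin_cases i <;> rfl

variable {κ : Type} {n : ℕ} [(treeLang κ).Structure M] {v : Empty → M} {xs : Fin n → M}

@[simp]
theorem realize_up (t : Tm κ n) (a : M) :
    (up t).realize (Sum.elim v (Fin.snoc xs a)) = t.realize (Sum.elim v xs) := by
  rw [up, Term.realize_relabel]
  congr 1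
  ext (i | i)
  · rfl
  · simp

@[simp]
theorem realize_new (a : M) :
    (new : Tm κ (n + 1)).realize (Sum.elim v (Fin.snoc xs a)) = a := by
  simp [new]

@[simp]
theorem realize_meet (s t : Tm κ n) : (meet s t).realize (Sum.elim v xs) =
    Structure.funMap (L := treeLang κ) TreeFunc.meet
      ![s.realize (Sum.elim v xs), t.realize (Sum.elim v xs)] :=
  Term.realize_functions_apply₂

@[simp]
theorem realize_app (i : κ) (t : Tm κ n) : (app i t).realize (Sum.elim v xs) =
    Structure.funMap (L := treeLang κ) (TreeFunc.fn i) ![t.realize (Sum.elim v xs)] :=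
  Term.realize_functions_apply₁

@[simp]
theorem realize_le (s t : Tm κ n) : (le s t).Realize v xs ↔
    Structure.RelMap (L := treeLang κ) TreeRel.le
      ![s.realize (Sum.elim v xs), t.realize (Sum.elim v xs)] :=
  BoundedFormula.realize_rel₂

@[simp]
theorem realize_lt (s t : Tm κ n) : (lt s t).Realize v xs ↔
    Structure.RelMap (L := treeLang κ) TreeRel.le
      ![s.realize (Sum.elim v xs), t.realize (Sum.elim v xs)] ∧
    s.realize (Sum.elim v xs) ≠ t.realize (Sum.elim v xs) := by
  simp [lt]

@[simp]
theorem realize_node (t : Tm κ n) : (node t).Realize v xs ↔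
    Structure.RelMap (L := treeLang κ) TreeRel.node ![t.realize (Sum.elim v xs)] :=
  BoundedFormula.realize_rel₁

@[simp]
theorem realize_leaf (t : Tm κ n) : (leaf t).Realize v xs ↔
    Structure.RelMap (L := treeLang κ) TreeRel.leaf ![t.realize (Sum.elim v xs)] :=
  BoundedFormula.realize_rel₁

@[simp]
theorem realize_dom (i : κ) (t : Tm κ n) : (dom i t).Realize v xs ↔
    Structure.RelMap (L := treeLang κ) (TreeRel.dom i) ![t.realize (Sum.elim v xs)] :=
  BoundedFormula.realize_rel₁

@[simp]
theorem realize_im (i : κ) (t : Tm κ n) : (im i t).Realize v xs ↔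
    Structure.RelMap (L := treeLang κ) (TreeRel.im i) ![t.realize (Sum.elim v xs)] :=
  BoundedFormula.realize_rel₁

theorem realize_cov (s t : Tm κ n) : (cov s t).Realize v xs ↔
    (Structure.RelMap (L := treeLang κ) TreeRel.le
      ![s.realize (Sum.elim v xs), t.realize (Sum.elim v xs)] ∧
      s.realize (Sum.elim v xs) ≠ t.realize (Sum.elim v xs)) ∧
    ∀ c, ¬ ((Structure.RelMap (L := treeLang κ) TreeRel.le ![s.realize (Sum.elim v xs), c] ∧
      s.realize (Sum.elim v xs) ≠ c) ∧
      Structure.RelMap (L := treeLang κ) TreeRel.le ![c, t.realize (Sum.elim v xs)] ∧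
      c ≠ t.realize (Sum.elim v xs)) := by
  simp only [cov, BoundedFormula.realize_inf, realize_lt, BoundedFormula.realize_all,
    BoundedFormula.realize_not, realize_up, realize_new]

end Realize

/-! ### Trees with partial functions as first-order structures. -/

section TreeStructure

variable {M : Type u} {κ : Type}

open Classical in
/-- The total function extending a partial function by the identity. -/
noncomputable def total (g : M →. M) (x : M) : M := if h : (g x).Dom then (g x).get h else x

theorem mem_iff_total {g : M →. M} {x y : M} : y ∈ g x ↔ (g x).Dom ∧ total g x = y := by
  constructor
  · rintro ⟨h, rfl⟩
    exact ⟨h, by rw [total, dif_pos h]⟩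
  · rintro ⟨h, rfl⟩
    exact ⟨h, by rw [total, dif_pos h]⟩

theorem total_of_not_dom {g : M →. M} {x : M} (h : ¬ (g x).Dom) : total g x = x := by
  rw [total, dif_neg h]

theorem total_of_mem {g : M →. M} {x y : M} (h : y ∈ g x) : total g x = y :=
  (mem_iff_total.1 h).2

theorem mem_ran_iff {g : M →. M} {y : M} : y ∈ g.ran ↔ ∃ x, (g x).Dom ∧ total g x = y := by
  simp only [← mem_iff_total]; rfl

theorem total_eq_iff {g : M →. M} {x y : M} :
    total g x = y ↔ y ∈ g x ∨ (¬ (g x).Dom ∧ x = y) := by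
  by_cases h : (g x).Dom
  · simp [mem_iff_total, h]
  · simp [mem_iff_total, h, total_of_not_dom h]

theorem structure_ext {s t : (treeLang κ).Structure M}
    (hmeet : ∀ a b, s.funMap TreeFunc.meet ![a, b] = t.funMap TreeFunc.meet ![a, b])
    (hfn : ∀ i a, s.funMap (TreeFunc.fn i) ![a] = t.funMap (TreeFunc.fn i) ![a])
    (hle : ∀ a b, s.RelMap TreeRel.le ![a, b] ↔ t.RelMap TreeRel.le ![a, b])
    (hnode : ∀ a, s.RelMap TreeRel.node ![a] ↔ t.RelMap TreeRel.node ![a])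
    (hleaf : ∀ a, s.RelMap TreeRel.leaf ![a] ↔ t.RelMap TreeRel.leaf ![a])
    (hdom : ∀ i a, s.RelMap (TreeRel.dom i) ![a] ↔ t.RelMap (TreeRel.dom i) ![a])
    (him : ∀ i a, s.RelMap (TreeRel.im i) ![a] ↔ t.RelMap (TreeRel.im i) ![a]) : s = t := by
  have h1 : ∀ x : Fin 1 → M, x = ![x 0] := by intro x; ext i; fin_cases i; rfl
  have h2 : ∀ x : Fin 2 → M, x = ![x 0, x 1] := by intro x; ext i; fin_cases i <;> rfl
  refine Structure.ext ?_ ?_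
  · funext n f x
    cases f with
    | meet => rw [h2 x]; exact hmeet _ _
    | fn i => rw [h1 x]; exact hfn i _
  · funext n R x
    refine propext ?_
    cases R with
    | le => rw [h2 x]; exact hle _ _
    | node => rw [h1 x]; exact hnode _
    | leaf => rw [h1 x]; exact hleaf _
    | dom i => rw [h1 x]; exact hdom i _
    | im i => rw [h1 x]; exact him i _

section Eval

variable [SemilatticeInf M] (g : κ → M →. M)

@[simp]
theorem funMap_meet (a b : M) : @Structure.funMap (treeLang κ) M (treeStructure g) _
    TreeFunc.meet ![a, b] = a ⊓ b := rfl

@[simp]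
theorem funMap_fn (i : κ) (a : M) : @Structure.funMap (treeLang κ) M (treeStructure g) _
    (TreeFunc.fn i) ![a] = total (g i) a := rfl

@[simp]
theorem relMap_le (a b : M) : @Structure.RelMap (treeLang κ) M (treeStructure g) _
    TreeRel.le ![a, b] ↔ a ≤ b := Iff.rfl

@[simp]
theorem relMap_node (a : M) : @Structure.RelMap (treeLang κ) M (treeStructure g) _
    TreeRel.node ![a] ↔ IsNode a := Iff.rfl

@[simp]
theorem relMap_leaf (a : M) : @Structure.RelMap (treeLang κ) M (treeStructure g) _
    TreeRel.leaf ![a] ↔ IsMax a := Iff.rfl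

@[simp]
theorem relMap_dom (i : κ) (a : M) : @Structure.RelMap (treeLang κ) M (treeStructure g) _
    (TreeRel.dom i) ![a] ↔ (g i a).Dom := Iff.rfl

@[simp]
theorem relMap_im (i : κ) (a : M) : @Structure.RelMap (treeLang κ) M (treeStructure g) _
    (TreeRel.im i) ![a] ↔ a ∈ (g i).ran := Iff.rfl

end Eval

/-- The axioms describe exactly the structures coming from a good tree with partial functions, so
models can be handled as trees and axioms as statements about the order. -/
theorem exists_eq_treeStructure [str : (treeLang κ).Structure M] (h₁ : M ⊨ goodTreeAxioms κ)
    (h₂ : ∀ i : κ, M ⊨ partialFunAxioms i) :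
    ∃ (_ : SemilatticeInf M) (g : κ → M →. M), IsGoodTree M ∧ str = treeStructure g := by
  have hax := h₁.realize_of_mem
  simp only [goodTreeAxioms, Set.mem_insert_iff, Set.mem_singleton_iff, forall_eq_or_imp,
    forall_eq, Sentence.Realize, Formula.Realize, BoundedFormula.realize_all,
    BoundedFormula.realize_imp, BoundedFormula.realize_inf, BoundedFormula.realize_sup,
    BoundedFormula.realize_iff, BoundedFormula.realize_ex, BoundedFormula.realize_not,
    BoundedFormula.realize_bdEqual, realize_le, realize_leaf, realize_node, realize_meet,
    snoc_default, snoc_one, snoc_two] at hax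
  obtain ⟨hrefl, hanti, htrans, hchain, hmeet, hmeet', hleaf, hnode, habove, hor⟩ := hax
  dsimp at hrefl hanti htrans hchain hmeet hmeet' hleaf hnode habove hor
  have hpf := fun i => (h₂ i).realize_of_mem
  simp only [partialFunAxioms, Set.mem_insert_iff, Set.mem_singleton_iff, forall_eq_or_imp,
    forall_eq, Sentence.Realize, Formula.Realize, BoundedFormula.realize_all,
    BoundedFormula.realize_imp, BoundedFormula.realize_inf, 
    BoundedFormula.realize_iff, BoundedFormula.realize_ex, BoundedFormula.realize_not,
    BoundedFormula.realize_bdEqual, realize_dom, realize_im, realize_app,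
    snoc_default, snoc_one] at hpf
  dsimp at hpf
  let sl : SemilatticeInf M :=
    { le := fun a b => Structure.RelMap (L := treeLang κ) TreeRel.le ![a, b]
      le_refl := hrefl
      le_trans := fun a b c => htrans a b c
      le_antisymm := fun a b => hanti a b
      inf := fun a b => Structure.funMap (L := treeLang κ) TreeFunc.meet ![a, b]
      inf_le_left := fun a b => (hmeet a b).1
      inf_le_right := fun a b => (hmeet a b).2
      le_inf := fun a b c h h' => hmeet' b c a h h' }
  -- Each partial function is the function symbol cut down to its domain predicate.
  let g : κ → M →. M := fun i x => ⟨Structure.RelMap (L := treeLang κ) (TreeRel.dom i) ![x],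
    fun _ => Structure.funMap (L := treeLang κ) (TreeFunc.fn i) ![x]⟩
  have hmax : ∀ a : M, Structure.RelMap (L := treeLang κ) TreeRel.leaf ![a] ↔ IsMax a :=
    fun a => hleaf a
  have hnd : ∀ a : M, Structure.RelMap (L := treeLang κ) TreeRel.node ![a] ↔ IsNode a :=
    fun a => hnode a
  refine ⟨sl, g, ⟨fun x y z hy hz => hchain x y z hy hz, fun x => ?_, fun x => ?_⟩, ?_⟩
  · obtain ⟨y, h1, h2⟩ := habove x
    exact ⟨y, h1, (hmax y).1 h2⟩
  · rw [← hmax, ← hnd]; exact hor x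
  · refine structure_ext (fun a b => rfl) (fun i a => ?_) (fun a b => Iff.rfl) hnd hmax
      (fun i a => Iff.rfl) (fun i a => ?_)
    · rw [funMap_fn]
      by_cases h : (g i a).Dom
      · rw [total, dif_pos h]
      · rw [total_of_not_dom h]
        exact (hpf i).1 a h
    · refine ((hpf i).2 a).trans ?_
      rw [relMap_im]
      constructor
      · rintro ⟨x, h1, h2⟩
        exact ⟨x, h1, h2⟩
      · rintro ⟨x, h1, h2⟩
        exact ⟨x, h1, h2⟩

theorem isNode_iff [SemilatticeInf M] (h : IsGoodTree M) (x : M) : IsNode x ↔ ¬ IsMax x := by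
  constructor
  · rintro ⟨y, z, hne, rfl⟩
    exact Ext.not_isMax_inf_of_ne hne
  · exact (h.leaf_or_node x).resolve_left

theorem model_goodTreeAxioms [SemilatticeInf M] (g : κ → M →. M) (h : IsGoodTree M) :
    letI := treeStructure g
    M ⊨ goodTreeAxioms κ := by
  let _ := treeStructure g
  refine ⟨?_⟩
  simp only [goodTreeAxioms, Set.mem_insert_iff, Set.mem_singleton_iff, forall_eq_or_imp,
    forall_eq, Sentence.Realize, Formula.Realize, BoundedFormula.realize_all,
    BoundedFormula.realize_imp, BoundedFormula.realize_inf, BoundedFormula.realize_sup,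
    BoundedFormula.realize_iff, BoundedFormula.realize_ex, BoundedFormula.realize_not,
    BoundedFormula.realize_bdEqual, realize_le, realize_leaf, realize_node, realize_meet,
    snoc_default, snoc_one, snoc_two, relMap_le, relMap_node,
    relMap_leaf, funMap_meet]
  refine ⟨fun a => le_rfl, fun a b => le_antisymm, fun a b c => le_trans, h.chain_below,
    fun a b => ⟨inf_le_left, inf_le_right⟩, fun a b c => le_inf, fun a => Iff.rfl,
    fun a => Iff.rfl, h.leaf_above, h.leaf_or_node⟩

theorem model_partialFunAxioms [SemilatticeInf M] (g : κ → M →. M) (i : κ) :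
    letI := treeStructure g
    M ⊨ partialFunAxioms i := by
  let _ := treeStructure g
  refine ⟨?_⟩
  simp only [partialFunAxioms, Set.mem_insert_iff, Set.mem_singleton_iff, forall_eq_or_imp,
    forall_eq, Sentence.Realize, Formula.Realize, BoundedFormula.realize_all,
    BoundedFormula.realize_imp, BoundedFormula.realize_inf, 
    BoundedFormula.realize_iff, BoundedFormula.realize_ex, BoundedFormula.realize_not,
    BoundedFormula.realize_bdEqual, realize_dom, realize_im, realize_app,
    snoc_default, snoc_one, relMap_dom, relMap_im, funMap_fn]
  exact ⟨fun a => total_of_not_dom, fun a => mem_ran_iff⟩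

/-! ### The predecessor function -/

/-- `pred` chooses some covered element; the elements below `x` form a chain, so there is only one
to choose. -/
theorem mem_pred [SemilatticeInf M] (h : IsGoodTree M) {x y : M} : y ∈ pred M x ↔ y ⋖ x := by
  constructor
  · rintro ⟨h1, rfl⟩
    exact h1.choose_spec
  · intro hy
    have hd : ∃ y, y ⋖ x := ⟨y, hy⟩
    refine ⟨hd, ?_⟩
    have hz : hd.choose ⋖ x := hd.choose_spec
    change hd.choose = y
    rcases h.chain_below x _ _ hy.le hz.le with h1 | h1
    · rcases h1.eq_or_lt with h2 | h2
      · exact h2.symm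
      · exact absurd hz.lt (hy.2 h2)
    · rcases h1.eq_or_lt with h2 | h2
      · exact h2
      · exact absurd hy.lt (hz.2 h2)

theorem pred_dom [SemilatticeInf M] {x : M} : (pred M x).Dom ↔ ∃ y, y ⋖ x := Iff.rfl

/-- The axioms for `p`, `D` and `F` are explicit definitions, so the expansion of a given tree is
unique. -/
theorem eq_treeStructure_withPred [SemilatticeInf M] (h : IsGoodTree M) (g : κ → M →. M)
    [str : (treeLang (AddP κ)).Structure M]
    (hred : (treeMap AddP.old).reduct M = treeStructure g) (hp : M ⊨ predAxioms κ) :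
    str = treeStructure (withPred g) := by
  have hmeet : ∀ a b : M, Structure.funMap (L := treeLang (AddP κ)) TreeFunc.meet ![a, b] = a ⊓ b :=
    fun a b => congrArg (fun s : (treeLang κ).Structure M => s.funMap TreeFunc.meet ![a, b]) hred
  have hfn : ∀ (i) (a : M), Structure.funMap (L := treeLang (AddP κ)) (TreeFunc.fn (.old i)) ![a] =
      total (g i) a :=
    fun i a => congrArg (fun s : (treeLang κ).Structure M => s.funMap (TreeFunc.fn i) ![a]) hred
  have hle : ∀ a b : M, Structure.RelMap (L := treeLang (AddP κ)) TreeRel.le ![a, b] ↔ a ≤ b :=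
    fun a b => (congrArg (fun s : (treeLang κ).Structure M => s.RelMap TreeRel.le ![a, b]) hred).to_iff
  have hnode : ∀ a : M, Structure.RelMap (L := treeLang (AddP κ)) TreeRel.node ![a] ↔ IsNode a :=
    fun a => (congrArg (fun s : (treeLang κ).Structure M => s.RelMap TreeRel.node ![a]) hred).to_iff
  have hleaf : ∀ a : M, Structure.RelMap (L := treeLang (AddP κ)) TreeRel.leaf ![a] ↔ IsMax a :=
    fun a => (congrArg (fun s : (treeLang κ).Structure M => s.RelMap TreeRel.leaf ![a]) hred).to_iff
  have hdom : ∀ (i) (a : M), Structure.RelMap (L := treeLang (AddP κ)) (TreeRel.dom (.old i)) ![a] ↔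
      (g i a).Dom :=
    fun i a => (congrArg (fun s : (treeLang κ).Structure M => s.RelMap (TreeRel.dom i) ![a]) hred).to_iff
  have him : ∀ (i) (a : M), Structure.RelMap (L := treeLang (AddP κ)) (TreeRel.im (.old i)) ![a] ↔
      a ∈ (g i).ran :=
    fun i a => (congrArg (fun s : (treeLang κ).Structure M => s.RelMap (TreeRel.im i) ![a]) hred).to_iff
  have hcov : ∀ a b : M, ((a ≤ b ∧ a ≠ b) ∧ ∀ c : M, ¬ ((a ≤ c ∧ a ≠ c) ∧ c ≤ b ∧ c ≠ b)) ↔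
      a ⋖ b := by
    intro a b
    simp only [← lt_iff_le_and_ne, CovBy, not_and]
  have hax := hp.realize_of_mem
  simp only [predAxioms, partialFunAxioms, Set.mem_union, or_imp, forall_and,
    Set.mem_insert_iff, Set.mem_singleton_iff, forall_eq_or_imp,
    forall_eq, Sentence.Realize, Formula.Realize, BoundedFormula.realize_all,
    BoundedFormula.realize_imp, BoundedFormula.realize_inf, realize_cov,
    BoundedFormula.realize_iff, BoundedFormula.realize_ex, BoundedFormula.realize_not,
    BoundedFormula.realize_bdEqual, realize_dom, realize_im, realize_app,
    snoc_default, snoc_one, hle, hcov] at hax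
  dsimp at hax
  obtain ⟨⟨h1, h2⟩, h3, h4⟩ := hax
  have hold : ∀ a : M, (pred M a).Dom ↔
      Structure.RelMap (L := treeLang (AddP κ)) (TreeRel.dom .p) ![a] := fun a => (h3 a).symm
  have hpfn : ∀ a : M, Structure.funMap (L := treeLang (AddP κ)) (TreeFunc.fn .p) ![a] =
      total (pred M) a := by
    intro a
    by_cases hd : (pred M a).Dom
    · exact (total_of_mem ((mem_pred h).2 (h4 a ((hold a).1 hd)))).symm
    · rw [total_of_not_dom hd]
      exact h1 a fun h5 => hd ((hold a).2 h5)
  refine structure_ext hmeet ?_ hle hnode hleaf ?_ ?_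
  · rintro (i | _) a
    exacts [hfn i a, hpfn a]
  · rintro (i | _) a
    exacts [hdom i a, h3 a]
  · rintro (i | _) a
    · exact him i a
    · rw [relMap_im, h2, withPred, mem_ran_iff]
      simp only [hpfn, hold]

theorem model_predAxioms [SemilatticeInf M] (h : IsGoodTree M) (g : κ → M →. M) :
    letI := treeStructure (withPred g)
    M ⊨ predAxioms κ := by
  let _ := treeStructure (withPred g)
  have hcov : ∀ a b : M, ((a ≤ b ∧ a ≠ b) ∧ ∀ c : M, ¬ ((a ≤ c ∧ a ≠ c) ∧ c ≤ b ∧ c ≠ b)) ↔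
      a ⋖ b := by
    intro a b
    simp only [← lt_iff_le_and_ne, CovBy, not_and]
  refine Theory.Model.union (model_partialFunAxioms (withPred g) .p) ⟨?_⟩
  simp only [Set.mem_insert_iff, Set.mem_singleton_iff, forall_eq_or_imp,
    forall_eq, Sentence.Realize, Formula.Realize, BoundedFormula.realize_all,
    BoundedFormula.realize_imp, realize_cov, BoundedFormula.realize_iff, BoundedFormula.realize_ex,
    realize_dom, realize_app, snoc_default, snoc_one, relMap_le, hcov, relMap_dom, funMap_fn]
  exact ⟨fun a => Iff.rfl, fun a ha => (mem_pred h).1 (mem_iff_total.2 ⟨ha, rfl⟩)⟩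

theorem reduct_withPred [SemilatticeInf M] (g : κ → M →. M) :
    @LHom.reduct _ _ (treeMap AddP.old) M (treeStructure (withPred g)) = treeStructure g :=
  structure_ext (fun _ _ => rfl) (fun _ _ => rfl) (fun _ _ => Iff.rfl) (fun _ => Iff.rfl)
    (fun _ => Iff.rfl) (fun _ _ => Iff.rfl) (fun _ _ => Iff.rfl)

end TreeStructure

/-! ### Back-and-forth systems between trees -/

section BackForthTree

variable {M : Type u} {N : Type v} {S : Set (M × N) → Prop}

theorem IsBackForth.forall_iff (hS : IsBackForth S) {s : Set (M × N)} (hs : S s)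
    {P : M → Prop} {Q : N → Prop} (h : ∀ a b, S (insert (a, b) s) → (P a ↔ Q b)) :
    (∀ a, P a) ↔ ∀ b, Q b := by
  constructor
  · intro hP b
    obtain ⟨a, ha⟩ := hS.back s hs b
    exact (h a b ha).1 (hP a)
  · intro hQ a
    obtain ⟨b, hb⟩ := hS.forth s hs a
    exact (h a b hb).2 (hQ b)

theorem IsBackForth.exists_iff (hS : IsBackForth S) {s : Set (M × N)} (hs : S s)
    {P : M → Prop} {Q : N → Prop} (h : ∀ a b, S (insert (a, b) s) → (P a ↔ Q b)) :
    (∃ a, P a) ↔ ∃ b, Q b := by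
  rw [← not_iff_not, not_exists, not_exists]
  exact hS.forall_iff hs fun a b hab => not_congr (h a b hab)

variable [SemilatticeInf M] [SemilatticeInf N]

theorem inf_eq_iff_forall_le {a b c : M} : a ⊓ b = c ↔
    (c ≤ a ∧ c ≤ b) ∧ ∀ d, d ≤ a → d ≤ b → d ≤ c := by
  constructor
  · rintro rfl
    exact ⟨⟨inf_le_left, inf_le_right⟩, fun d => le_inf⟩
  · rintro ⟨⟨h1, h2⟩, h3⟩
    exact le_antisymm (h3 _ inf_le_left inf_le_right) (le_inf h1 h2)

/-- All members of the system preserve the order. -/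
def PreservesLE (S : Set (M × N) → Prop) : Prop :=
  ∀ s, S s → ∀ p ∈ s, ∀ q ∈ s, p.1 ≤ q.1 ↔ p.2 ≤ q.2

variable (hS : IsBackForth S) (hle : PreservesLE S)

include hle

theorem PreservesLE.eq_iff {s : Set (M × N)} (hs : S s) {p q : M × N} (hp : p ∈ s) (hq : q ∈ s) :
    p.1 = q.1 ↔ p.2 = q.2 := by
  rw [le_antisymm_iff, le_antisymm_iff, hle s hs p hp q hq, hle s hs q hq p hp]

theorem PreservesLE.lt_iff {s : Set (M × N)} (hs : S s) {p q : M × N} (hp : p ∈ s) (hq : q ∈ s) :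
    p.1 < q.1 ↔ p.2 < q.2 := by
  rw [lt_iff_le_not_ge, lt_iff_le_not_ge, hle s hs p hp q hq, hle s hs q hq p hp]

include hS

theorem IsBackForth.isMax_iff {s : Set (M × N)} (hs : S s) {p : M × N} (hp : p ∈ s) :
    IsMax p.1 ↔ IsMax p.2 :=
  hS.forall_iff hs fun a b hab => by
    have hp' : p ∈ insert (a, b) s := Set.mem_insert_of_mem _ hp
    rw [hle _ hab _ hp' _ (Set.mem_insert _ _), hle _ hab _ (Set.mem_insert _ _) _ hp']

theorem IsBackForth.covBy_iff {s : Set (M × N)} (hs : S s) {p q : M × N} (hp : p ∈ s)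
    (hq : q ∈ s) : p.1 ⋖ q.1 ↔ p.2 ⋖ q.2 :=
  and_congr (hle.lt_iff hs hp hq) (hS.forall_iff hs fun a b hab => by
    have hp' : p ∈ insert (a, b) s := Set.mem_insert_of_mem _ hp
    have hq' : q ∈ insert (a, b) s := Set.mem_insert_of_mem _ hq
    have hb : (a, b) ∈ insert (a, b) s := Set.mem_insert _ _
    rw [← hle.lt_iff hab hp' hb, ← hle.lt_iff hab hb hq'])

theorem IsBackForth.inf_eq_iff {s : Set (M × N)} (hs : S s) {p q r : M × N} (hp : p ∈ s)
    (hq : q ∈ s) (hr : r ∈ s) : p.1 ⊓ q.1 = r.1 ↔ p.2 ⊓ q.2 = r.2 := by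
  rw [inf_eq_iff_forall_le, inf_eq_iff_forall_le, hle s hs r hr p hp, hle s hs r hr q hq]
  refine and_congr_right fun _ => hS.forall_iff hs fun a b hab => ?_
  have hb : (a, b) ∈ insert (a, b) s := Set.mem_insert _ _
  rw [hle _ hab _ hb _ (Set.mem_insert_of_mem _ hp), hle _ hab _ hb _ (Set.mem_insert_of_mem _ hq),
    hle _ hab _ hb _ (Set.mem_insert_of_mem _ hr)]

variable {κ : Type} {g : κ → M →. M} {h : κ → N →. N}

/-- Only the order and the graphs have to be checked on members: leaves, meets, domains and images
are defined from them with one quantifier, which a back or forth step absorbs. -/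
theorem IsBackForth.preservesAtoms_tree (hM : IsGoodTree M) (hN : IsGoodTree N)
    (hg : ∀ s, S s → ∀ i, ∀ p ∈ s, ∀ q ∈ s, q.1 ∈ g i p.1 ↔ q.2 ∈ h i p.2) :
    ∀ s, S s → @PreservesAtoms M N (treeLang κ) (treeStructure g) (treeStructure h) s := by
  intro s hs
  have hdom : ∀ i, ∀ p ∈ s, (g i p.1).Dom ↔ (h i p.2).Dom := fun i p hp => by
    rw [Part.dom_iff_mem, Part.dom_iff_mem]
    exact hS.exists_iff hs fun a b hab =>
      hg _ hab i p (Set.mem_insert_of_mem _ hp) (a, b) (Set.mem_insert _ _)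
  refine @PreservesAtoms.mk _ _ _ (treeStructure g) (treeStructure h) s
    (fun p hp q hq => hle.eq_iff hs hp hq) ?_ ?_
  · intro n R x hx
    cases R with
    | le => exact hle s hs _ (hx 0) _ (hx 1)
    | node =>
      change IsNode (x 0).1 ↔ IsNode (x 0).2
      rw [isNode_iff hM, isNode_iff hN, hS.isMax_iff hle hs (hx 0)]
    | leaf => exact hS.isMax_iff hle hs (hx 0)
    | dom i => exact hdom i _ (hx 0)
    | im i =>
      refine hS.exists_iff hs fun a b hab => ?_
      exact hg _ hab i (a, b) (Set.mem_insert _ _) _ (Set.mem_insert_of_mem _ (hx 0))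
  · intro n F x hx p hp
    cases F with
    | meet => exact hS.inf_eq_iff hle hs (hx 0) (hx 1) hp
    | fn i =>
      change total (g i) (x 0).1 = p.1 ↔ total (h i) (x 0).2 = p.2
      rw [total_eq_iff, total_eq_iff, hdom i _ (hx 0), hle.eq_iff hs (hx 0) hp,
        hg s hs i _ (hx 0) _ hp]

theorem IsBackForth.preservesAtoms_withPred (hM : IsGoodTree M) (hN : IsGoodTree N)
    (hg : ∀ s, S s → ∀ i, ∀ p ∈ s, ∀ q ∈ s, q.1 ∈ g i p.1 ↔ q.2 ∈ h i p.2) :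
    ∀ s, S s → @PreservesAtoms M N (treeLang (AddP κ)) (treeStructure (withPred g))
      (treeStructure (withPred h)) s := by
  refine hS.preservesAtoms_tree hle hM hN ?_
  rintro s hs (i | _) p hp q hq
  · exact hg s hs i p hp q hq
  · change q.1 ∈ pred M p.1 ↔ q.2 ∈ pred N p.2
    rw [mem_pred hM, mem_pred hN, hS.covBy_iff hle hs hq hp]

end BackForthTree

/-! ## Saturated trees -/

section Countable

theorem countable_of_surjective_option {α β : Type} [Countable α] (f : Option α → β)
    (hf : Function.Surjective f) : Countable β := hf.countable

instance {κ : Type} [Countable κ] : Countable (AddE κ) :=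
  countable_of_surjective_option (fun o : Option κ => o.elim .e .old) (by
    rintro (i | _)
    exacts [⟨some i, rfl⟩, ⟨none, rfl⟩])

instance {κ : Type} [Countable κ] : Countable (AddP κ) :=
  countable_of_surjective_option (fun o : Option κ => o.elim .p .old) (by
    rintro (i | _)
    exacts [⟨some i, rfl⟩, ⟨none, rfl⟩])

instance {κ : Type} [Countable κ] : Countable (treeLang κ).Symbols := by
  have h1 : Countable (Σ l, TreeFunc κ l) :=
    countable_of_surjective_option (fun o : Option κ => o.elim ⟨_, .meet⟩ fun i => ⟨_, .fn i⟩) (by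
      rintro ⟨_, _ | i⟩
      exacts [⟨none, rfl⟩, ⟨some i, rfl⟩])
  let f : Fin 3 ⊕ (κ ⊕ κ) → Σ l, TreeRel κ l := fun x => match x with
    | .inl 0 => ⟨_, .le⟩
    | .inl 1 => ⟨_, .node⟩
    | .inl 2 => ⟨_, .leaf⟩
    | .inr (.inl i) => ⟨_, .dom i⟩
    | .inr (.inr i) => ⟨_, .im i⟩
  have h2 : Countable (Σ l, TreeRel κ l) := Function.Surjective.countable (f := f) (by
      rintro ⟨_, _ | _ | _ | i | i⟩
      exacts [⟨.inl 0, rfl⟩, ⟨.inl 1, rfl⟩, ⟨.inl 2, rfl⟩, ⟨.inr (.inl i), rfl⟩,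
        ⟨.inr (.inr i), rfl⟩])
  exact inferInstanceAs (Countable ((Σ l, TreeFunc κ l) ⊕ Σ l, TreeRel κ l))

end Countable

/-! ### Saturation and equivalence under reducts. -/

section Reduct

variable {L L' : FirstOrder.Language.{0, 0}} (φ : L →ᴸ L') {M : Type u} [L'.Structure M]

theorem model_onTheory_iff (T : L.Theory) :
    M ⊨ φ.onTheory T ↔ @Theory.Model L M (φ.reduct M) T :=
  letI := φ.reduct M
  LHom.onTheory_model φ T

theorem realize_onFormula_iff {n : ℕ} (ψ : L.Formula (Fin n)) (x : Fin n → M) :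
    (φ.onFormula ψ).Realize x ↔ @Formula.Realize L M (φ.reduct M) _ ψ x :=
  letI := φ.reduct M
  LHom.realize_onFormula φ ψ

theorem IsSaturated.reduct (h : IsSaturated L' M) : @IsSaturated L M (φ.reduct M) := by
  classical
  intro n x p hp
  obtain ⟨y, hy⟩ := h n x (φ.onFormula '' p) (by
    intro q hq
    obtain ⟨q', hq', rfl⟩ := Finset.subset_set_image_iff.1 hq
    obtain ⟨y, hy⟩ := hp q' hq'
    refine ⟨y, fun ψ hψ => ?_⟩
    obtain ⟨χ, hχ, rfl⟩ := Finset.mem_image.1 hψ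
    exact (realize_onFormula_iff φ χ _).2 (hy χ hχ))
  exact ⟨y, fun ψ hψ => (realize_onFormula_iff φ ψ _).1 (hy _ ⟨ψ, hψ, rfl⟩)⟩

theorem elementarilyEquivalent_reduct {N : Type v} [L'.Structure N] (h : M ≅[L'] N) :
    @ElementarilyEquivalent L M N (φ.reduct M) (φ.reduct N) := by
  let _ := φ.reduct M
  let _ := φ.reduct N
  rw [elementarilyEquivalent_iff] at h ⊢
  intro ψ
  have := h (φ.onSentence ψ)
  rwa [LHom.realize_onSentence, LHom.realize_onSentence] at this

end Reduct

section SaturatedTree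

variable {κ : Type} {M : Type u}

theorem isSaturated_of_withPred [SemilatticeInf M] {g : κ → M →. M}
    (h : @IsSaturated (treeLang (AddP κ)) M (treeStructure (withPred g))) :
    @IsSaturated (treeLang κ) M (treeStructure g) := by
  rw [← reduct_withPred]
  exact @IsSaturated.reduct _ _ _ _ (treeStructure (withPred g)) h

theorem elementarilyEquivalent_of_withPred {N : Type v} [SemilatticeInf M] [SemilatticeInf N]
    {g : κ → M →. M} {h : κ → N →. N}
    (heq : @ElementarilyEquivalent (treeLang (AddP κ)) M N (treeStructure (withPred g))
      (treeStructure (withPred h))) :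
    @ElementarilyEquivalent (treeLang κ) M N (treeStructure g) (treeStructure h) := by
  rw [← reduct_withPred g, ← reduct_withPred h]
  exact @elementarilyEquivalent_reduct _ _ _ _ (treeStructure (withPred g)) _
    (treeStructure (withPred h)) heq

/-- A saturated elementary extension of a tree, in the language with the predecessor function. -/
theorem exists_isSaturated_tree [Countable κ] [SemilatticeInf M] [Nonempty M] (hM : IsGoodTree M)
    (g : κ → M →. M) :
    ∃ (N : Type u) (_ : SemilatticeInf N) (h : κ → N →. N)
      (_ : @ElementaryEmbedding (treeLang (AddP κ)) M N (treeStructure (withPred g))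
        (treeStructure (withPred h))),
      IsGoodTree N ∧ @IsSaturated (treeLang (AddP κ)) N (treeStructure (withPred h)) := by
  let _ := treeStructure (withPred g)
  obtain ⟨N, str, j, hN⟩ := exists_isSaturated (treeLang (AddP κ)) M
  have hax : ∀ T : (treeLang κ).Theory, @Theory.Model _ M (treeStructure g) T →
      @Theory.Model _ N ((treeMap AddP.old).reduct N) T := by
    intro T hT
    rw [← model_onTheory_iff, ← j.theory_model_iff, model_onTheory_iff, reduct_withPred]
    exact hT
  have hN₁ := hax _ (model_goodTreeAxioms g hM)
  have hN₂ := fun i => hax _ (model_partialFunAxioms g i)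
  have hN₃ : N ⊨ predAxioms κ := (j.theory_model_iff _).1 (model_predAxioms hM g)
  obtain ⟨sl, h, hgood, hstr⟩ := @exists_eq_treeStructure N κ ((treeMap AddP.old).reduct N) hN₁ hN₂
  obtain rfl := eq_treeStructure_withPred hgood h hstr hN₃
  exact ⟨N, sl, h, j, hgood, hN⟩

theorem PreservesAtoms.le_iff {N : Type v} [SemilatticeInf M] [SemilatticeInf N] {g : κ → M →. M}
    {h : κ → N →. N} {s : Set (M × N)}
    (hs : @PreservesAtoms _ _ (treeLang κ) (treeStructure g) (treeStructure h) s) {p q : M × N}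
    (hp : p ∈ s) (hq : q ∈ s) : p.1 ≤ q.1 ↔ p.2 ≤ q.2 :=
  @PreservesAtoms.rel _ _ (treeLang κ) (treeStructure g) (treeStructure h) s hs 2 TreeRel.le ![p, q]
    (by intro i; fin_cases i <;> assumption)

theorem PreservesAtoms.mem_iff {N : Type v} [SemilatticeInf M] [SemilatticeInf N] {g : κ → M →. M}
    {h : κ → N →. N} {s : Set (M × N)}
    (hs : @PreservesAtoms _ _ (treeLang κ) (treeStructure g) (treeStructure h) s) (i : κ)
    {p q : M × N} (hp : p ∈ s) (hq : q ∈ s) : q.1 ∈ g i p.1 ↔ q.2 ∈ h i p.2 := by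
  have h1 := @PreservesAtoms.rel _ _ (treeLang κ) (treeStructure g) (treeStructure h) s hs 1
    (TreeRel.dom i) ![p] (by intro i; fin_cases i; assumption)
  have h2 := @PreservesAtoms.fn _ _ (treeLang κ) (treeStructure g) (treeStructure h) s hs 1
    (TreeFunc.fn i) ![p] (by intro i; fin_cases i; assumption) q hq
  rw [mem_iff_total, mem_iff_total]
  exact and_congr h1 h2

/-- Equality of types in the smaller language is a back-and-forth system, and any such system
preserves the predecessor, which is defined from the order. -/
theorem elementarilyEquivalent_withPred_of_isSaturated {N : Type v} [SemilatticeInf M]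
    [SemilatticeInf N] (hM : IsGoodTree M) (hN : IsGoodTree N) {g : κ → M →. M} {h : κ → N →. N}
    (hMs : @IsSaturated (treeLang κ) M (treeStructure g))
    (hNs : @IsSaturated (treeLang κ) N (treeStructure h))
    (heq : @ElementarilyEquivalent (treeLang κ) M N (treeStructure g) (treeStructure h)) :
    @ElementarilyEquivalent (treeLang (AddP κ)) M N (treeStructure (withPred g))
      (treeStructure (withPred h)) := by
  let _ := treeStructure g
  let _ := treeStructure h
  have hbf := isBackForth_sameType hMs hNs
  refine @IsBackForth.elementarilyEquivalent _ _ _ (treeStructure (withPred g))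
    (treeStructure (withPred h)) _ hbf ?_ (sameType_empty heq)
  exact hbf.preservesAtoms_withPred (fun s hs p hp q hq => hs.preservesAtoms.le_iff hp hq) hM hN
    fun s hs i p hp q hq => hs.preservesAtoms.mem_iff i hp hq

/-- Instead of translating formulas with `p`, pass to extensions saturated in the language with `p`;
their reducts are saturated as well. -/
theorem elementarilyEquivalent_withPred [Countable κ] {N : Type v} [SemilatticeInf M]
    [SemilatticeInf N] [Nonempty M] [Nonempty N] (hM : IsGoodTree M) (hN : IsGoodTree N)
    {g : κ → M →. M} {h : κ → N →. N}
    (heq : @ElementarilyEquivalent (treeLang κ) M N (treeStructure g) (treeStructure h)) :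
    @ElementarilyEquivalent (treeLang (AddP κ)) M N (treeStructure (withPred g))
      (treeStructure (withPred h)) := by
  obtain ⟨M', _, g', j, hM', hsat⟩ := exists_isSaturated_tree hM g
  obtain ⟨N', _, h', k, hN', hsat'⟩ := exists_isSaturated_tree hN h
  have hj := @ElementaryEmbedding.elementarilyEquivalent _ _ _ (treeStructure (withPred g))
    (treeStructure (withPred g')) j
  have hk := @ElementaryEmbedding.elementarilyEquivalent _ _ _ (treeStructure (withPred h))
    (treeStructure (withPred h')) k
  have hj₀ := elementarilyEquivalent_of_withPred hj
  have hk₀ := elementarilyEquivalent_of_withPred hk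
  have h₀ := elementarilyEquivalent_withPred_of_isSaturated hM' hN'
    (isSaturated_of_withPred hsat) (isSaturated_of_withPred hsat')
    (Eq.trans (Eq.trans (Eq.symm hj₀) heq) hk₀)
  exact Eq.trans (Eq.trans hj h₀) (Eq.symm hk)

end SaturatedTree

/-! ## Elementary equivalence of ordered sets -/

section OrderTransfer

attribute [local instance] orderStructure

instance orderedStructure_orderStructure {X : Type u} [LE X] : Language.order.OrderedStructure X :=
  ⟨fun _ => Iff.rfl⟩

theorem realize_orderLe {X : Type u} [LE X] {α : Type*} {n : ℕ}
    {s t : Language.order.Term (α ⊕ Fin n)} {v : α → X} {xs : Fin n → X} :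
    (Term.le s t).Realize v xs ↔
      s.realize (Sum.elim v xs) ≤ t.realize (Sum.elim v xs) := Term.realize_le

variable {X : Type u} {Y : Type v}

theorem forall_realize_iff [LE X] [LE Y] (h : orderTheoryOf X = orderTheoryOf Y) {α : Type}
    [Finite α] (φ : Language.order.Formula α) :
    (∀ v : α → X, φ.Realize v) ↔ ∀ v : α → Y, φ.Realize v := by
  have := (elementarilyEquivalent_iff (L := Language.order) (M := X) (N := Y)).1 h
    (Formula.iAlls α (φ.relabel Sum.inr))
  simpa [Sentence.Realize, Formula.realize_relabel, Function.comp_def] using this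

/-- The formula saying that an element is maximal. -/
def maxForm {α : Type} {n : ℕ} (t : Language.order.Term (α ⊕ Fin n)) :
    Language.order.BoundedFormula α n :=
  ∀' (Term.le (t.relabel (Sum.map id Fin.castSucc)) (&(Fin.last n)) ⟹
    Term.le (&(Fin.last n)) (t.relabel (Sum.map id Fin.castSucc)))

theorem realize_maxForm [LE X] {α : Type} {n : ℕ} (t : Language.order.Term (α ⊕ Fin n))
    (v : α → X) (xs : Fin n → X) :
    (maxForm t).Realize v xs ↔ IsMax (t.realize (Sum.elim v xs)) := by
  have : ∀ a : X, (Sum.elim v (Fin.snoc xs a : Fin (n + 1) → X)) ∘ (Sum.map id Fin.castSucc) =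
      Sum.elim v xs := by
    intro a; ext (i | i) <;> simp
  simp only [maxForm, BoundedFormula.realize_all, BoundedFormula.realize_imp, realize_orderLe,
    Term.realize_relabel, this, Term.realize_var, Function.comp_apply, Sum.elim_inr, Fin.snoc_last]
  rfl

/-- A free variable. -/
def fvar {α : Type} {n : ℕ} (a : α) : Language.order.Term (α ⊕ Fin n) := .var (.inl a)

theorem forall_fin_one {P : X → Prop} : (∀ v : Fin 1 → X, P (v 0)) ↔ ∀ x, P x :=
  ⟨fun h x => h ![x], fun h v => h (v 0)⟩

theorem forall_fin_two {P : X → X → Prop} : (∀ v : Fin 2 → X, P (v 0) (v 1)) ↔ ∀ x y, P x y :=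
  ⟨fun h x y => h ![x, y], fun h v => h (v 0) (v 1)⟩

theorem forall_fin_three {P : X → X → X → Prop} :
    (∀ v : Fin 3 → X, P (v 0) (v 1) (v 2)) ↔ ∀ x y z, P x y z :=
  ⟨fun h x y z => h ![x, y, z], fun h v => h (v 0) (v 1) (v 2)⟩

variable [PartialOrder X] [PartialOrder Y]

/-- `x < y`. -/
def ltForm {α : Type} {n : ℕ} (s t : Language.order.Term (α ⊕ Fin n)) :
    Language.order.BoundedFormula α n := Term.le s t ⊓ ∼(Term.le t s)

theorem realize_ltForm {α : Type} {n : ℕ} (s t : Language.order.Term (α ⊕ Fin n))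
    (v : α → X) (xs : Fin n → X) : (ltForm s t).Realize v xs ↔
      s.realize (Sum.elim v xs) < t.realize (Sum.elim v xs) := by
  simp [ltForm, lt_iff_le_not_ge]

variable (h : orderTheoryOf X = orderTheoryOf Y)

include h

theorem chain_transfer (hX : ∀ x y z : X, y ≤ x → z ≤ x → y ≤ z ∨ z ≤ y) :
    ∀ x y z : Y, y ≤ x → z ≤ x → y ≤ z ∨ z ≤ y := by
  have := forall_realize_iff h
    (show Language.order.Formula (Fin 3) from (Term.le (fvar 1) (fvar 0) ⟹
      Term.le (fvar 2) (fvar 0) ⟹ Term.le (fvar 1) (fvar 2) ⊔ Term.le (fvar 2) (fvar 1) :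
      Language.order.BoundedFormula (Fin 3) 0))
  simp only [Formula.Realize, BoundedFormula.realize_imp, BoundedFormula.realize_sup,
    realize_orderLe] at this
  exact forall_fin_three.1 (this.1 (forall_fin_three.2 hX))

theorem leaf_above_transfer (hX : ∀ x : X, ∃ y, x ≤ y ∧ IsMax y) :
    ∀ x : Y, ∃ y, x ≤ y ∧ IsMax y := by
  have := forall_realize_iff h
    (show Language.order.Formula (Fin 1) from (∃' (Term.le (fvar 0) (&0) ⊓ maxForm (&0)) :
      Language.order.BoundedFormula (Fin 1) 0))
  simp only [Formula.Realize, BoundedFormula.realize_ex, BoundedFormula.realize_inf,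
    realize_orderLe, realize_maxForm] at this
  exact forall_fin_one.1 (this.1 (forall_fin_one.2 hX))

theorem noBot_transfer (hX : ∀ x : X, ∃ y, y < x) : ∀ x : Y, ∃ y, y < x := by
  have := forall_realize_iff h
    (show Language.order.Formula (Fin 1) from (∃' (ltForm (&0) (fvar 0)) :
      Language.order.BoundedFormula (Fin 1) 0))
  simp only [Formula.Realize, BoundedFormula.realize_ex, realize_ltForm] at this
  exact forall_fin_one.1 (this.1 (forall_fin_one.2 hX))

theorem hasRoot_transfer (hX : HasRoot X) : HasRoot Y := by
  have := forall_realize_iff h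
    (show Language.order.Formula (Fin 0) from (∃' ∀' (Term.le (&0) (&1)) :
      Language.order.BoundedFormula (Fin 0) 0))
  simp only [Formula.Realize, BoundedFormula.realize_ex, BoundedFormula.realize_all,
    realize_orderLe] at this
  exact this.1 (fun _ => hX) Fin.elim0

theorem height_transfer (hX : ∀ x y z : X, x < y → ¬ y < z) : ∀ x y z : Y, x < y → ¬ y < z := by
  have := forall_realize_iff h
    (show Language.order.Formula (Fin 3) from (ltForm (fvar 0) (fvar 1) ⟹
      ∼(ltForm (fvar 1) (fvar 2)) : Language.order.BoundedFormula (Fin 3) 0))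
  simp only [Formula.Realize, BoundedFormula.realize_imp, BoundedFormula.realize_not,
    realize_ltForm] at this
  exact forall_fin_three.1 (this.1 (forall_fin_three.2 hX))

theorem dense_transfer (hX : ∀ x y : X, x < y → ¬ IsMax y → ∃ z, x < z ∧ z < y) :
    ∀ x y : Y, x < y → ¬ IsMax y → ∃ z, x < z ∧ z < y := by
  have := forall_realize_iff h
    (show Language.order.Formula (Fin 2) from (ltForm (fvar 0) (fvar 1) ⟹ ∼(maxForm (fvar 1)) ⟹
      ∃' (ltForm (fvar 0) (&0) ⊓ ltForm (&0) (fvar 1)) :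
      Language.order.BoundedFormula (Fin 2) 0))
  simp only [Formula.Realize, BoundedFormula.realize_imp, BoundedFormula.realize_not,
    realize_ltForm, realize_maxForm, BoundedFormula.realize_ex,
    BoundedFormula.realize_inf] at this
  exact forall_fin_two.1 (this.1 (forall_fin_two.2 hX))

theorem dense_leaf_transfer (hX : ∀ x y : X, x < y → IsMax y → ∃ z, x < z ∧ z < y) :
    ∀ x y : Y, x < y → IsMax y → ∃ z, x < z ∧ z < y := by
  have := forall_realize_iff h
    (show Language.order.Formula (Fin 2) from (ltForm (fvar 0) (fvar 1) ⟹ maxForm (fvar 1) ⟹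
      ∃' (ltForm (fvar 0) (&0) ⊓ ltForm (&0) (fvar 1)) :
      Language.order.BoundedFormula (Fin 2) 0))
  simp only [Formula.Realize, BoundedFormula.realize_imp,
    realize_ltForm, realize_maxForm, BoundedFormula.realize_ex,
    BoundedFormula.realize_inf] at this
  exact forall_fin_two.1 (this.1 (forall_fin_two.2 hX))

theorem pred_leaf_transfer (hX : ∀ x : X, IsMax x → ∃ y, y ⋖ x) : ∀ x : Y, IsMax x → ∃ y, y ⋖ x := by
  have := forall_realize_iff h
    (show Language.order.Formula (Fin 1) from (maxForm (fvar 0) ⟹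
      ∃' (ltForm (&0) (fvar 0) ⊓ ∀' (ltForm (&0) (&1) ⟹ ∼(ltForm (&1) (fvar 0)))) :
      Language.order.BoundedFormula (Fin 1) 0))
  simp only [Formula.Realize, BoundedFormula.realize_imp, BoundedFormula.realize_not,
    realize_ltForm, realize_maxForm, BoundedFormula.realize_ex,
    BoundedFormula.realize_inf, BoundedFormula.realize_all] at this
  exact forall_fin_one.1 (this.1 (forall_fin_one.2 hX))

omit h

/-- There are `k` non maximal elements in different cones at `u`. -/
def HasCones (k : ℕ) (u : X) : Prop :=
  ∃ y : Fin k → X, (∀ i, u < y i ∧ ¬ IsMax (y i)) ∧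
    ∀ i j, i ≠ j → ∀ z, z ≤ y i → z ≤ y j → z ≤ u

/-- There are `k` leaves with predecessor `u`. -/
def HasLeaves (k : ℕ) (u : X) : Prop :=
  ∃ y : Fin k → X, (∀ i, IsMax (y i) ∧ u ⋖ y i) ∧ Function.Injective y

/-- The formula expressing `HasCones`. -/
noncomputable def conesForm (k : ℕ) : Language.order.Formula (Fin 1) :=
  BoundedFormula.exs (BoundedFormula.iInf (fun i : Fin k =>
      ltForm (fvar 0) (&i) ⊓ ∼(maxForm (&i))) ⊓
    BoundedFormula.iInf (fun p : {p : Fin k × Fin k // p.1 ≠ p.2} =>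
      ∀' (Term.le (&(Fin.last k)) (&p.1.1.castSucc) ⟹ Term.le (&(Fin.last k)) (&p.1.2.castSucc) ⟹
        Term.le (&(Fin.last k)) (fvar 0))))

theorem realize_conesForm (k : ℕ) (v : Fin 1 → X) :
    (conesForm k).Realize v ↔ HasCones k (v 0) := by
  simp only [conesForm, BoundedFormula.realize_exs, BoundedFormula.realize_inf,
    BoundedFormula.realize_iInf, realize_ltForm, BoundedFormula.realize_not,
    realize_maxForm, BoundedFormula.realize_all, BoundedFormula.realize_imp, realize_orderLe,
    Term.realize_var, Function.comp_apply, Sum.elim_inr, Fin.snoc_last, Fin.snoc_castSucc, Subtype.forall, Prod.forall]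
  rfl

/-- The formula expressing `HasLeaves`. -/
noncomputable def leavesForm (k : ℕ) : Language.order.Formula (Fin 1) :=
  BoundedFormula.exs (BoundedFormula.iInf (fun i : Fin k =>
      maxForm (&i) ⊓ (ltForm (fvar 0) (&i) ⊓ ∀' (ltForm (fvar 0) (&(Fin.last k)) ⟹
        ∼(ltForm (&(Fin.last k)) (&i.castSucc))))) ⊓
    BoundedFormula.iInf (fun p : {p : Fin k × Fin k // p.1 ≠ p.2} => ∼((&p.1.1) =' (&p.1.2))))

theorem realize_leavesForm (k : ℕ) (v : Fin 1 → X) :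
    (leavesForm k).Realize v ↔ HasLeaves k (v 0) := by
  simp only [leavesForm, BoundedFormula.realize_exs, BoundedFormula.realize_inf,
    BoundedFormula.realize_iInf, realize_ltForm, BoundedFormula.realize_not,
    realize_maxForm, BoundedFormula.realize_all, BoundedFormula.realize_imp,
    Term.realize_var, Function.comp_apply, Sum.elim_inr, Fin.snoc_last, Fin.snoc_castSucc, Subtype.forall, Prod.forall,
    BoundedFormula.realize_bdEqual]
  refine exists_congr fun y => and_congr Iff.rfl ?_
  exact ⟨fun h i j hij => by_contra fun hne => h i j hne hij, fun h i j hne hij => hne (h hij)⟩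

/-- All the elements satisfying `P` behave in the same way in both ordered sets, when they do so
in one of them. -/
theorem uniform_transfer {Z : Type w} [PartialOrder Z] (hX : orderTheoryOf Z = orderTheoryOf X)
    (hY : orderTheoryOf Z = orderTheoryOf Y) (φ : Language.order.Formula (Fin 1))
    (hZ : ∀ a b : Fin 1 → Z, ¬ IsMax (a 0) → ¬ IsMax (b 0) → φ.Realize a → φ.Realize b)
    (a : Fin 1 → X) (b : Fin 1 → Y) (ha : ¬ IsMax (a 0)) (hb : ¬ IsMax (b 0))
    (hφ : φ.Realize a) : φ.Realize b := by
  have hXZ := forall_realize_iff hX (show Language.order.Formula (Fin 1) from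
    (∼(maxForm (fvar 0)) ⟹ ∼φ : Language.order.BoundedFormula (Fin 1) 0))
  have hYZ := forall_realize_iff hY (show Language.order.Formula (Fin 1) from
    (∼(maxForm (fvar 0)) ⟹ φ : Language.order.BoundedFormula (Fin 1) 0))
  simp only [Formula.Realize, BoundedFormula.realize_imp, BoundedFormula.realize_not,
    realize_maxForm] at hXZ hYZ
  -- In `Z` the formula holds at all non maximal elements or at none. Either alternative is a
  -- sentence, and the second one contradicts `hφ`.
  by_cases hall : ∃ c : Fin 1 → Z, ¬ IsMax (c 0) ∧ φ.Realize c
  · obtain ⟨c, hc, hc'⟩ := hall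
    exact hYZ.1 (fun d hd => hZ c d hc hd hc') b hb
  · push Not at hall
    exact absurd hφ (hXZ.1 (fun d hd => hall d hd) a ha)

theorem hasCones_transfer {Z : Type w} [PartialOrder Z] (hX : orderTheoryOf Z = orderTheoryOf X)
    (hY : orderTheoryOf Z = orderTheoryOf Y) (k : ℕ)
    (hZ : ∀ a b : Z, ¬ IsMax a → ¬ IsMax b → HasCones k a → HasCones k b)
    (a : X) (b : Y) (ha : ¬ IsMax a) (hb : ¬ IsMax b) (h : HasCones k a) : HasCones k b :=
  (realize_conesForm k ![b]).1 (uniform_transfer hX hY _ (fun a b ha hb h =>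
    (realize_conesForm k b).2 (hZ _ _ ha hb ((realize_conesForm k a).1 h))) ![a] ![b] ha hb
    ((realize_conesForm k ![a]).2 h))

theorem hasLeaves_transfer {Z : Type w} [PartialOrder Z] (hX : orderTheoryOf Z = orderTheoryOf X)
    (hY : orderTheoryOf Z = orderTheoryOf Y) (k : ℕ)
    (hZ : ∀ a b : Z, ¬ IsMax a → ¬ IsMax b → HasLeaves k a → HasLeaves k b)
    (a : X) (b : Y) (ha : ¬ IsMax a) (hb : ¬ IsMax b) (h : HasLeaves k a) : HasLeaves k b :=
  (realize_leavesForm k ![b]).1 (uniform_transfer hX hY _ (fun a b ha hb h =>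
    (realize_leavesForm k b).2 (hZ _ _ ha hb ((realize_leavesForm k a).1 h))) ![a] ![b] ha hb
    ((realize_leavesForm k ![a]).2 h))

include h in
theorem natCast_le_card_transfer (n : ℕ) (hX : (n : Cardinal) ≤ Cardinal.mk X) :
    (n : Cardinal) ≤ Cardinal.mk Y := by
  have := (elementarilyEquivalent_iff (L := Language.order) (M := X) (N := Y)).1 h
    (Sentence.cardGe _ n)
  rw [Sentence.realize_cardGe, Sentence.realize_cardGe] at this
  exact this.1 hX

end OrderTransfer

/-! ## Back-and-forth systems between 1-colored trees -/

section Swap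

variable {X : Type u} {Y : Type v}

theorem preimage_swap_insert (a : X) (b : Y) (s : Set (X × Y)) :
    Prod.swap ⁻¹' (insert (a, b) s) = insert (b, a) (Prod.swap ⁻¹' s) := by
  ext ⟨y, x⟩
  simp [and_comm]

end Swap

section Class

variable {X Y : Type u} [SemilatticeInf X] [SemilatticeInf Y]

/-- A relation preserving the order, the leaves and the root, and closed under meets and
predecessors of leaves. -/
structure IsTreeIso (r : Set (X × Y)) : Prop where
  le : ∀ p ∈ r, ∀ q ∈ r, p.1 ≤ q.1 ↔ p.2 ≤ q.2
  inf : ∀ p ∈ r, ∀ q ∈ r, p ⊓ q ∈ r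
  max : ∀ p ∈ r, IsMax p.1 ↔ IsMax p.2
  bot : ∀ p ∈ r, IsBot p.1 ↔ IsBot p.2
  pred : ∀ p ∈ r, IsMax p.1 → ∀ q : X × Y, q.1 ⋖ p.1 → q.2 ⋖ p.2 → q ∈ r

/-- A back-and-forth system between trees, containing the finite parts of the relations
`IsTreeIso`. -/
structure IsClassSystem (K : Set (X × Y) → Prop) : Prop where
  backForth : IsBackForth K
  empty : K ∅
  preservesLE : PreservesLE K
  of_isTreeIso : ∀ r s, IsTreeIso r → s ⊆ r → s.Finite → K s

/-! ### Trees with a unique node -/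

section Star

/-- The system between trees with a unique node. -/
structure StarSystem (s : Set (X × Y)) : Prop where
  finite : s.Finite
  eq : ∀ p ∈ s, ∀ q ∈ s, p.1 = q.1 ↔ p.2 = q.2
  bot : ∀ p ∈ s, IsBot p.1 ↔ IsBot p.2

theorem StarSystem.swap {s : Set (X × Y)} (hs : StarSystem s) :
    StarSystem (Prod.swap ⁻¹' s) where
  finite := hs.finite.preimage Prod.swap_injective.injOn
  eq p hp q hq := (hs.eq p.swap hp q.swap hq).symm
  bot p hp := (hs.bot p.swap hp).symm

-- `s` uses equally many elements on both sides. With `a` there are `|s| + 1` of them in `X`, hence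
-- at least as many in `Y`, more than the second coordinates can exhaust.
omit [SemilatticeInf X] [SemilatticeInf Y] in
theorem exists_notMem_of_card (hcard : ∀ n : ℕ, (n : Cardinal) ≤ Cardinal.mk X →
    (n : Cardinal) ≤ Cardinal.mk Y) {s : Set (X × Y)} (hs : s.Finite)
    (heq : ∀ p ∈ s, ∀ q ∈ s, p.1 = q.1 ↔ p.2 = q.2) {a : X} (ha : ∀ p ∈ s, p.1 ≠ a) :
    ∃ b, ∀ p ∈ s, p.2 ≠ b := by
  classical
  lift s to Finset (X × Y) using hs
  by_contra! hcon
  have h1 : (s.image Prod.fst).card = s.card :=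
    Finset.card_image_of_injOn fun p hp q hq hpq => Prod.ext hpq ((heq p hp q hq).1 hpq)
  have h2 : a ∉ s.image Prod.fst := by
    intro h
    obtain ⟨p, hp, hp'⟩ := Finset.mem_image.1 h
    exact ha p hp hp'
  have h3 : (insert a (s.image Prod.fst)).card = s.card + 1 := by
    rw [Finset.card_insert_of_notMem h2, h1]
  have h4 := hcard (s.card + 1) (by
    rw [← h3, ← Cardinal.mk_coe_finset]
    exact Cardinal.mk_set_le _)
  have h5 : Cardinal.mk Y ≤ (s.card : Cardinal) := by
    rw [← Cardinal.mk_coe_finset]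
    refine Cardinal.mk_le_of_surjective (f := fun p : s => p.1.2) fun b => ?_
    obtain ⟨p, hp, hp'⟩ := hcon b
    exact ⟨⟨p, hp⟩, hp'⟩
  have := h4.trans h5
  norm_cast at this
  omega

theorem StarSystem.forth (hX : HasRoot X) (hY : HasRoot Y)
    (hcard : ∀ n : ℕ, (n : Cardinal) ≤ Cardinal.mk X → (n : Cardinal) ≤ Cardinal.mk Y)
    {s : Set (X × Y)} (hs : StarSystem s) (a : X) : ∃ b, StarSystem (insert (a, b) s) := by
  obtain ⟨r, hr⟩ := hX
  obtain ⟨r', hr'⟩ := hY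
  have hinsert : ∀ b, (∀ p ∈ s, p.1 = a ↔ p.2 = b) → (IsBot a ↔ IsBot b) →
      StarSystem (insert (a, b) s) := by
    intro b h1 h2
    refine ⟨hs.finite.insert _, ?_, ?_⟩
    · rintro p (rfl | hp) q (rfl | hq)
      · simp
      · rw [eq_comm, h1 q hq, eq_comm]
      · exact h1 p hp
      · exact hs.eq p hp q hq
    · rintro p (rfl | hp)
      exacts [h2, hs.bot p hp]
  by_cases ha : ∃ p ∈ s, p.1 = a
  · obtain ⟨p, hp, rfl⟩ := ha
    exact ⟨p.2, hinsert _ (fun q hq => hs.eq q hq p hp) (hs.bot p hp)⟩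
  push Not at ha
  by_cases hbot : IsBot a
  · refine ⟨r', hinsert _ (fun p hp => iff_of_false (ha p hp) ?_) (iff_of_true hbot hr')⟩
    rintro rfl
    exact ha p hp (((hs.bot p hp).2 hr' a).antisymm (hbot _))
  -- The pair of roots is adjoined first, so that the new element is not the root.
  · obtain ⟨b, hb⟩ := exists_notMem_of_card hcard (s := insert (r, r') s) (hs.finite.insert _) (by
      have : ∀ p ∈ s, p.1 = r ↔ p.2 = r' := by
        intro p hp
        have h1 : p.1 = r ↔ IsBot p.1 := ⟨fun h => h ▸ hr, fun h => (h _).antisymm (hr _)⟩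
        have h2 : p.2 = r' ↔ IsBot p.2 := ⟨fun h => h ▸ hr', fun h => (h _).antisymm (hr' _)⟩
        rw [h1, h2, hs.bot p hp]
      rintro p (rfl | hp) q (rfl | hq)
      · simp
      · rw [eq_comm, this q hq, eq_comm]
      · exact this p hp
      · exact hs.eq p hp q hq) (a := a) (by
      rintro p (rfl | hp)
      · rintro rfl; exact hbot hr
      · exact ha p hp)
    refine ⟨b, hinsert b (fun p hp => iff_of_false (ha p hp) (hb p (Or.inr hp)))
      (iff_of_false hbot fun h => ?_)⟩
    exact hb (r, r') (Or.inl rfl) ((hr' b).antisymm (h r'))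

/-- In height one the order amounts to equality and the root, which is why `StarSystem` records
nothing else. -/
theorem le_iff_eq_or_isBot (hX : HasRoot X) (hX' : ∀ x y z : X, x < y → ¬ y < z) (x y : X) :
    x ≤ y ↔ x = y ∨ IsBot x := by
  obtain ⟨r, hr⟩ := hX
  constructor
  · refine fun h => h.eq_or_lt.imp id fun h => ?_
    rcases (hr x).eq_or_lt with rfl | h'
    exacts [hr, absurd h (hX' _ _ _ h')]
  · rintro (rfl | h)
    exacts [le_rfl, h y]

theorem isClassSystem_star (hX : HasRoot X) (hX' : ∀ x y z : X, x < y → ¬ y < z)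
    (hY : HasRoot Y) (hY' : ∀ x y z : Y, x < y → ¬ y < z)
    (hcard : ∀ n : ℕ, (n : Cardinal) ≤ Cardinal.mk X ↔ (n : Cardinal) ≤ Cardinal.mk Y) :
    IsClassSystem (StarSystem : Set (X × Y) → Prop) where
  backForth :=
    { forth := fun s hs a => hs.forth hX hY (fun n => (hcard n).1) a
      back := fun s hs b => by
        obtain ⟨a, ha⟩ := hs.swap.forth hY hX (fun n => (hcard n).2) b
        refine ⟨a, ?_⟩
        have := ha.swap
        rwa [preimage_swap_insert, ← Set.preimage_comp, Prod.swap_swap_eq, Set.preimage_id] at this }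
  empty := ⟨Set.finite_empty, by simp, by simp⟩
  preservesLE s hs p hp q hq := by
    have hX₁ := le_iff_eq_or_isBot hX hX'
    have hY₁ := le_iff_eq_or_isBot hY hY'
    rw [hX₁, hY₁, hs.eq p hp q hq, hs.bot p hp]
  of_isTreeIso r s hr hsr hs := by
    refine ⟨hs, fun p hp q hq => ?_, fun p hp => hr.bot p (hsr hp)⟩
    rw [le_antisymm_iff, le_antisymm_iff, hr.le p (hsr hp) q (hsr hq), hr.le q (hsr hq) p (hsr hp)]

end Star

/-! ### Dense trees -/

section Dense

/-- The trees of types (1.a) and (1.b); the leaves are isolated if `iso` holds, and non isolated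
otherwise. -/
structure IsDenseTree (X : Type u) [PartialOrder X] (iso : Prop) : Prop where
  chain : ∀ x y z : X, y ≤ x → z ≤ x → y ≤ z ∨ z ≤ y
  leaf_above : ∀ x : X, ∃ y, x ≤ y ∧ IsMax y
  no_bot : ∀ x : X, ∃ y, y < x
  dense : ∀ x y : X, x < y → ¬ IsMax y → ∃ z, x < z ∧ z < y
  pred : iso → ∀ x : X, IsMax x → ∃ y, y ⋖ x
  dense_leaf : ¬ iso → ∀ x y : X, x < y → IsMax y → ∃ z, x < z ∧ z < y

/-- The nodes of both trees have the same number of leaves and of infinite cones. -/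
structure SameCounts (X Y : Type u) [PartialOrder X] [PartialOrder Y] : Prop where
  cones : ∀ k (a : X) (b : Y), ¬ IsMax a → ¬ IsMax b → (HasCones k a ↔ HasCones k b)
  leaves : ∀ k (a : X) (b : Y), ¬ IsMax a → ¬ IsMax b → (HasLeaves k a ↔ HasLeaves k b)

theorem SameCounts.swap (h : SameCounts X Y) : SameCounts Y X :=
  ⟨fun k a b ha hb => (h.cones k b a hb ha).symm, fun k a b ha hb => (h.leaves k b a hb ha).symm⟩

/-- Finite relations preserving the order and the leaves, and closed under meets and predecessors
of leaves. -/
structure IsDenseIso (iso : Prop) (r : Set (X × Y)) : Prop where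
  finite : r.Finite
  le : ∀ p ∈ r, ∀ q ∈ r, p.1 ≤ q.1 ↔ p.2 ≤ q.2
  inf : ∀ p ∈ r, ∀ q ∈ r, p ⊓ q ∈ r
  max : ∀ p ∈ r, IsMax p.1 ↔ IsMax p.2
  pred : iso → ∀ p ∈ r, IsMax p.1 → ∃ q ∈ r, q.1 ⋖ p.1 ∧ q.2 ⋖ p.2

variable {iso : Prop} {r : Set (X × Y)}

theorem IsDenseIso.swap (hr : IsDenseIso iso r) : IsDenseIso iso (Prod.swap ⁻¹' r) where
  finite := hr.finite.preimage Prod.swap_injective.injOn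
  le p hp q hq := (hr.le p.swap hp q.swap hq).symm
  inf p hp q hq := hr.inf p.swap hp q.swap hq
  max p hp := (hr.max p.swap hp).symm
  pred hi p hp hm := by
    obtain ⟨q, hq, h1, h2⟩ := hr.pred hi p.swap hp ((hr.max p.swap hp).2 hm)
    exact ⟨q.swap, by simpa using hq, h2, h1⟩

theorem IsDenseIso.lt_iff (hr : IsDenseIso iso r) {p q : X × Y} (hp : p ∈ r) (hq : q ∈ r) :
    p.1 < q.1 ↔ p.2 < q.2 := by
  rw [lt_iff_le_not_ge, lt_iff_le_not_ge, hr.le p hp q hq, hr.le q hq p hp]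

theorem IsDenseIso.eq_iff (hr : IsDenseIso iso r) {p q : X × Y} (hp : p ∈ r) (hq : q ∈ r) :
    p.1 = q.1 ↔ p.2 = q.2 := by
  rw [le_antisymm_iff, le_antisymm_iff, hr.le p hp q hq, hr.le q hq p hp]

theorem IsDenseIso.insert (hr : IsDenseIso iso r) {x : X} {y : Y}
    (hle : ∀ p ∈ r, x ≤ p.1 ↔ y ≤ p.2) (hge : ∀ p ∈ r, p.1 ≤ x ↔ p.2 ≤ y)
    (hinf : ∀ p ∈ r, (x, y) ⊓ p ∈ insert (x, y) r) (hmax : IsMax x ↔ IsMax y)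
    (hpred : iso → IsMax x → ∃ q ∈ r, q.1 ⋖ x ∧ q.2 ⋖ y) : IsDenseIso iso (insert (x, y) r) where
  finite := hr.finite.insert _
  le := by
    rintro p (rfl | hp) q (rfl | hq)
    exacts [by simp, hle q hq, hge p hp, hr.le p hp q hq]
  inf := by
    rintro p (rfl | hp) q (rfl | hq)
    exacts [by simp, hinf q hq, inf_comm p (x, y) ▸ hinf p hp, Or.inr (hr.inf p hp q hq)]
  max := by
    rintro p (rfl | hp)
    exacts [hmax, hr.max p hp]
  pred := by
    rintro hi p (rfl | hp) hm
    · obtain ⟨q, hq, h⟩ := hpred hi hm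
      exact ⟨q, Or.inr hq, h⟩
    · obtain ⟨q, hq, h⟩ := hr.pred hi p hp hm
      exact ⟨q, Or.inr hq, h⟩

theorem lt_of_chain {x a b : X} (hchain : ∀ x y z : X, y ≤ x → z ≤ x → y ≤ z ∨ z ≤ y)
    (ha : a ≤ x) (hb : b ≤ x) (h : ¬ a ≤ b) : b < a :=
  ((hchain x a b ha hb).resolve_left h).lt_of_not_ge h

/-- Both meets lie below `b`, so they are comparable, and the smaller one lies below `a` and `c`.
This is the transitivity of being in the same cone at `u`. -/
theorem lt_inf_trans (hchain : ∀ x y z : X, y ≤ x → z ≤ x → y ≤ z ∨ z ≤ y) {u a b c : X}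
    (hab : u < a ⊓ b) (hbc : u < b ⊓ c) : u < a ⊓ c := by
  rcases hchain b (a ⊓ b) (b ⊓ c) inf_le_right inf_le_left with h | h
  · exact hab.trans_le (le_inf inf_le_left (h.trans inf_le_right))
  · exact hbc.trans_le (le_inf (h.trans inf_le_left) inf_le_right)

theorem IsDenseTree.le_of_covBy {hX : IsDenseTree X iso} {x q a : X} (h : q ⋖ x) (ha : a < x) :
    a ≤ q := by
  by_contra hcon
  exact h.2 (lt_of_chain hX.chain ha.le h.le hcon) ha

variable (hX : IsDenseTree X iso) (hY : IsDenseTree Y iso) (hr : IsDenseIso iso r)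

include hX hY hr

/-- Closure under meets gives a least point `p₁` of `r` above `u`, and for `u` not yet in the domain
every other point of `r` that is not above `u` meets `p₁` strictly below `u`. The place of `u` is
thus a gap in a chain below `p₁`, and density fills the matching gap on the other side. -/
theorem IsDenseIso.exists_insert_below {p₀ : X × Y} (hp₀ : p₀ ∈ r) {u : X} (hu : u ≤ p₀.1) :
    ∃ v, IsDenseIso iso (Insert.insert (u, v) r) := by
  by_cases hdom : ∃ p ∈ r, p.1 = u
  · obtain ⟨p, hp, rfl⟩ := hdom
    exact ⟨p.2, by rwa [Set.insert_eq_of_mem hp]⟩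
  push Not at hdom
  obtain ⟨p₁, ⟨hp₁, hup₁⟩, hmin⟩ := Set.Finite.exists_minimalFor (fun p : X × Y => p.1)
    {p ∈ r | u ≤ p.1} (hr.finite.subset fun p hp => hp.1) ⟨p₀, hp₀, hu⟩
  have hleast : ∀ p ∈ r, u ≤ p.1 → p₁.1 ≤ p.1 := fun p hp hup =>
    (hmin (j := p ⊓ p₁) ⟨hr.inf p hp p₁ hp₁, le_inf hup hup₁⟩ inf_le_right).trans inf_le_left
  have hlt₁ : u < p₁.1 := hup₁.lt_of_ne (hdom p₁ hp₁).symm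
  -- Density can fail only just below an isolated leaf; but then the predecessor belongs to `r` and
  -- lies above `u`, against the choice of `p₁`.
  have hdense : ∀ b : Y, b < p₁.2 → ∃ c, b < c ∧ c < p₁.2 := by
    intro b hb
    by_cases hm : IsMax p₁.2
    · by_cases hi : iso
      · obtain ⟨q, hq, hq₁, hq₂⟩ := hr.pred hi p₁ hp₁ ((hr.max p₁ hp₁).2 hm)
        have := hleast q hq (IsDenseTree.le_of_covBy (hX := hX) hq₁ hlt₁)
        exact absurd hq₁.lt this.not_gt
      · exact hY.dense_leaf hi b _ hb hm
    · exact hY.dense b _ hb hm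
  -- The points of `r` below `u` form a chain, so it suffices to pass the greatest one; if there is
  -- none, the absence of a root provides `v`.
  obtain ⟨v, hv₁, hv₂⟩ : ∃ v, v < p₁.2 ∧ ∀ p ∈ r, p.1 < u → p.2 < v := by
    by_cases hne : ∃ p ∈ r, p.1 < u
    · obtain ⟨p₂, ⟨hp₂, hup₂⟩, hmax⟩ := Set.Finite.exists_maximalFor (fun p : X × Y => p.1)
        {p ∈ r | p.1 < u} (hr.finite.subset fun p hp => hp.1) hne
      obtain ⟨v, hv, hv'⟩ := hdense p₂.2 ((hr.lt_iff hp₂ hp₁).1 (hup₂.trans hlt₁))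
      refine ⟨v, hv', fun p hp hpu => ?_⟩
      refine lt_of_le_of_lt ((hr.le p hp p₂ hp₂).1 ?_) hv
      rcases hX.chain u _ _ hpu.le hup₂.le with h | h
      exacts [h, hmax ⟨hp, hpu⟩ h]
    · push Not at hne
      obtain ⟨v, hv⟩ := hY.no_bot p₁.2
      exact ⟨v, hv, fun p hp hpu => absurd hpu (hne p hp)⟩
  have hbelow : ∀ p ∈ r, p.1 ≤ p₁.1 → ¬ u ≤ p.1 → p.1 < u ∧ p.2 < v := fun p hp hpp hup =>
    have : p.1 < u := lt_of_chain hX.chain hup₁ hpp hup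
    ⟨this, hv₂ p hp this⟩
  have hnot : ∀ p ∈ r, ¬ u ≤ p.1 → (p ⊓ p₁).1 < u ∧ (p ⊓ p₁).2 < v := fun p hp hup =>
    hbelow _ (hr.inf p hp p₁ hp₁) inf_le_right fun h => hup (h.trans inf_le_left)
  have hle : ∀ p ∈ r, u ≤ p.1 ↔ v ≤ p.2 := by
    intro p hp
    constructor
    · exact fun h => hv₁.le.trans ((hr.le p₁ hp₁ p hp).1 (hleast p hp h))
    · intro h
      by_contra hup
      exact ((hnot p hp hup).2).not_ge (le_inf h hv₁.le)
  refine ⟨v, hr.insert hle (fun p hp => ?_) (fun p hp => ?_)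
    (iff_of_false hlt₁.not_isMax hv₁.not_isMax) fun _ hm => absurd hm hlt₁.not_isMax⟩
  · constructor
    · exact fun h => (hv₂ p hp (h.lt_of_ne (hdom p hp))).le
    · intro h
      refine (hbelow p hp ((hr.le p hp p₁ hp₁).2 (h.trans hv₁.le)) fun hup => ?_).1.le
      have h1 := (hr.le p₁ hp₁ p hp).1 (hleast p hp hup)
      exact (hv₁.trans_le h1).not_ge h
  · by_cases hup : u ≤ p.1
    · left
      exact Prod.ext (inf_eq_left.2 hup) (inf_eq_left.2 ((hle p hp).1 hup))
    · right
      have h1 := hnot p hp hup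
      have h2 : (u, v) ⊓ p = p ⊓ p₁ := by
        refine Prod.ext ?_ ?_
        · exact le_antisymm (le_inf inf_le_right (inf_le_left.trans hup₁))
            (le_inf h1.1.le inf_le_left)
        · exact le_antisymm (le_inf inf_le_right (inf_le_left.trans hv₁.le))
            (le_inf h1.2.le inf_le_left)
      rw [h2]
      exact hr.inf p hp p₁ hp₁

-- When `r` misses the cone of `x` at `u` and the cone of `y` at `v`, meeting a point of `r` with
-- the new pair is the same as meeting it with `(u, v)`, and the same points lie below.
omit hX hY in
theorem IsDenseIso.insert_above {u x : X} {v y : Y} (huv : (u, v) ∈ r) (hux : u < x)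
    (hx : ∀ p ∈ r, x ⊓ p.1 ≤ u) (hvy : v < y) (hy : ∀ p ∈ r, y ⊓ p.2 ≤ v)
    (hmax : IsMax x ↔ IsMax y) (hpred : iso → IsMax x → u ⋖ x ∧ v ⋖ y) :
    IsDenseIso iso (Insert.insert (x, y) r) := by
  refine hr.insert (fun p hp => iff_of_false (fun h => ?_) fun h => ?_) (fun p hp => ?_)
    (fun p hp => ?_) hmax fun hi hm => ⟨_, huv, hpred hi hm⟩
  · exact hux.not_ge ((le_inf le_rfl h).trans (hx p hp))
  · exact hvy.not_ge ((le_inf le_rfl h).trans (hy p hp))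
  · have h1 : p.1 ≤ x ↔ p.1 ≤ u :=
      ⟨fun h => (le_inf h le_rfl).trans (hx p hp), fun h => h.trans hux.le⟩
    have h2 : p.2 ≤ y ↔ p.2 ≤ v :=
      ⟨fun h => (le_inf h le_rfl).trans (hy p hp), fun h => h.trans hvy.le⟩
    rw [h1, h2]
    exact hr.le p hp _ huv
  · right
    have : (x, y) ⊓ p = (u, v) ⊓ p := by
      refine Prod.ext ?_ ?_
      · exact le_antisymm (le_inf (hx p hp) inf_le_right) (inf_le_inf_right _ hux.le)
      · exact le_antisymm (le_inf (hy p hp) inf_le_right) (inf_le_inf_right _ hvy.le)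
    rw [this]
    exact hr.inf _ huv p hp

/-- A cone is infinite exactly when it contains an element that is not a leaf. So if `r` meets an
infinite cone at `v`, the corresponding cone at `u` is infinite; for a leaf `p` this uses its
predecessor in `r` or density below it. -/
theorem IsDenseIso.exists_between_of_cone {u : X} {v b : Y} {p : X × Y} (huv : (u, v) ∈ r)
    (hp : p ∈ r) (hvb : v < b) (hbp : b ≤ p.2) (hb : ¬ IsMax b) :
    ∃ a, u < a ∧ a ≤ p.1 ∧ ¬ IsMax a := by
  have hup : u < p.1 := (hr.lt_iff huv hp).2 (hvb.trans_le hbp)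
  by_cases hm : IsMax p.1
  · by_cases hi : iso
    · obtain ⟨q, hq, hq₁, hq₂⟩ := hr.pred hi p hp hm
      have hbp' : b < p.2 := hbp.lt_of_ne fun h => hb (h ▸ (hr.max p hp).1 hm)
      have := IsDenseTree.le_of_covBy (hX := hY) hq₂ hbp'
      exact ⟨q.1, (hr.lt_iff huv hq).2 (hvb.trans_le this), hq₁.le, hq₁.lt.not_isMax⟩
    · obtain ⟨z, hz, hz'⟩ := hX.dense_leaf hi u p.1 hup hm
      exact ⟨z, hz, hz'.le, hz'.not_isMax⟩
  · exact ⟨p.1, hup, le_rfl, hm⟩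

/-- A counting argument. Let `F` be a largest set of points of `r` in distinct infinite cones at
`u`. With the cone of `z` there are `|F| + 1` infinite cones at `u`, hence also at `v`. If `r` met
all of these, each would contain the partner of a member of `F`, and two of them would share one. -/
theorem IsDenseIso.exists_free_cone (hc : SameCounts X Y) {u z : X} {v : Y} (huv : (u, v) ∈ r)
    (huz : u < z) (hzm : ¬ IsMax z) (hz : ∀ p ∈ r, z ⊓ p.1 ≤ u) :
    ∃ y, v < y ∧ ¬ IsMax y ∧ ∀ p ∈ r, y ⊓ p.2 ≤ v := by
  classical
  let good : Set (Finset (X × Y)) := {F | ↑F ⊆ r ∧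
    (∀ p ∈ F, ∃ a, u < a ∧ a ≤ p.1 ∧ ¬ IsMax a) ∧
    ∀ p ∈ F, ∀ q ∈ F, p ≠ q → p.1 ⊓ q.1 ≤ u}
  have hfin : good.Finite := by
    refine (Finset.finite_toSet hr.finite.toFinset.powerset).subset fun F hF => ?_
    exact Finset.mem_coe.2 (Finset.mem_powerset.2 fun p hp => hr.finite.mem_toFinset.2 (hF.1 hp))
  obtain ⟨F, hF, hmax⟩ := Set.Finite.exists_maximalFor Finset.card good hfin
    ⟨∅, by simp [good]⟩
  obtain ⟨hFr, hFa, hFu⟩ := hF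
  have : Nonempty X := ⟨u⟩
  choose! a ha using hFa
  have hcone : HasCones (F.card + 1) u := by
    let e := F.equivFin
    refine ⟨Fin.cons z fun i => a (e.symm i).1, ?_, ?_⟩
    · intro i
      refine Fin.cases ?_ (fun i => ?_) i
      · exact ⟨huz, hzm⟩
      · have := ha _ (e.symm i).2
        exact ⟨this.1, this.2.2⟩
    · have hzi : ∀ i : Fin F.card, ∀ c, c ≤ z → c ≤ a (e.symm i).1 → c ≤ u := fun i c h1 h2 =>
        (le_inf h1 (h2.trans (ha _ (e.symm i).2).2.1)).trans (hz _ (hFr (e.symm i).2))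
      intro i j
      refine Fin.cases ?_ (fun i => ?_) i <;> refine Fin.cases ?_ (fun j => ?_) j
      · intro h; exact absurd rfl h
      · intro _ c h1 h2
        exact hzi j c h1 h2
      · intro _ c h1 h2
        exact hzi i c h2 h1
      · intro hij c h1 h2
        simp only [Fin.cons_succ] at h1 h2
        refine (le_inf (h1.trans (ha _ (e.symm i).2).2.1) (h2.trans (ha _ (e.symm j).2).2.1)).trans
          (hFu _ (e.symm i).2 _ (e.symm j).2 fun h => hij ?_)
        rw [e.symm.injective (Subtype.ext h)]
  have hum : ¬ IsMax u := huz.not_isMax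
  have hvm : ¬ IsMax v := fun h => hum ((hr.max _ huv).2 h)
  obtain ⟨y, hy, hy'⟩ := (hc.cones _ u v hum hvm).1 hcone
  by_contra! hcon
  have hocc : ∀ i, ∃ p ∈ F, v < y i ⊓ p.2 := by
    intro i
    obtain ⟨p, hp, hp'⟩ := hcon (y i) (hy i).1 (hy i).2
    have hlt : v < y i ⊓ p.2 := lt_of_chain hY.chain inf_le_left (hy i).1.le hp'
    by_contra! hF'
    have hpF : p ∉ F := fun h => hF' p h hlt
    -- Otherwise `p` could be adjoined to `F`: its cone at `u` is infinite and different from those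
    -- of `F`, because this is so at `v`.
    have hins : Insert.insert p F ∈ good := by
      obtain ⟨b, hb⟩ := hr.exists_between_of_cone hX hY huv hp hlt inf_le_right
        fun h => (hy i).2 (h.mono inf_le_left)
      have hdisj : ∀ q ∈ F, p.1 ⊓ q.1 ≤ u := by
        intro q hq
        by_contra hpq
        have h1 : u < p.1 ⊓ q.1 :=
          lt_of_chain hX.chain inf_le_left (hb.1.le.trans hb.2.1) hpq
        have h2 : v < p.2 ⊓ q.2 := (hr.lt_iff huv (hr.inf p hp q (hFr hq))).1 h1
        exact hF' q hq (lt_inf_trans hY.chain hlt h2)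
      refine ⟨?_, ?_, ?_⟩
      · intro q hq
        rcases Finset.mem_insert.1 (Finset.mem_coe.1 hq) with rfl | hq
        exacts [hp, hFr hq]
      · intro q hq
        rcases Finset.mem_insert.1 hq with rfl | hq
        exacts [⟨b, hb⟩, ⟨a q, ha q hq⟩]
      · intro q hq q' hq' hne
        rcases Finset.mem_insert.1 hq with rfl | hq <;>
          rcases Finset.mem_insert.1 hq' with rfl | hq'
        exacts [absurd rfl hne, hdisj q' hq', inf_comm q'.1 q.1 ▸ hdisj q (by assumption), hFu q hq q' hq' hne]
    have := hmax hins (Finset.card_le_card (Finset.subset_insert _ _))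
    rw [Finset.card_insert_of_notMem hpF] at this
    omega
  choose P hP hP' using hocc
  obtain ⟨i, -, j, -, hij, hPij⟩ := Finset.exists_ne_map_eq_of_card_lt_of_maps_to
    (s := (Finset.univ : Finset (Fin (F.card + 1)))) (t := F) (by simp) (f := P)
    (fun i _ => hP i)
  have h1 : v < (P i).2 ⊓ y j := by
    rw [hPij, inf_comm]; exact hP' j
  have h2 := lt_inf_trans hY.chain (hP' i) h1
  exact h2.not_ge (hy' i j hij _ inf_le_left inf_le_right)

/-- The same count for leaves. A leaf over `v` occurring in `r` comes from a leaf over `u`: the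
predecessor of its partner belongs to `r` and is matched with `v`. -/
theorem IsDenseIso.exists_free_leaf (hc : SameCounts X Y) (hi : iso) {u x : X} {v : Y}
    (huv : (u, v) ∈ r) (hux : u ⋖ x) (hxm : IsMax x) (hx : ∀ p ∈ r, p.1 ≠ x) :
    ∃ y, v ⋖ y ∧ IsMax y ∧ ∀ p ∈ r, y ⊓ p.2 ≤ v := by
  classical
  let F := hr.finite.toFinset.filter fun p => IsMax p.1 ∧ u ⋖ p.1
  have hF : ∀ p, p ∈ F ↔ p ∈ r ∧ IsMax p.1 ∧ u ⋖ p.1 := by simp [F]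
  have hleaves : HasLeaves (F.card + 1) u := by
    let e := F.equivFin
    refine ⟨Fin.cons x fun i => (e.symm i).1.1, ?_, ?_⟩
    · intro i
      refine Fin.cases ?_ (fun i => ?_) i
      · exact ⟨hxm, hux⟩
      · exact ((hF _).1 (e.symm i).2).2
    · rw [Fin.cons_injective_iff]
      constructor
      · rintro ⟨i, hi⟩
        exact hx _ ((hF _).1 (e.symm i).2).1 hi
      · intro i j hij
        have h1 := ((hF _).1 (e.symm i).2).1
        have h2 := ((hF _).1 (e.symm j).2).1
        have : (e.symm i).1 = (e.symm j).1 := Prod.ext hij ((hr.eq_iff h1 h2).1 hij)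
        exact e.symm.injective (Subtype.ext this)
  have hum : ¬ IsMax u := hux.lt.not_isMax
  have hvm : ¬ IsMax v := fun h => hum ((hr.max _ huv).2 h)
  obtain ⟨y, hy, hinj⟩ := (hc.leaves _ u v hum hvm).1 hleaves
  have hfree : ∃ i, ∀ p ∈ r, p.2 ≠ y i := by
    by_contra! hcon
    choose P hP hP' using hcon
    have hPF : ∀ i, P i ∈ F := by
      intro i
      have hm : IsMax (P i).1 := (hr.max _ (hP i)).2 (hP' i ▸ (hy i).1)
      refine (hF _).2 ⟨hP i, hm, ?_⟩
      obtain ⟨q, hq, hq₁, hq₂⟩ := hr.pred hi _ (hP i) hm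
      have hvP : v ⋖ (P i).2 := hP' i ▸ (hy i).2
      have : v = q.2 := le_antisymm (IsDenseTree.le_of_covBy (hX := hY) hq₂ hvP.lt)
        (IsDenseTree.le_of_covBy (hX := hY) hvP hq₂.lt)
      have : u = q.1 := (hr.eq_iff huv hq).2 this
      exact this ▸ hq₁
    obtain ⟨i, -, j, -, hij, hPij⟩ := Finset.exists_ne_map_eq_of_card_lt_of_maps_to
      (s := (Finset.univ : Finset (Fin (F.card + 1)))) (t := F) (by simp) (f := P)
      (fun i _ => hPF i)
    exact hij (hinj (by rw [← hP' i, ← hP' j, hPij]))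
  obtain ⟨i, hfree⟩ := hfree
  refine ⟨y i, (hy i).2, (hy i).1, fun p hp => ?_⟩
  refine IsDenseTree.le_of_covBy (hX := hY) (hy i).2 (inf_le_left.lt_of_ne fun h => ?_)
  exact hfree p hp ((hy i).1.eq_of_le (inf_eq_left.1 h)).symm

theorem IsDenseIso.exists_insert_node (hc : SameCounts X Y) {u x : X} {v : Y} (huv : (u, v) ∈ r)
    (hux : u ≤ x) (hx : ∀ p ∈ r, x ⊓ p.1 ≤ u) (hxm : ¬ IsMax x) :
    ∃ y, IsDenseIso iso (Insert.insert (x, y) r) := by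
  rcases hux.eq_or_lt with rfl | hux
  · exact ⟨v, by rwa [Set.insert_eq_of_mem huv]⟩
  obtain ⟨y, hvy, hym, hy⟩ := hr.exists_free_cone hX hY hc huv hux hxm hx
  exact ⟨y, hr.insert_above huv hux hx hvy hy (iff_of_false hxm hym) fun _ h => absurd h hxm⟩

/-- Let `u` be the largest meet of `x` with a point of `r`. Once `u` is adjoined, either `x = u` or
`x` lies in a cone at `u` not met by the relation, and the counts supply a free place over the
partner of `u`. -/
theorem IsDenseIso.forth_of_nonempty (hc : SameCounts X Y) (hne : r.Nonempty) (x : X) :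
    ∃ y r', IsDenseIso iso r' ∧ Insert.insert (x, y) r ⊆ r' := by
  obtain ⟨p₀, hp₀, hmax⟩ := Set.Finite.exists_maximalFor (fun p : X × Y => x ⊓ p.1) r hr.finite hne
  set u := x ⊓ p₀.1 with hu
  have hle : ∀ p ∈ r, x ⊓ p.1 ≤ u := fun p hp => by
    rcases hX.chain x (x ⊓ p.1) u inf_le_left inf_le_left with h | h
    exacts [h, hmax hp h]
  obtain ⟨v, hr₁⟩ := hr.exists_insert_below hX hY hp₀ (u := u) inf_le_right
  have hle₁ : ∀ p ∈ Insert.insert (u, v) r, x ⊓ p.1 ≤ u := by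
    rintro p (rfl | hp)
    exacts [inf_le_right, hle p hp]
  have huv : (u, v) ∈ Insert.insert (u, v) r := Set.mem_insert _ _
  by_cases hxm : IsMax x
  swap
  · obtain ⟨y, hy⟩ := hr₁.exists_insert_node hX hY hc huv inf_le_left hle₁ hxm
    exact ⟨y, _, hy, Set.insert_subset_insert (Set.subset_insert _ _)⟩
  rcases (inf_le_left : u ≤ x).eq_or_lt with hux | hux
  · exact ⟨v, _, hr₁, by rw [← hux]⟩
  by_cases hi : iso
  -- An isolated leaf must bring its predecessor along, so `q` is adjoined before `x`.
  · obtain ⟨q, hq⟩ := hX.pred hi x hxm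
    have huq : u ≤ q := IsDenseTree.le_of_covBy (hX := hX) hq hux
    obtain ⟨w, hr₂⟩ := hr₁.exists_insert_node hX hY hc huv huq
      (fun p hp => (inf_le_inf_right _ hq.le).trans (hle₁ p hp)) hq.lt.not_isMax
    have hle₂ : ∀ p ∈ Insert.insert (q, w) (Insert.insert (u, v) r), x ⊓ p.1 ≤ q := by
      rintro p (rfl | hp)
      exacts [inf_le_right, (hle₁ p hp).trans huq]
    have hqw : (q, w) ∈ Insert.insert (q, w) (Insert.insert (u, v) r) := Set.mem_insert _ _
    obtain ⟨y, hwy, hym, hy⟩ := hr₂.exists_free_leaf hX hY hc hi hqw hq hxm fun p hp h => by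
      have := hle₂ p hp
      rw [h, inf_idem] at this
      exact hq.lt.not_ge this
    exact ⟨y, _, hr₂.insert_above hqw hq.lt hle₂ hwy.lt hy (iff_of_true hxm hym)
      fun _ _ => ⟨hq, hwy⟩, Set.insert_subset_insert
        ((Set.subset_insert _ _).trans (Set.subset_insert _ _))⟩
  -- For a non isolated leaf, a node between `u` and `x` shows that the cone is infinite; any leaf
  -- above the node found on the other side will do.
  · obtain ⟨z, huz, hzx⟩ := hX.dense_leaf hi u x hux hxm
    obtain ⟨y', hvy', hym', hy'⟩ := hr₁.exists_free_cone hX hY hc huv huz hzx.not_isMax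
      fun p hp => (inf_le_inf_right _ hzx.le).trans (hle₁ p hp)
    obtain ⟨y, hyy, hym⟩ := hY.leaf_above y'
    refine ⟨y, _, hr₁.insert_above huv hux hle₁ (hvy'.trans_le hyy) (fun p hp => ?_)
      (iff_of_true hxm hym) fun h => absurd h hi, Set.insert_subset_insert (Set.subset_insert _ _)⟩
    by_contra hcon
    have h1 : v < p.2 ⊓ y := by
      rw [inf_comm]; exact lt_of_chain hY.chain inf_le_left (hvy'.trans_le hyy).le hcon
    have h2 : v < y ⊓ y' := by rwa [inf_eq_right.2 hyy]
    have h3 := lt_inf_trans hY.chain h1 h2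
    rw [inf_comm] at h3
    exact h3.not_ge (hy' p hp)

theorem IsDenseIso.forth (hc : SameCounts X Y) [Nonempty Y] (x : X) :
    ∃ y r', IsDenseIso iso r' ∧ Insert.insert (x, y) r ⊆ r' := by
  by_cases hne : r.Nonempty
  · exact hr.forth_of_nonempty hX hY hc hne x
  · rw [Set.not_nonempty_iff_eq_empty] at hne
    subst hne
    -- With nothing to compare with, any pair of non maximal elements can start the relation.
    obtain ⟨x₀, hx₀⟩ := hX.no_bot x
    obtain ⟨y₀, hy₀⟩ := hY.no_bot (Classical.arbitrary Y)
    have h₀ : IsDenseIso iso (Insert.insert (x₀, y₀) ∅) :=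
      hr.insert (by simp) (by simp) (by simp) (iff_of_false hx₀.not_isMax hy₀.not_isMax)
        fun _ h => absurd h hx₀.not_isMax
    obtain ⟨y, r', h1, h2⟩ := h₀.forth_of_nonempty hX hY hc (Set.insert_nonempty _ _) x
    exact ⟨y, r', h1, (Set.insert_subset_insert (Set.empty_subset _)).trans h2⟩

omit hr

/-- Adjoin to `s` the predecessors of its leaves, then all meets of two pairs. Two meets having a
factor in common are comparable, so a meet of three pairs is already a meet of two, and the finite
result is closed. -/
theorem exists_isDenseIso_of_isTreeIso {s : Set (X × Y)} (hr : IsTreeIso r) (hsr : s ⊆ r)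
    (hs : s.Finite) : ∃ r', IsDenseIso iso r' ∧ s ⊆ r' := by
  let s' : Set (X × Y) := s ∪ ⋃ p ∈ s, {q | IsMax p.1 ∧ q.1 ⋖ p.1 ∧ q.2 ⋖ p.2}
  have hs' : s'.Finite := by
    refine hs.union (hs.biUnion fun p hp => Set.Subsingleton.finite ?_)
    rintro q ⟨-, h1, h2⟩ q' ⟨-, h3, h4⟩
    exact Prod.ext
      (le_antisymm (IsDenseTree.le_of_covBy (hX := hX) h3 h1.lt)
        (IsDenseTree.le_of_covBy (hX := hX) h1 h3.lt))
      (le_antisymm (IsDenseTree.le_of_covBy (hX := hY) h4 h2.lt)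
        (IsDenseTree.le_of_covBy (hX := hY) h2 h4.lt))
  have hs'r : s' ⊆ r := by
    rintro q (hq | hq)
    · exact hsr hq
    · simp only [Set.mem_iUnion] at hq
      obtain ⟨p, hp, h1, h2, h3⟩ := hq
      exact hr.pred p (hsr hp) h1 q h2 h3
  have htri : ∀ p ∈ r, ∀ q ∈ r, ∀ t ∈ r, p ⊓ q ⊓ t = p ⊓ q ∨ p ⊓ q ⊓ t = p ⊓ t := by
    intro p hp q hq t ht
    rcases hX.chain p.1 (p ⊓ q).1 (p ⊓ t).1 inf_le_left inf_le_left with h | h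
    · have h' := (hr.le _ (hr.inf p hp q hq) _ (hr.inf p hp t ht)).1 h
      left
      exact inf_eq_left.2 (le_trans (show p ⊓ q ≤ p ⊓ t from ⟨h, h'⟩) inf_le_right)
    · have h' := (hr.le _ (hr.inf p hp t ht) _ (hr.inf p hp q hq)).1 h
      right
      rw [inf_right_comm]
      exact inf_eq_left.2 (le_trans (show p ⊓ t ≤ p ⊓ q from ⟨h, h'⟩) inf_le_right)
  refine ⟨Set.image2 (· ⊓ ·) s' s', ?_, fun p hp => ⟨p, Or.inl hp, p, Or.inl hp, inf_idem p⟩⟩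
  have hsub : Set.image2 (· ⊓ ·) s' s' ⊆ r := by
    rintro _ ⟨p, hp, q, hq, rfl⟩
    exact hr.inf p (hs'r hp) q (hs'r hq)
  have htri' : ∀ p ∈ s', ∀ q ∈ s', ∀ t ∈ s', p ⊓ q ⊓ t ∈ Set.image2 (· ⊓ ·) s' s' := by
    intro p hp q hq t ht
    rcases htri p (hs'r hp) q (hs'r hq) t (hs'r ht) with h | h
    · rw [h]; exact ⟨p, hp, q, hq, rfl⟩
    · rw [h]; exact ⟨p, hp, t, ht, rfl⟩
  refine ⟨Set.Finite.image2 _ hs' hs', fun p hp q hq => hr.le p (hsub hp) q (hsub hq), ?_,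
    fun p hp => hr.max p (hsub hp), ?_⟩
  · rintro _ ⟨p, hp, q, hq, rfl⟩ _ ⟨p', hp', q', hq', rfl⟩
    obtain ⟨a, ha, b, hb, hab⟩ := htri' p hp q hq p' hp'
    have := htri' a ha b hb q' hq'
    change a ⊓ b = p ⊓ q ⊓ p' at hab
    rw [hab, inf_assoc] at this
    exact this
  · rintro hi _ ⟨p, hp, q, hq, rfl⟩ hm
    have hm' := (hr.max _ (hsub ⟨p, hp, q, hq, rfl⟩)).1 hm
    have hpq : p ⊓ q = p := Prod.ext (hm.eq_of_le inf_le_left) (hm'.eq_of_le inf_le_left)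
    simp only [hpq] at hm hm' ⊢
    -- Only original pairs can be leaves; an adjoined predecessor has something above it.
    rcases hp with hps | hps
    · obtain ⟨a, ha⟩ := hX.pred hi p.1 hm
      obtain ⟨b, hb⟩ := hY.pred hi p.2 hm'
      have hab : (a, b) ∈ s' := Or.inr (by
        simp only [Set.mem_iUnion]
        exact ⟨p, hps, hm, ha, hb⟩)
      exact ⟨(a, b), ⟨_, hab, _, hab, inf_idem _⟩, ha, hb⟩
    · simp only [Set.mem_iUnion] at hps
      obtain ⟨p', hp', -, h2, -⟩ := hps
      exact absurd hm h2.lt.not_isMax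

theorem isClassSystem_dense (hc : SameCounts X Y) [Nonempty X] [Nonempty Y] :
    IsClassSystem fun s : Set (X × Y) => ∃ r, IsDenseIso iso r ∧ s ⊆ r where
  backForth :=
    { forth := by
        rintro s ⟨r, hr, hsr⟩ a
        obtain ⟨b, r', hr', h⟩ := hr.forth hX hY hc a
        exact ⟨b, r', hr', (Set.insert_subset_insert hsr).trans h⟩
      back := by
        rintro s ⟨r, hr, hsr⟩ b
        obtain ⟨a, r', hr', h⟩ := hr.swap.forth hY hX hc.swap b
        refine ⟨a, _, hr'.swap, ?_⟩
        rw [← preimage_swap_insert]  at h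
        exact (Set.insert_subset_insert hsr).trans fun p hp => h (a := p.swap) (by simpa using hp) }
  empty := ⟨∅, ⟨Set.finite_empty, by simp, by simp, by simp, by simp⟩, subset_rfl⟩
  preservesLE := by
    rintro s ⟨r, hr, hsr⟩ p hp q hq
    exact hr.le p (hsr hp) q (hsr hq)
  of_isTreeIso r s hr hsr hs := exists_isDenseIso_of_isTreeIso hX hY hr hsr hs

end Dense

end Class

/-! ## Back-and-forth systems between trees equivalent to a 1-colored tree -/

section OneColored

theorem le_encard_iff {X : Type u} {S : Set X} {k : ℕ} :
    (k : ℕ∞) ≤ S.encard ↔ ∃ f : Fin k → X, Function.Injective f ∧ ∀ i, f i ∈ S := by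
  constructor
  · intro h
    obtain ⟨t, ht, hk⟩ := Set.exists_subset_encard_eq h
    have hfin : t.Finite := Set.finite_of_encard_eq_coe hk
    have : t.ncard = k := by simp [Set.ncard, hk]
    have := hfin.fintype
    let e : Fin k ≃ t := (Fintype.equivFinOfCardEq (by
      rw [← Nat.card_eq_fintype_card, Nat.card_coe_set_eq]; assumption)).symm
    exact ⟨fun i => (e i).1, fun i j hij => e.injective (Subtype.ext hij), fun i => ht (e i).2⟩
  · rintro ⟨f, hf, hfS⟩
    have h := hf.encard_range.trans (Set.encard_le_encard (Set.range_subset_iff.2 hfS))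
    rwa [ENat.card_eq_coe_fintype_card, Fintype.card_fin] at h

variable {X : Type u} [SemilatticeInf X]

theorem cone_eq_of_lt_inf (hchain : ∀ x y z : X, y ≤ x → z ≤ x → y ≤ z ∨ z ≤ y) {u a b : X}
    (h : u < a ⊓ b) : cone u a = cone u b :=
  Set.ext fun _ => ⟨fun h' => lt_inf_trans hchain h' h,
    fun h' => lt_inf_trans hchain h' (inf_comm a b ▸ h)⟩

/-- A cone is infinite exactly when it contains an element that is not a leaf: density below such an
element gives infinitely many others, and two distinct elements of a cone have a meet in it that is
not a leaf. -/
theorem IsDenseTree.hasCones_iff {iso : Prop} (hX : IsDenseTree X iso) (k : ℕ) (u : X) :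
    HasCones k u ↔ (k : ℕ∞) ≤ {C ∈ conesAt u | C.Infinite}.encard := by
  rw [le_encard_iff]
  constructor
  · rintro ⟨y, hy, hyz⟩
    refine ⟨fun i => cone u (y i), fun i j hij => ?_, fun i => ⟨⟨y i, (hy i).1, rfl⟩, ?_⟩⟩
    · by_contra hne
      have h : y i ∈ cone u (y j) := by
        rw [← show cone u (y i) = cone u (y j) from hij]
        simpa [cone] using (hy i).1
      exact (hyz i j hne _ inf_le_left inf_le_right).not_gt h
    · intro hfin
      have hfin' : {t | u < t ∧ t ≤ y i}.Finite := hfin.subset fun t ht => by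
        simpa [cone, inf_eq_left.2 ht.2] using ht.1
      obtain ⟨t, ht, hmin⟩ := hfin'.exists_minimal ⟨y i, (hy i).1, le_rfl⟩
      obtain ⟨z, hz, hz'⟩ := hX.dense u t ht.1 fun hm => (hy i).2 (hm.mono ht.2)
      exact hz'.not_ge (hmin ⟨hz, hz'.le.trans ht.2⟩ hz'.le)
  · rintro ⟨C, hC, hCS⟩
    have key : ∀ i, ∃ y, (u < y ∧ ¬ IsMax y) ∧ C i = cone u y := by
      intro i
      obtain ⟨⟨y, hy, hCy⟩, hinf⟩ := hCS i
      obtain ⟨t, ht, hty⟩ := hinf.nontrivial.exists_ne y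
      rw [hCy] at ht
      refine ⟨t ⊓ y, ⟨ht, fun hm => hty ?_⟩, ?_⟩
      · exact (hm.eq_of_le inf_le_left).symm.trans (hm.eq_of_le inf_le_right)
      · rw [hCy]
        refine cone_eq_of_lt_inf hX.chain ?_
        rw [inf_left_comm, inf_idem]
        exact ht
    choose y hy hCy using key
    refine ⟨y, hy, fun i j hij z hzi hzj => ?_⟩
    by_contra hcon
    have h1 : u < z := lt_of_chain hX.chain hzi (hy i).1.le hcon
    exact hij (hC (by rw [hCy, hCy, cone_eq_of_lt_inf hX.chain (h1.trans_le (le_inf hzi hzj))]))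

theorem hasLeaves_iff (k : ℕ) (u : X) :
    HasLeaves k u ↔ (k : ℕ∞) ≤ {α : X | IsMax α ∧ u ⋖ α}.encard := by
  rw [le_encard_iff]
  exact ⟨fun ⟨y, hy, hinj⟩ => ⟨y, hinj, hy⟩, fun ⟨y, hinj, hy⟩ => ⟨y, hy, hinj⟩⟩

/-- The meet of the unique node with any other element is a node, hence that node. -/
theorem IsType0.hasRoot (h : IsType0 X) : HasRoot X := by
  obtain ⟨⟨r, hr, hr'⟩, -⟩ := h
  refine ⟨r, fun x => ?_⟩
  by_contra hcon
  have hne : r ≠ x := fun h => hcon h.le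
  exact hcon (inf_eq_left.1 (hr' _ ⟨r, x, hne, rfl⟩))

theorem IsOneColored.isType0 (h : IsOneColored X) (hr : HasRoot X) : IsType0 X :=
  h.type.elim id fun h' => h'.elim (fun h' => absurd hr h'.1) fun h' => absurd hr h'.1

/-- Everything with an element above it is a node, and there is only one node. -/
theorem IsOneColored.height (h : IsOneColored X) (hr : HasRoot X) :
    ∀ x y z : X, x < y → ¬ y < z := by
  intro x y z hxy hyz
  obtain ⟨⟨r, -, hr'⟩, -⟩ := h.isType0 hr
  have hx := hr' x ((isNode_iff h.good x).2 hxy.not_isMax)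
  have hy := hr' y ((isNode_iff h.good y).2 hyz.not_isMax)
  exact hxy.ne (hx.trans hy.symm)

theorem exists_lt_of_not_hasRoot (h : ¬ HasRoot X) (x : X) : ∃ y, y < x := by
  have : ¬ IsBot x := fun hx => h ⟨x, hx⟩
  simp only [IsBot, not_forall] at this
  obtain ⟨z, hz⟩ := this
  exact ⟨z ⊓ x, inf_lt_right.2 hz⟩

/-- Types (1.a) and (1.b) in a common form, with `m = 0` in the first case. The bound `1 ≤ m` serves
only to decide `Rooted` in the extension. -/
theorem IsOneColored.isDenseTree (h : IsOneColored X) (hr : ¬ HasRoot X) :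
    ∃ (iso : Prop) (μ m : ℕ∞), IsDenseTree X iso ∧ (iso → 1 ≤ m) ∧ ∀ u : X, ¬ IsMax u →
      {C ∈ conesAt u | C.Infinite}.encard = μ ∧ {α : X | IsMax α ∧ u ⋖ α}.encard = m := by
  rcases h.type with h' | h' | h'
  · exact absurd h'.hasRoot hr
  · obtain ⟨-, μ, -, hd, hμ⟩ := h'
    -- The cone of `y` at `x` is infinite, so it contains another element, which branches off below
    -- `y` and above `x`.
    have hdl : ∀ x y : X, x < y → IsMax y → ∃ z, x < z ∧ z < y := by
      intro x y hxy hm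
      have hinf := (hμ x ((isNode_iff h.good x).2 hxy.not_isMax)).2 _ ⟨y, hxy, rfl⟩
      obtain ⟨t, ht, hty⟩ := hinf.nontrivial.exists_ne y
      refine ⟨t ⊓ y, ht, inf_lt_right.2 fun hyt => hty (hm.eq_of_le hyt).symm⟩
    refine ⟨False, μ, 0, ⟨h.good.chain_below, h.good.leaf_above, exists_lt_of_not_hasRoot hr,
      fun x y hxy hm => ?_, fun h => h.elim, fun _ => hdl⟩, fun h => h.elim, fun u hu => ⟨?_, ?_⟩⟩
    · obtain ⟨α, hyα, hα⟩ := h.good.leaf_above y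
      have hlt : y < α := hyα.lt_of_ne fun h => hm (h ▸ hα)
      obtain ⟨z, hz, hz'⟩ := (hd α hα).dense ⟨x, hxy.trans hlt⟩ ⟨y, hlt⟩ hxy
      exact ⟨z, hz, hz'⟩
    · have := hμ u ((isNode_iff h.good u).2 hu)
      rw [← this.1]
      congr 1
      ext C
      exact ⟨fun h => h.1, fun h => ⟨h, this.2 C h⟩⟩
    · rw [Set.encard_eq_zero, Set.eq_empty_iff_forall_notMem]
      rintro α ⟨hα, hu⟩
      obtain ⟨z, hz, hz'⟩ := hdl u α hu.lt hα
      exact hu.2 hz hz'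
  · obtain ⟨-, m, μ, hm₁, -, hd, hμ⟩ := h'
    refine ⟨True, μ, m, ⟨h.good.chain_below, h.good.leaf_above, exists_lt_of_not_hasRoot hr,
      fun x y hxy hm => ?_, fun _ α hα => (hd α hα).imp fun _ => And.left,
      fun h => absurd trivial h⟩, fun _ => hm₁, fun u hu => ?_⟩
    · obtain ⟨α, hyα, hα⟩ := h.good.leaf_above y
      have hlt : y < α := hyα.lt_of_ne fun h => hm (h ▸ hα)
      obtain ⟨q, hq, hdq⟩ := hd α hα
      have hyq : y ≤ q := by
        by_contra hcon
        exact hq.2 (lt_of_chain h.good.chain_below hyα hq.le hcon) hlt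
      obtain ⟨z, hz, hz'⟩ := hdq.dense ⟨x, hxy.le.trans hyq⟩ ⟨y, hyq⟩ hxy
      exact ⟨z, hz, hz'⟩
    · exact (hμ u ((isNode_iff h.good u).2 hu)).symm

/-- All that the two kinds of systems use is first-order in the order and so passes from `T₀` to `X`
and `Y`. Possibly infinite counts enter only through the statements "at least `k`". -/
theorem exists_isClassSystem {T₀ : Type w} [SemilatticeInf T₀] (hT₀ : IsOneColored T₀)
    {X Y : Type u} [SemilatticeInf X] [SemilatticeInf Y]
    (hX : orderTheoryOf X = orderTheoryOf T₀) (hY : orderTheoryOf Y = orderTheoryOf T₀) :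
    ∃ K : Set (X × Y) → Prop, IsClassSystem K := by
  by_cases hr : HasRoot T₀
  · have h := hT₀.height hr
    exact ⟨_, isClassSystem_star (hasRoot_transfer hX.symm hr) (height_transfer hX.symm h)
      (hasRoot_transfer hY.symm hr) (height_transfer hY.symm h) fun n =>
        ⟨natCast_le_card_transfer (hX.trans hY.symm) n,
          natCast_le_card_transfer (hY.trans hX.symm) n⟩⟩
  · obtain ⟨iso, μ, m, hd, -, hu⟩ := hT₀.isDenseTree hr
    have hne : ∀ {Z : Type u} [SemilatticeInf Z], orderTheoryOf Z = orderTheoryOf T₀ →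
        Nonempty Z := by
      intro Z _ hZ
      obtain ⟨x, -⟩ := hT₀.nontrivial
      have := natCast_le_card_transfer hZ.symm 1 (by
        rw [Nat.cast_one, Cardinal.one_le_iff_ne_zero]
        exact Cardinal.mk_ne_zero_iff.2 ⟨x⟩)
      rw [Nat.cast_one, Cardinal.one_le_iff_ne_zero] at this
      exact Cardinal.mk_ne_zero_iff.1 this
    have hdense : ∀ {Z : Type u} [SemilatticeInf Z], orderTheoryOf Z = orderTheoryOf T₀ →
        IsDenseTree Z iso := fun hZ =>
      ⟨chain_transfer hZ.symm hd.chain, leaf_above_transfer hZ.symm hd.leaf_above,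
        noBot_transfer hZ.symm hd.no_bot, dense_transfer hZ.symm hd.dense,
        fun hi => pred_leaf_transfer hZ.symm (hd.pred hi),
        fun hi => dense_leaf_transfer hZ.symm (hd.dense_leaf hi)⟩
    have hcones : ∀ k (a b : T₀), ¬ IsMax a → ¬ IsMax b → HasCones k a → HasCones k b := by
      intro k a b ha hb
      rw [hd.hasCones_iff, hd.hasCones_iff, (hu a ha).1, (hu b hb).1]
      exact id
    have hleaves : ∀ k (a b : T₀), ¬ IsMax a → ¬ IsMax b → HasLeaves k a → HasLeaves k b := by
      intro k a b ha hb
      rw [hasLeaves_iff, hasLeaves_iff, (hu a ha).2, (hu b hb).2]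
      exact id
    have := hne hX
    have := hne hY
    exact ⟨_, isClassSystem_dense (hdense hX) (hdense hY)
      ⟨fun k a b ha hb => ⟨hasCones_transfer hX.symm hY.symm k (hcones k) a b ha hb,
          hasCones_transfer hY.symm hX.symm k (hcones k) b a hb ha⟩,
        fun k a b ha hb => ⟨hasLeaves_transfer hX.symm hY.symm k (hleaves k) a b ha hb,
          hasLeaves_transfer hY.symm hX.symm k (hleaves k) b a hb ha⟩⟩⟩

end OneColored

/-! ## Semantics of the axioms -/

section Holds

variable {M : Type u} [SemilatticeInf M] {κ : Type} {n : ℕ}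

/-- The value of a term in a tree. -/
noncomputable def ev (g : κ → M →. M) (t : Tm κ n) (xs : Fin n → M) : M :=
  letI := treeStructure g
  t.realize (Sum.elim (default : Empty → M) xs)

/-- The truth of a formula in a tree. -/
def Holds (g : κ → M →. M) (φ : Fm κ n) (xs : Fin n → M) : Prop :=
  letI := treeStructure g
  φ.Realize (default : Empty → M) xs

variable (g : κ → M →. M) (xs : Fin n → M) (s t : Tm κ n) (φ ψ : Fm κ n)

@[simp] theorem ev_up (a : M) : ev g (up t) (Fin.snoc xs a) = ev g t xs :=
  letI := treeStructure g
  realize_up t a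

@[simp] theorem ev_new (a : M) : ev g new (Fin.snoc xs a) = a :=
  letI := treeStructure g
  realize_new a

@[simp] theorem ev_meet : ev g (meet s t) xs = ev g s xs ⊓ ev g t xs := by
  let _ := treeStructure g
  exact (realize_meet s t).trans (funMap_meet g _ _)

@[simp] theorem ev_app (i : κ) : ev g (app i t) xs = total (g i) (ev g t xs) := by
  let _ := treeStructure g
  exact (realize_app i t).trans (funMap_fn g _ _)

@[simp] theorem holds_le : Holds g (le s t) xs ↔ ev g s xs ≤ ev g t xs := by
  let _ := treeStructure g
  exact (realize_le s t).trans (relMap_le g _ _)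

@[simp] theorem holds_eq : Holds g (s =' t) xs ↔ ev g s xs = ev g t xs := Iff.rfl

@[simp] theorem holds_imp : Holds g (φ ⟹ ψ) xs ↔ (Holds g φ xs → Holds g ψ xs) := Iff.rfl

@[simp] theorem holds_not : Holds g (∼φ) xs ↔ ¬ Holds g φ xs := Iff.rfl

@[simp] theorem holds_inf : Holds g (φ ⊓ ψ) xs ↔ Holds g φ xs ∧ Holds g ψ xs :=
  letI := treeStructure g
  BoundedFormula.realize_inf

@[simp] theorem holds_sup : Holds g (φ ⊔ ψ) xs ↔ Holds g φ xs ∨ Holds g ψ xs :=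
  letI := treeStructure g
  BoundedFormula.realize_sup

@[simp] theorem holds_iff : Holds g (φ ⇔ ψ) xs ↔ (Holds g φ xs ↔ Holds g ψ xs) :=
  letI := treeStructure g
  BoundedFormula.realize_iff

@[simp] theorem holds_all (φ : Fm κ (n + 1)) :
    Holds g (∀' φ) xs ↔ ∀ a, Holds g φ (Fin.snoc xs a) := Iff.rfl

@[simp] theorem holds_ex (φ : Fm κ (n + 1)) :
    Holds g (∃' φ) xs ↔ ∃ a, Holds g φ (Fin.snoc xs a) :=
  letI := treeStructure g
  BoundedFormula.realize_ex

@[simp] theorem holds_lt : Holds g (lt s t) xs ↔ ev g s xs < ev g t xs := by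
  simp [lt, lt_iff_le_and_ne]

@[simp] theorem holds_leaf : Holds g (leaf t) xs ↔ IsMax (ev g t xs) := by
  let _ := treeStructure g
  exact (realize_leaf t).trans (relMap_leaf g _)

@[simp] theorem holds_dom (i : κ) : Holds g (dom i t) xs ↔ (g i (ev g t xs)).Dom := by
  let _ := treeStructure g
  exact (realize_dom i t).trans (relMap_dom g i _)

@[simp] theorem holds_im (i : κ) : Holds g (im i t) xs ↔ ev g t xs ∈ (g i).ran := by
  let _ := treeStructure g
  exact (realize_im i t).trans (relMap_im g i _)

@[simp] theorem holds_cov : Holds g (cov s t) xs ↔ ev g s xs ⋖ ev g t xs := by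
  simp only [cov, holds_inf, holds_lt, holds_all, holds_not, ev_up, ev_new, not_and]
  rfl

theorem model_iff_holds (S : (treeLang κ).Theory) : @Theory.Model _ M (treeStructure g) S ↔
    ∀ φ ∈ S, Holds g (φ : Fm κ 0) default :=
  letI := treeStructure g
  Theory.model_iff S

end Holds

/-! ### The relation `∼` and truth in its classes. -/

section Sim

/-- Each leaf has a predecessor, and `p(α) < p(β)` for no leaves `α` and `β`. -/
def Rooted (M : Type u) [Preorder M] : Prop :=
  (∀ α : M, IsMax α → ∃ q, q ⋖ α) ∧
    ∀ α β q q' : M, IsMax α → IsMax β → q ⋖ α → q' ⋖ β → ¬ q < q'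

variable {M : Type u} [SemilatticeInf M]

/-- The relation `x ∼ y`. -/
def Sim (e : M →. M) (x y : M) : Prop :=
  x = y ∨ (e x).Dom ∧ (e y).Dom ∧ total e x = total e y ∧ (Rooted M ∨ total e x < x ⊓ y)

variable {ι : Type} {n : ℕ} (g : AddE ι → M →. M) (xs : Fin n → M) (s t : Tm (AddE ι) n)

@[simp] theorem ev_eFn : ev g (eFn t) xs = total (g .e) (ev g t xs) := ev_app ..

@[simp] theorem holds_inE : Holds g (inE t) xs ↔ ev g t xs ∈ (g .e).ran := holds_im ..

@[simp] theorem holds_inEge : Holds g (inEge t) xs ↔ (g .e (ev g t xs)).Dom := holds_dom ..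

@[simp] theorem holds_inEgt : Holds g (inEgt t) xs ↔
    (g .e (ev g t xs)).Dom ∧ ev g t xs ∉ (g .e).ran := by simp [inEgt]

@[simp] theorem holds_inEle : Holds g (inEle t) xs ↔
    ¬ (g .e (ev g t xs)).Dom ∨ ev g t xs ∈ (g .e).ran := by simp [inEle]

@[simp] theorem holds_rooted : Holds g (rooted : Fm (AddE ι) n) xs ↔ Rooted M := by
  simp only [rooted, holds_inf, holds_all, holds_imp, holds_leaf, holds_ex, holds_cov, holds_not,
    holds_lt, ev_up, ev_new, Rooted]

@[simp] theorem holds_sim : Holds g (sim s t) xs ↔ Sim (g .e) (ev g s xs) (ev g t xs) := by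
  simp [sim, Sim, and_assoc]

/-- `x̄ ≤ ȳ` in the quotient. -/
def LeBar (e : M →. M) (x y : M) : Prop := ∃ a b, Sim e a x ∧ Sim e b y ∧ a ≤ b

@[simp] theorem holds_leBar : Holds g (leBar s t) xs ↔
    LeBar (g .e) (ev g s xs) (ev g t xs) := by
  simp [leBar, LeBar, and_assoc]

theorem holds_leafBar : Holds g (leafBar t) xs ↔
    ∀ y, LeBar (g .e) (ev g t xs) y → Sim (g .e) y (ev g t xs) := by
  simp [leafBar]

theorem holds_nodeBar : Holds g (nodeBar t) xs ↔
    ∃ y z, ¬ Sim (g .e) y z ∧ Sim (g .e) (ev g t xs) (y ⊓ z) := by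
  simp [nodeBar]

theorem holds_covBar : Holds g (covBar s t) xs ↔
    (LeBar (g .e) (ev g s xs) (ev g t xs) ∧ ¬ Sim (g .e) (ev g s xs) (ev g t xs)) ∧
      ∀ y, LeBar (g .e) (ev g s xs) y → LeBar (g .e) y (ev g t xs) →
        Sim (g .e) y (ev g s xs) ∨ Sim (g .e) y (ev g t xs) := by
  simp [covBar]

theorem holds_domBar (i : AddE ι) : Holds g (domBar i t) xs ↔
    ∃ y, Sim (g .e) y (ev g t xs) ∧ (g i y).Dom := by
  simp [domBar]

theorem holds_imBar (i : AddE ι) : Holds g (imBar i t) xs ↔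
    ∃ y, Sim (g .e) y (ev g t xs) ∧ y ∈ (g i).ran := by
  simp [imBar]

theorem holds_appBar (i : AddE ι) : Holds g (appBar i s t) xs ↔
    ∃ y, (Sim (g .e) y (ev g s xs) ∧ (g i y).Dom) ∧ Sim (g .e) (total (g i) y) (ev g t xs) := by
  simp [appBar]

theorem ev_inClass_tm (x : M) (c : Fin n → {y // Sim (g .e) y x})
    (t : Language.order.Term (Empty ⊕ Fin n)) :
    letI := orderStructure {y // Sim (g .e) y x}
    ev g (inClass.tm t) (Fin.cons x fun i => (c i).1 : Fin (n + 1) → M) =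
      (t.realize (Sum.elim (default : Empty → {y // Sim (g .e) y x}) c)).1 := by
  rcases t with (x | k) | ⟨f, -⟩
  · exact x.elim
  · exact Fin.cons_succ (α := fun _ => M) x (fun i => (c i).1) k
  · exact Empty.elim f

/-- Quantifiers are relativised to the class of `x`, which stays at the head of the assignment while
quantified elements are appended at its end. -/
theorem holds_inClass (x : M) (c : Fin n → {y // Sim (g .e) y x})
    (φ : Language.order.BoundedFormula Empty n) :
    Holds g (inClass φ) (Fin.cons x fun i => (c i).1 : Fin (n + 1) → M) ↔
      letI := orderStructure {y // Sim (g .e) y x}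
      φ.Realize (default : Empty → {y // Sim (g .e) y x}) c := by
  let _ := orderStructure {y // Sim (g .e) y x}
  induction φ with
  | falsum => exact Iff.rfl
  | equal s t =>
    refine (holds_eq g _ _ _).trans ?_
    rw [ev_inClass_tm, ev_inClass_tm]
    exact Subtype.ext_iff.symm
  | rel R ts =>
    cases R
    refine (holds_le g _ _ _).trans ?_
    rw [ev_inClass_tm, ev_inClass_tm]
    exact Iff.rfl
  | imp φ ψ ih₁ ih₂ => exact imp_congr (ih₁ c) (ih₂ c)
  | all φ ih =>
    have hcons : ∀ y : {y // Sim (g .e) y x}, (Fin.snoc (Fin.cons x fun i => (c i).1 : Fin _ → M) y.1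
        : Fin _ → M) = Fin.cons x fun i => ((Fin.snoc c y : Fin _ → {y // Sim (g .e) y x}) i).1 := by
      intro y
      rw [← Fin.cons_snoc_eq_snoc_cons]
      congr 1
      ext i
      refine Fin.lastCases ?_ (fun i => ?_) i <;> simp
    refine (holds_all g _ _).trans ?_
    constructor
    · intro h y
      refine (ih (Fin.snoc c y)).1 ?_
      rw [← hcons]
      refine h y.1 ((holds_sim ..).2 ?_)
      rw [ev_new]
      exact y.2
    · intro h y hy
      have hy' : Sim (g .e) y x := by
        have := (holds_sim ..).1 hy
        rw [ev_new] at this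
        exact this
      have := (ih (Fin.snoc c ⟨y, hy'⟩)).2 (h ⟨y, hy'⟩)
      rwa [← hcons] at this

end Sim

/-! ### Truth in the quotient modulo `∼`. -/

section Quotient

variable {M : Type u} [SemilatticeInf M] {ι : Type} {n : ℕ}

/-- `Q` is, via `π`, the quotient of `M` modulo `∼`. -/
structure IsQuotient (g : AddE ι → M →. M) {Q : Type v} [(treeLang ι).Structure Q] (π : M → Q) :
    Prop where
  surjective : Function.Surjective π
  sim : ∀ x y, Sim (g .e) x y ↔ π x = π y
  meet : ∀ x y, Structure.funMap (L := treeLang ι) TreeFunc.meet ![π x, π y] = π (x ⊓ y)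
  fn : ∀ i x, Structure.funMap (L := treeLang ι) (TreeFunc.fn i) ![π x] = π (total (g (.old i)) x)
  le : ∀ x y, Structure.RelMap (L := treeLang ι) TreeRel.le ![π x, π y] ↔ LeBar (g .e) x y
  leaf : ∀ x, Structure.RelMap (L := treeLang ι) TreeRel.leaf ![π x] ↔
    ∀ y, LeBar (g .e) x y → Sim (g .e) y x
  node : ∀ x, Structure.RelMap (L := treeLang ι) TreeRel.node ![π x] ↔
    ∃ y z, ¬ Sim (g .e) y z ∧ Sim (g .e) x (y ⊓ z)
  dom : ∀ i x, Structure.RelMap (L := treeLang ι) (TreeRel.dom i) ![π x] ↔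
    ∃ y, Sim (g .e) y x ∧ (g (.old i) y).Dom
  im : ∀ i x, Structure.RelMap (L := treeLang ι) (TreeRel.im i) ![π x] ↔
    ∃ y, Sim (g .e) y x ∧ y ∈ (g (.old i)).ran

variable {g : AddE ι → M →. M} {Q : Type v} [(treeLang ι).Structure Q] {π : M → Q}

theorem IsQuotient.ev_onTerm (hπ : IsQuotient g π) (xs : Fin n → M) (t : Tm ι n) :
    π (ev g ((treeMap AddE.old).onTerm t) xs) = t.realize (Sum.elim (default : Empty → Q) (π ∘ xs)) := by
  induction t with
  | var x =>
    rcases x with x | i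
    · exact x.elim
    · rfl
  | func F ts ih =>
    cases F with
    | meet =>
      refine ((hπ.meet _ _).symm.trans ?_ : π (ev g ((treeMap AddE.old).onTerm (ts 0)) xs ⊓
        ev g ((treeMap AddE.old).onTerm (ts 1)) xs) = _)
      rw [ih, ih]
      refine congrArg (Structure.funMap (L := treeLang ι) (n := 2) TreeFunc.meet) ?_
      ext i; fin_cases i <;> rfl
    | fn i =>
      refine ((hπ.fn _ _).symm.trans ?_ :
        π (total (g (.old i)) (ev g ((treeMap AddE.old).onTerm (ts 0)) xs)) = _)
      rw [ih]
      refine congrArg (Structure.funMap (L := treeLang ι) (n := 1) (TreeFunc.fn i)) ?_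
      ext i; fin_cases i; rfl

/-- Since `π` is surjective and commutes with the functions, quantifiers and terms of the quotient
can be evaluated on representatives. -/
theorem IsQuotient.holds_inQuotient (hπ : IsQuotient g π) (φ : Fm ι n) (xs : Fin n → M) :
    Holds g (inQuotient φ) xs ↔ φ.Realize (default : Empty → Q) (π ∘ xs) := by
  induction φ with
  | falsum => exact Iff.rfl
  | equal s t =>
    refine (holds_sim ..).trans ?_
    rw [hπ.sim, hπ.ev_onTerm, hπ.ev_onTerm]
    exact Iff.rfl
  | @rel n l R ts =>
    have h1 : ∀ (R : TreeRel ι 1) (ts : Fin 1 → Tm ι n), Structure.RelMap (L := treeLang ι) R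
        ![π (ev g ((treeMap AddE.old).onTerm (ts 0)) xs)] ↔
        BoundedFormula.Realize (BoundedFormula.rel (L := treeLang ι) R ts)
          (default : Empty → Q) (π ∘ xs) := by
      intro R ts
      rw [hπ.ev_onTerm]
      refine iff_of_eq (congrArg _ ?_)
      ext i; fin_cases i; rfl
    cases R with
    | le =>
      refine (holds_leBar ..).trans ((hπ.le _ _).symm.trans ?_)
      rw [hπ.ev_onTerm, hπ.ev_onTerm]
      refine iff_of_eq (congrArg _ ?_)
      ext i; fin_cases i <;> rfl
    | node => exact (holds_nodeBar ..).trans ((hπ.node _).symm.trans (h1 _ ts))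
    | leaf => exact (holds_leafBar ..).trans ((hπ.leaf _).symm.trans (h1 _ ts))
    | dom i => exact (holds_domBar ..).trans ((hπ.dom i _).symm.trans (h1 _ ts))
    | im i => exact (holds_imBar ..).trans ((hπ.im i _).symm.trans (h1 _ ts))
  | imp φ ψ ih₁ ih₂ => exact imp_congr (ih₁ xs) (ih₂ xs)
  | all φ ih =>
    refine (holds_all ..).trans ((forall_congr' fun a => ih _).trans ?_)
    have : ∀ a, π ∘ (Fin.snoc xs a : Fin _ → M) = Fin.snoc (π ∘ xs) (π a) := fun a =>
      Fin.comp_snoc π xs a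
    simp only [this]
    exact ⟨fun h y => by obtain ⟨a, rfl⟩ := hπ.surjective y; exact h a, fun h a => h (π a)⟩

/-- A formula of the quotient, pulled back. -/
def pullback {n : ℕ} (φ : (treeLang ι).Formula (Fin n)) : (treeLang (AddE ι)).Formula (Fin n) :=
  (inQuotient (BoundedFormula.relabel (Sum.inr : Fin n → Empty ⊕ Fin n) φ)).toFormula.relabel
    (Sum.elim Empty.elim id)

theorem IsQuotient.realize_pullback (hπ : IsQuotient g π) (φ : (treeLang ι).Formula (Fin n))
    (xs : Fin n → M) :
    @Formula.Realize _ M (treeStructure g) _ (pullback φ) xs ↔ φ.Realize (π ∘ xs) := by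
  let _ := treeStructure g
  rw [pullback, Formula.realize_relabel, BoundedFormula.realize_toFormula]
  have h := hπ.holds_inQuotient (BoundedFormula.relabel (Sum.inr : Fin n → Empty ⊕ Fin n) φ) xs
  have hx : ((xs ∘ Sum.elim Empty.elim id) ∘ Sum.inl : Empty → M) = default :=
    Subsingleton.elim _ _
  rw [hx]
  refine h.trans ?_
  rw [BoundedFormula.realize_relabel]
  refine iff_of_eq (congrArg₂ _ ?_ (Subsingleton.elim _ _))
  ext i
  rfl

/-- The quotient is interpretable in `M`: `pullback` turns a type over `Q` into a finitely
satisfiable type over representatives of its parameters. -/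
theorem IsQuotient.isSaturated (hπ : IsQuotient g π)
    (hM : @IsSaturated (treeLang (AddE ι)) M (treeStructure g)) : IsSaturated (treeLang ι) Q := by
  classical
  intro n x p hp
  obtain ⟨x', rfl⟩ : ∃ x' : Fin n → M, π ∘ x' = x :=
    ⟨fun i => (hπ.surjective (x i)).choose, funext fun i => (hπ.surjective (x i)).choose_spec⟩
  have hs : ∀ a, (Fin.snoc (π ∘ x') (π a) : Fin _ → Q) = π ∘ (Fin.snoc x' a : Fin _ → M) :=
    fun a => (Fin.comp_snoc π x' a).symm
  obtain ⟨y, hy⟩ := hM n x' (pullback '' p) (by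
    intro q hq
    obtain ⟨q', hq', rfl⟩ := Finset.subset_set_image_iff.1 hq
    obtain ⟨y, hy⟩ := hp q' hq'
    obtain ⟨a, rfl⟩ := hπ.surjective y
    refine ⟨a, fun ψ hψ => ?_⟩
    obtain ⟨χ, hχ, rfl⟩ := Finset.mem_image.1 hψ
    rw [hπ.realize_pullback, ← hs]
    exact hy χ hχ)
  refine ⟨π y, fun ψ hψ => ?_⟩
  rw [hs, ← hπ.realize_pullback]
  exact hy _ ⟨ψ, hψ, rfl⟩

end Quotient

/-! ### Meaning of the axioms of `Σ'`. -/

section Axioms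

variable {M : Type u} [SemilatticeInf M] {ι : Type} (g : AddE ι → M →. M)

/-- The properties of `e` expressed by `Σ''`. -/
structure IsESystem (e : M →. M) : Prop where
  convex : ∀ x y z, x ∈ e.ran → z ∈ e.ran → x < y → y < z → y ∈ e.ran
  dom_iff : ∀ x, (e x).Dom ↔ ∃ y ∈ e.ran, y ≤ x
  leaf_dom : ∀ x, IsMax x → (e x).Dom
  not_max : ∀ x ∈ e.ran, ¬ IsMax x
  mem : ∀ x, (e x).Dom → total e x ∈ e.ran
  le : ∀ x, (e x).Dom → total e x ≤ x
  greatest : ∀ x, (e x).Dom → ∀ y ∈ e.ran, y ≤ x → y ≤ total e x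

theorem model_sigma2_iff (hM : IsGoodTree M) :
    @Theory.Model _ M (treeStructure g) (sigma2 ι) ↔ IsESystem (g .e) := by
  have h1 := (model_iff_holds g _).1 (model_goodTreeAxioms g hM)
  have h2 := (model_iff_holds g _).1 (model_partialFunAxioms g .e)
  rw [model_iff_holds]
  simp only [sigma2, Set.mem_union, or_imp, forall_and, Set.mem_insert_iff,
    Set.mem_singleton_iff, forall_eq]
  rw [and_iff_right ⟨h1, h2⟩]
  simp only [holds_all, holds_imp, holds_inE, holds_lt, holds_inEge, holds_iff, holds_ex,
    holds_inf, holds_le, holds_leaf, holds_not, ev_eFn, snoc_default, snoc_one, snoc_two]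
  dsimp
  constructor
  · rintro ⟨h1, h2, h3, h4, h5, h6⟩
    exact ⟨h1, h2, h3, fun x hx hm => h4 x ⟨hx, hm⟩, fun x hx => (h6 x hx).1.1, h5,
      fun x hx => (h6 x hx).2⟩
  · rintro ⟨h1, h2, h3, h4, h5, h6, h7⟩
    exact ⟨h1, h2, h3, fun x hx => h4 x hx.1 hx.2, h6, fun x hx => ⟨⟨h5 x hx, h6 x hx⟩, h7 x hx⟩⟩

/-- The elements with a non trivial `∼`-class. -/
def IsLeafClass (e : M →. M) (x : M) : Prop := (e x).Dom ∧ (Rooted M ∨ x ∉ e.ran)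

/-- One inclusion suffices, both theories being complete. -/
theorem orderTheoryOf_eq_iff {X : Type v} {Y : Type w} [LE X] [LE Y] :
    orderTheoryOf X = orderTheoryOf Y ↔ ∀ φ ∈ orderTheoryOf Y,
      letI := orderStructure X
      X ⊨ φ := by
  let _ := orderStructure X
  let _ := orderStructure Y
  constructor
  · intro h φ hφ
    rw [← h] at hφ
    exact hφ
  · intro h
    ext φ
    refine ⟨fun hX => by_contra fun hY => ?_, fun hY => h φ hY⟩
    exact h (Formula.not φ) (fun hn : Y ⊨ φ => hY hn) hX

theorem model_classAxioms_iff {T₀ : Type v} [LE T₀] :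
    @Theory.Model _ M (treeStructure g) (classAxioms ι (orderTheoryOf T₀)) ↔
      ∀ x, IsLeafClass (g .e) x → orderTheoryOf {y // Sim (g .e) y x} = orderTheoryOf T₀ := by
  rw [model_iff_holds]
  simp only [classAxioms, Set.forall_mem_image, orderTheoryOf_eq_iff]
  have hlc : ∀ x, IsLeafClass (g .e) x ↔
      (Rooted M ∧ (g .e x).Dom) ∨ ¬ Rooted M ∧ (g .e x).Dom ∧ x ∉ (g .e).ran := by
    intro x
    unfold IsLeafClass
    tauto
  have key : ∀ (φ : Language.order.Sentence) x, Holds g (inClass φ) ![x] ↔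
      letI := orderStructure {y // Sim (g .e) y x}
      {y // Sim (g .e) y x} ⊨ φ := by
    intro φ x
    have := holds_inClass g x default φ
    rw [show (Fin.cons x fun i => ((default : Fin 0 → {y // Sim (g .e) y x}) i).1 : Fin 1 → M) =
      ![x] by ext i; fin_cases i; rfl] at this
    exact this
  simp only [holds_all, holds_imp, holds_sup, holds_inf, holds_rooted, holds_inEge, holds_not,
    holds_inEgt, snoc_default, key]
  constructor
  · intro h x hx φ hφ
    exact h hφ x ((hlc x).1 hx)
  · intro h φ hφ x hx
    exact h x ((hlc x).2 hx) φ hφ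

theorem model_quotientAxioms_iff {Q : Type v} [(treeLang ι).Structure Q] {π : M → Q}
    (hπ : IsQuotient g π) (S : (treeLang ι).Theory) :
    @Theory.Model _ M (treeStructure g) (quotientAxioms S) ↔ Q ⊨ S := by
  rw [model_iff_holds, Theory.model_iff]
  simp only [quotientAxioms, Set.forall_mem_image]
  refine forall₂_congr fun φ _ => ?_
  rw [hπ.holds_inQuotient]
  exact iff_of_eq (congrArg _ (Subsingleton.elim _ _))

theorem model_noRootAxioms_iff : @Theory.Model _ M (treeStructure g) (noRootAxioms ι) ↔
    (¬ Rooted M → (∀ x, (∀ y, LeBar (g .e) x y → Sim (g .e) y x) →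
      ∃ y, (LeBar (g .e) y x ∧ ¬ Sim (g .e) y x) ∧
        ∀ z, LeBar (g .e) y z → LeBar (g .e) z x → Sim (g .e) z y ∨ Sim (g .e) z x) ∧
      ∀ x, (∃ y, Sim (g .e) y x ∧ y ∈ (g .e).ran) ↔
        ∃ y, (∀ z, LeBar (g .e) y z → Sim (g .e) z y) ∧ (LeBar (g .e) x y ∧ ¬ Sim (g .e) x y) ∧
        ∀ z, LeBar (g .e) x z → LeBar (g .e) z y → Sim (g .e) z x ∨ Sim (g .e) z y) := by
  rw [model_iff_holds]
  simp only [noRootAxioms, Set.mem_insert_iff, Set.mem_singleton_iff, forall_eq_or_imp, forall_eq,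
    holds_imp, holds_not, holds_rooted, holds_all, holds_leafBar, holds_ex, holds_covBar,
    holds_iff, holds_imBar, holds_inf, snoc_default, snoc_one]
  dsimp
  exact imp_and.symm

/-- The properties of `f` expressed by `Σ'`. -/
structure IsFunSystem (e f : M →. M) : Prop where
  dom_iff : ∀ x, ¬ (e x).Dom ∨ x ∈ e.ran → ((f x).Dom ↔ ∃ y, Sim e y x ∧ (f y).Dom)
  eq_iff : ∀ x, ¬ (e x).Dom ∨ x ∈ e.ran → (f x).Dom → ∀ y,
    ((¬ (e y).Dom ∨ y ∈ e.ran) ∧ ∃ z, (Sim e z x ∧ (f z).Dom) ∧ Sim e (total f z) y) ↔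
      y = total f x
  dom_e : ∀ x, (e x).Dom → ((f x).Dom ↔ (f (total e x)).Dom)
  eq_e : ∀ x, (e x).Dom → (f x).Dom → total f x = total f (total e x)

theorem model_funAxioms_iff (i : ι) : @Theory.Model _ M (treeStructure g) (funAxioms i) ↔
    IsFunSystem (g .e) (g (.old i)) := by
  have h2 := (model_iff_holds g _).1 (model_partialFunAxioms g (.old i))
  rw [model_iff_holds]
  simp only [funAxioms, Set.mem_union, or_imp, forall_and, Set.mem_insert_iff,
    Set.mem_singleton_iff, forall_eq]
  rw [and_iff_right h2]
  simp only [holds_all, holds_imp, holds_inEle, holds_iff, holds_dom, holds_domBar, holds_inf,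
    holds_appBar, holds_eq, ev_app, holds_inEge, ev_eFn, snoc_default, snoc_one]
  dsimp
  constructor
  · rintro ⟨h1, h2, h3, h4⟩
    exact ⟨h1, h2, h3, h4⟩
  · rintro ⟨h1, h2, h3, h4⟩
    exact ⟨h1, h2, h3, h4⟩

theorem model_sigma'_iff {S : (treeLang ι).Theory} {S₀ : Language.order.Theory} :
    @Theory.Model _ M (treeStructure g) (sigma' S S₀) ↔
    (((@Theory.Model _ M (treeStructure g) (sigma2 ι) ∧
      @Theory.Model _ M (treeStructure g) (classAxioms ι S₀)) ∧
      @Theory.Model _ M (treeStructure g) (quotientAxioms S)) ∧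
      @Theory.Model _ M (treeStructure g) (noRootAxioms ι)) ∧
      ∀ i, @Theory.Model _ M (treeStructure g) (funAxioms i) := by
  simp only [model_iff_holds, sigma', Set.mem_union, Set.mem_iUnion, or_imp, forall_and,
    forall_exists_index]
  refine and_congr Iff.rfl ⟨fun h i φ hφ => h φ i hφ, fun h φ i hφ => h i φ hφ⟩

end Axioms

/-! ### Geometry of `E` and of the `∼`-classes. -/

section ESystem

variable {M : Type u} [SemilatticeInf M] {e : M →. M}

theorem covBy_unique (hM : IsGoodTree M) {x y z : M} (h : y ⋖ x) (h' : z ⋖ x) : y = z := by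
  rcases hM.chain_below x y z h.le h'.le with h1 | h1
  · exact (h1.eq_or_lt).resolve_right fun h2 => h.2 h2 h'.lt
  · exact ((h1.eq_or_lt).resolve_right fun h2 => h'.2 h2 h.lt).symm

theorem Sim.refl (x : M) : Sim e x x := Or.inl rfl

theorem Sim.symm {x y : M} (h : Sim e x y) : Sim e y x := by
  rcases h with rfl | ⟨h1, h2, h3, h4⟩
  · exact Sim.refl _
  · exact Or.inr ⟨h2, h1, h3.symm, by rwa [← h3, inf_comm]⟩

/-- When `Rooted` fails, the extra condition says that the elements lie in the same cone at their
common image under `e`; being in the same cone is transitive. -/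
theorem Sim.trans (hM : IsGoodTree M) {x y z : M} (h : Sim e x y) (h' : Sim e y z) :
    Sim e x z := by
  rcases h with rfl | ⟨h1, h2, h3, h4⟩
  · exact h'
  rcases h' with rfl | ⟨-, h5, h6, h7⟩
  · exact Or.inr ⟨h1, h2, h3, h4⟩
  refine Or.inr ⟨h1, h5, h3.trans h6, h4.elim Or.inl fun h4 => h7.imp id fun h7 => ?_⟩
  rw [← h3] at h7
  exact lt_inf_trans hM.chain_below h4 h7

theorem isLeafClass_iff_of_sim {x y : M} (he : IsESystem e) (h : Sim e x y) :
    IsLeafClass e x → IsLeafClass e y := by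
  rcases h with rfl | ⟨h1, h2, h3, h4⟩
  · exact id
  · refine fun _ => ⟨h2, h4.imp id fun h4 hy => ?_⟩
    have := he.greatest y h2 y hy le_rfl
    exact h4.not_ge (inf_le_right.trans (h3 ▸ this))

variable (he : IsESystem e)

include he

theorem IsESystem.total_of_mem {x : M} (hx : x ∈ e.ran) : (e x).Dom ∧ total e x = x := by
  have hd := (he.dom_iff x).2 ⟨x, hx, le_rfl⟩
  exact ⟨hd, (he.le x hd).antisymm (he.greatest x hd x hx le_rfl)⟩

theorem IsESystem.dom_of_le {x y : M} (hx : (e x).Dom) (h : x ≤ y) : (e y).Dom := by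
  obtain ⟨z, hz, hzx⟩ := (he.dom_iff x).1 hx
  exact (he.dom_iff y).2 ⟨z, hz, hzx.trans h⟩

theorem IsESystem.total_mono {x y : M} (hx : (e x).Dom) (h : x ≤ y) : total e x ≤ total e y :=
  he.greatest y (he.dom_of_le hx h) _ (he.mem x hx) ((he.le x hx).trans h)

theorem IsESystem.total_eq_of_le_of_le {x y : M} (hx : (e x).Dom) (h : total e x ≤ y) (h' : y ≤ x) :
    (e y).Dom ∧ total e y = total e x := by
  have hy : (e y).Dom := (he.dom_iff y).2 ⟨_, he.mem x hx, h⟩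
  exact ⟨hy, (he.total_mono hy h').antisymm (he.greatest y hy _ (he.mem x hx) h)⟩

theorem IsESystem.isLeafClass_of_isMax {x : M} (hx : IsMax x) : IsLeafClass e x :=
  ⟨he.leaf_dom x hx, Or.inr fun h => he.not_max x h hx⟩

/-- Off the domain of `e` the relation is equality. In the remaining case `Rooted` fails and `x ∈
E`, so `e(x) = x` cannot lie strictly below `x ⊓ y`. -/
theorem IsESystem.eq_of_sim {x y : M} (hx : ¬ IsLeafClass e x) (h : Sim e x y) : x = y := by
  rcases h with h | ⟨h1, h2, h3, h4⟩
  · exact h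
  · simp only [IsLeafClass, not_and_or, not_or, not_not] at hx
    obtain ⟨hr, hE⟩ := hx.resolve_left fun h => h h1
    have := h4.resolve_left hr
    rw [(he.total_of_mem hE).2] at this
    exact absurd this inf_le_left.not_gt

variable (hM : IsGoodTree M)

include hM

/-- This is convexity: were `e(y)` strictly above `x`, then `x` would lie strictly between the
elements `e(x)` and `e(y)` of `E`. -/
theorem IsESystem.total_eq_of_notMem {x y : M} (hx : (e x).Dom) (hE : x ∉ e.ran) (h : x ≤ y) :
    total e y = total e x := by
  have hy := he.dom_of_le hx h
  refine le_antisymm ?_ (he.total_mono hx h)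
  rcases hM.chain_below y _ _ (he.le y hy) h with h' | h'
  · exact he.greatest x hx _ (he.mem y hy) h'
  · rcases h'.eq_or_lt with h' | h'
    · exact absurd (h' ▸ he.mem y hy) hE
    · have h1 : total e x < x := (he.le x hx).lt_of_ne fun h => hE (h ▸ he.mem x hx)
      exact absurd (he.convex _ _ _ (he.mem x hx) (he.mem y hy) h1 h') hE

variable {T₀ : Type v} [SemilatticeInf T₀] (hT₀ : IsOneColored T₀)
  (hcl : ∀ x, IsLeafClass e x → orderTheoryOf {y // Sim e y x} = orderTheoryOf T₀)

include hT₀ hcl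

-- Under `Rooted M` a class in `E_≥` is a fibre of `e`, so the class of a leaf `α` has least element
-- `e(α)`; having a root passes to `T₀`.
omit hT₀ in
theorem IsESystem.hasRoot_of_rooted [Nonempty M] (hr : Rooted M) : HasRoot T₀ := by
  obtain ⟨α, -, hα⟩ := hM.leaf_above (Classical.arbitrary M)
  have hlc := he.isLeafClass_of_isMax hα
  have hb := he.total_of_mem (he.mem α hlc.1)
  refine hasRoot_transfer (hcl α hlc) ⟨⟨total e α, Or.inr ⟨hb.1, hlc.1, hb.2, Or.inl hr⟩⟩, ?_⟩
  rintro ⟨y, rfl | ⟨h1, -, h2, -⟩⟩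
  · exact he.le _ hlc.1
  · exact (h2 ▸ he.le y h1 : total e α ≤ y)

/-- The class of `α` has a root `b` and height one. Whatever lies between `b` and `α` is in the
class, so there is nothing. -/
theorem IsESystem.exists_covBy_of_not_rooted (h₀ : HasRoot T₀) (hr : ¬ Rooted M) {α : M}
    (hα : IsMax α) : ∃ b, b ⋖ α ∧ (e b).Dom ∧ b ∉ e.ran ∧ total e b = total e α := by
  have hlc := he.isLeafClass_of_isMax hα
  obtain ⟨⟨b, hb⟩, hbot⟩ := hasRoot_transfer (hcl α hlc).symm h₀
  have hnt := natCast_le_card_transfer (hcl α hlc).symm 2 (by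
    have := hT₀.nontrivial
    exact_mod_cast Cardinal.two_le_iff.2 (exists_pair_ne T₀))
  have hne : b ≠ α := by
    -- A root that is also maximal would be the only element of the class, whereas `T₀` has at least
    -- two.
    rintro rfl
    obtain ⟨⟨x, hx⟩, ⟨y, hy⟩, hxy⟩ := Cardinal.two_le_iff.1 (by exact_mod_cast hnt)
    refine hxy (Subtype.ext ?_)
    exact (hα.eq_of_le (hbot ⟨x, hx⟩)).symm.trans (hα.eq_of_le (hbot ⟨y, hy⟩))
  have hbα : b < α := lt_of_le_of_ne (show b ≤ α from hbot ⟨α, Sim.refl α⟩) hne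
  obtain ⟨h1, h2, h3, h4⟩ := hb.resolve_left hne
  have h5 : total e b < b := by
    have := h4.resolve_left hr
    rwa [inf_eq_left.2 hbα.le] at this
  refine ⟨b, ⟨hbα, fun c hbc hcα => ?_⟩, h1, fun hE => h5.ne (he.total_of_mem hE).2, h3⟩
  have hc := he.total_eq_of_le_of_le hlc.1 (y := c) (h3 ▸ (h5.trans hbc).le) hcα.le
  have hcs : Sim e c α := Or.inr ⟨hc.1, hlc.1, hc.2, Or.inr (by
    rw [inf_eq_left.2 hcα.le, hc.2, ← h3]
    exact h5.trans hbc)⟩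
  exact height_transfer (hcl α hlc).symm (hT₀.height h₀) ⟨b, hb⟩ ⟨c, hcs⟩ ⟨α, Sim.refl α⟩ hbc hcα

/-- Suppose `Rooted M` fails. Each leaf still has the root of its class as predecessor, and `p(α) <
p(β)` would put a chain of three elements into the class of `β`, which has height one. So `Rooted M`
holds after all. -/
theorem IsESystem.rooted_of_hasRoot (h₀ : HasRoot T₀) : Rooted M := by
  by_contra hr
  refine hr ⟨fun α hα => ?_, fun α β q q' hα hβ hq hq' hlt => ?_⟩
  · obtain ⟨b, hb, -⟩ := he.exists_covBy_of_not_rooted hM hT₀ hcl h₀ hr hα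
    exact ⟨b, hb⟩
  · obtain ⟨b, hb, hbd, hbE, hbe⟩ := he.exists_covBy_of_not_rooted hM hT₀ hcl h₀ hr hα
    obtain ⟨c, hc, hcd, hcE, hce⟩ := he.exists_covBy_of_not_rooted hM hT₀ hcl h₀ hr hβ
    obtain rfl := covBy_unique hM hb hq
    obtain rfl := covBy_unique hM hc hq'
    have hβd := he.leaf_dom β hβ
    have hlc := he.isLeafClass_of_isMax hβ
    have hbc : total e c = total e b := he.total_eq_of_notMem hM hbd hbE hlt.le
    have hbb : total e b < b := (he.le b hbd).lt_of_ne fun h => hbE (h ▸ he.mem b hbd)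
    have hbs : Sim e b β := Or.inr ⟨hbd, hβd, hbc.symm.trans hce, Or.inr (by
      rwa [inf_eq_left.2 (hlt.trans hc.lt).le])⟩
    have hcs : Sim e c β := Or.inr ⟨hcd, hβd, hce, Or.inr (by
      rw [inf_eq_left.2 hc.le, hbc]
      exact hbb.trans hlt)⟩
    exact height_transfer (hcl β hlc).symm (hT₀.height h₀) ⟨b, hbs⟩ ⟨c, hcs⟩ ⟨β, Sim.refl β⟩ hlt hc.lt

/-- The class of `x` has a second element, necessarily above `x`. A leaf over it is again in the
class, and height one leaves nothing in between. -/
theorem IsESystem.exists_isMax_covBy (hr : Rooted M) {x : M} (hx : x ∈ e.ran) :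
    ∃ α, IsMax α ∧ x ⋖ α := by
  obtain ⟨hd, hex⟩ := he.total_of_mem hx
  have hlc : IsLeafClass e x := ⟨hd, Or.inl hr⟩
  have : Nonempty M := ⟨x⟩
  have h₀ := he.hasRoot_of_rooted hM hcl hr
  have hnt := natCast_le_card_transfer (hcl x hlc).symm 2 (by
    have := hT₀.nontrivial
    exact_mod_cast Cardinal.two_le_iff.2 (exists_pair_ne T₀))
  obtain ⟨y, hy, hyx⟩ : ∃ y, Sim e y x ∧ y ≠ x := by
    by_contra! hcon
    obtain ⟨⟨a, ha⟩, ⟨b, hb⟩, hab⟩ := Cardinal.two_le_iff.1 (by exact_mod_cast hnt)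
    exact hab (Subtype.ext ((hcon a ha).trans (hcon b hb).symm))
  obtain ⟨h1, -, h3, -⟩ := hy.resolve_left hyx
  rw [hex] at h3
  have hyE : y ∉ e.ran := fun h => hyx ((he.total_of_mem h).2.symm.trans h3)
  have hxy : x < y := (h3 ▸ he.le y h1).lt_of_ne hyx.symm
  obtain ⟨α, hyα, hα⟩ := hM.leaf_above y
  have hαd := he.leaf_dom α hα
  have hαe : total e α = x := (he.total_eq_of_notMem hM h1 hyE hyα).trans h3
  refine ⟨α, hα, hxy.trans_le hyα, fun c hxc hcα => ?_⟩
  have hc := he.total_eq_of_le_of_le hαd (y := c) (hαe ▸ hxc.le) hcα.le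
  have hs : ∀ c, (e c).Dom → total e c = x → Sim e c x := fun c h h' =>
    Or.inr ⟨h, hd, h'.trans hex.symm, Or.inl hr⟩
  exact height_transfer (hcl x hlc).symm (hT₀.height h₀) ⟨x, Sim.refl x⟩ ⟨c, hs c hc.1 (hc.2.trans hαe)⟩
    ⟨α, hs α hαd hαe⟩ hxc hcα

/-- Elements of `E` are predecessors of leaves, and the second half of `Rooted` forbids strict
inequalities between these: `E` is an antichain. -/
theorem IsESystem.eq_of_le_of_rooted (hr : Rooted M) {x y : M} (hx : x ∈ e.ran) (hy : y ∈ e.ran)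
    (h : x ≤ y) : x = y := by
  obtain ⟨α, hα, hxα⟩ := he.exists_isMax_covBy hM hT₀ hcl hr hx
  obtain ⟨β, hβ, hyβ⟩ := he.exists_isMax_covBy hM hT₀ hcl hr hy
  exact h.eq_or_lt.resolve_right (hr.2 α β x y hα hβ hxα hyβ)

/-- Going up from a leaf class does not change `e`: with `Rooted M` because `E` is an antichain,
otherwise by convexity. -/
theorem IsESystem.sim_of_le {x y : M} (hx : IsLeafClass e x) (h : x ≤ y) : Sim e y x := by
  have hy := he.dom_of_le hx.1 h
  rcases hx.2 with hr | hE
  · exact Or.inr ⟨hy, hx.1, (he.eq_of_le_of_rooted hM hT₀ hcl hr (he.mem x hx.1) (he.mem y hy)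
      (he.total_mono hx.1 h)).symm, Or.inl hr⟩
  · have := he.total_eq_of_notMem hM hx.1 hE h
    refine Or.inr ⟨hy, hx.1, this, Or.inr ?_⟩
    rw [this, inf_eq_right.2 h]
    exact (he.le x hx.1).lt_of_ne fun h => hE (h ▸ he.mem x hx.1)

/-- A meet not below `e(x)` would lie in the class of `x`, and `y`, being above it, would too. Hence
meets with elements outside a class do not depend on the representative. -/
theorem IsESystem.inf_eq {x y : M} (hx : IsLeafClass e x) (h : ¬ Sim e x y) :
    x ⊓ y = total e x ⊓ y := by
  refine le_antisymm (le_inf ?_ inf_le_right) (inf_le_inf_right _ (he.le x hx.1))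
  by_contra hcon
  have hlt := lt_of_chain hM.chain_below inf_le_left (he.le x hx.1) hcon
  have ht := he.total_eq_of_le_of_le hx.1 hlt.le inf_le_left
  have hs : Sim e (x ⊓ y) x := Or.inr ⟨ht.1, hx.1, ht.2, Or.inr (by
    rwa [ht.2, inf_eq_left.2 inf_le_left])⟩
  exact h ((he.sim_of_le hM hT₀ hcl (isLeafClass_iff_of_sim he hs.symm hx) inf_le_right).trans hM hs).symm

omit hM hT₀ hcl in
theorem IsESystem.sim_inf {x y : M} (h : Sim e x y) :
    Sim e (x ⊓ y) x := by
  rcases h with rfl | ⟨h1, h2, h3, h4⟩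
  · rw [inf_idem]; exact Sim.refl x
  · have ht := he.total_eq_of_le_of_le h1 (le_inf (he.le x h1) (h3 ▸ he.le y h2)) inf_le_left
    refine Or.inr ⟨ht.1, h1, ht.2, h4.imp id fun h4 => ?_⟩
    rwa [ht.2, inf_eq_left.2 inf_le_left]

/-- If `y` is in the class, both meets stay in it; if not, both are equal to the meet of `y` with
the common value of `e`. -/
theorem IsESystem.sim_inf_right {x x' : M} (y : M) (h : Sim e x x') : Sim e (x ⊓ y) (x' ⊓ y) := by
  by_cases hxx' : x = x'
  · rw [hxx']; exact Sim.refl _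
  have hx : IsLeafClass e x := by_contra fun hx => hxx' (he.eq_of_sim hx h)
  have hx' := isLeafClass_iff_of_sim he h hx
  have hd := h.resolve_left hxx'
  by_cases hxy : Sim e x y
  · exact ((he.sim_inf hxy).trans hM h).trans hM
      (he.sim_inf (h.symm.trans hM hxy)).symm
  · rw [he.inf_eq hM hT₀ hcl hx hxy, he.inf_eq hM hT₀ hcl hx' fun h' => hxy (h.trans hM h'),
      hd.2.2.1]
    exact Sim.refl _

/-- Nothing above a leaf class leaves it, and an `x` outside all leaf classes that lies below an
element `b` of one lies below `e(b)`, hence below the whole class. -/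
theorem IsESystem.leBar_iff {x y : M} : LeBar e x y ↔ x ≤ y ∨ Sim e x y := by
  constructor
  · rintro ⟨a, b, ha, hb, hab⟩
    by_cases hx : IsLeafClass e x
    · right
      have h := he.sim_of_le hM hT₀ hcl (isLeafClass_iff_of_sim he ha.symm hx) hab
      exact ((hb.symm.trans hM h).trans hM ha).symm
    · obtain rfl := he.eq_of_sim hx ha.symm
      left
      rcases hb with rfl | ⟨h1, h2, h3, -⟩
      · exact hab
      · rcases hM.chain_below b x (total e b) hab (he.le b h1) with h | h
        · exact h.trans (h3 ▸ he.le y h2)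
        · have hxd : (e x).Dom := (he.dom_iff x).2 ⟨_, he.mem b h1, h⟩
          simp only [IsLeafClass, not_and_or, not_or, not_not] at hx
          have hE := (hx.resolve_left fun h => h hxd).2
          exact (he.greatest b h1 x hE hab).trans (h3 ▸ he.le y h2)
  · rintro (h | h)
    · exact ⟨x, y, Sim.refl x, Sim.refl y, h⟩
    · exact ⟨x, x, Sim.refl x, h, le_rfl⟩

/-- There is a leaf of `M` above `x`, and leaves lie in leaf classes; conversely no element above a
leaf class is outside it. -/
theorem IsESystem.leafBar_iff {x : M} : (∀ y, LeBar e x y → Sim e y x) ↔ IsLeafClass e x := by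
  constructor
  · intro h
    obtain ⟨α, hxα, hα⟩ := hM.leaf_above x
    exact isLeafClass_iff_of_sim he (h α ((he.leBar_iff hM hT₀ hcl).2 (Or.inl hxα)))
      (he.isLeafClass_of_isMax hα)
  · intro hx y hxy
    rcases (he.leBar_iff hM hT₀ hcl).1 hxy with h | h
    exacts [he.sim_of_le hM hT₀ hcl hx h, h.symm]

end ESystem

/-! ## Decomposition of the models -/

section Decomposition

variable {M : Type u} [SemilatticeInf M] {ι : Type}

theorem elementarilyEquivalent_of_model_completeTheory {L : FirstOrder.Language.{0, 0}} {N : Type v}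
    {Q : Type w} [L.Structure N] [L.Structure Q] (h : Q ⊨ L.completeTheory N) : Q ≅[L] N := by
  have h' := (Theory.model_iff _).1 h
  refine Set.ext fun φ => ⟨fun hX : Q ⊨ φ => by_contra fun hY : ¬ N ⊨ φ => ?_, fun hY => h' φ hY⟩
  exact h' (Formula.not φ) (fun hn : N ⊨ φ => hY hn) hX

/-- The tree `M` is obtained from the tree `Q` by replacing the leaves by trees of theory `S₀`;
here `rt` means that the latter have a root. -/
structure Decomp {Q : Type v} [SemilatticeInf Q] (g : AddE ι → M →. M) (h : ι → Q →. Q)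
    (π : M → Q) (S₀ : Language.order.Theory) (rt : Prop) : Prop where
  surjective : Function.Surjective π
  le_iff : ∀ a b, π a ≤ π b ↔ a ≤ b ∨ π a = π b
  inf : ∀ a b, π (a ⊓ b) = π a ⊓ π b
  inj : ∀ a b, ¬ IsMax (π a) → π a = π b → a = b
  ran_of_root : rt → ∀ a, a ∈ (g .e).ran ↔ IsMax (π a) ∧ ∀ b, π b = π a → a ≤ b
  ran_of_not_root : ¬ rt → ∀ a, a ∈ (g .e).ran ↔ π a ∈ predLeaves Q
  isMax_iff : ∀ a, IsMax (π a) ↔ (g .e a).Dom ∧ (rt ∨ a ∉ (g .e).ran)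
  eq_iff : ∀ a b, π a = π b ↔ a = b ∨ (g .e a).Dom ∧ (g .e b).Dom ∧
    total (g .e) a = total (g .e) b ∧ (rt ∨ total (g .e) a < a ⊓ b)
  exists_pred : ¬ rt → ∀ c : Q, IsMax c → ∃ q, q ⋖ c
  dom_iff : ∀ i x, (h i (π x)).Dom ↔ (g (.old i) x).Dom
  total_map : ∀ i x, total (h i) (π x) = π (total (g (.old i)) x)
  ran_iff : ∀ i x, π x ∈ (h i).ran ↔ ∃ y, π y = π x ∧ y ∈ (g (.old i)).ran
  dom_e_iff : ∀ x, (g .e x).Dom ↔ ∃ y ∈ (g .e).ran, y ≤ x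
  e_iff : ∀ x y, y ∈ g .e x ↔ y ∈ (g .e).ran ∧ y ≤ x ∧ ∀ z ∈ (g .e).ran, z ≤ x → z ≤ y
  fn_iff : ∀ i x y, y ∈ g (.old i) x ↔ π y ∈ h i (π x) ∧ (¬ IsMax (π y) ∨ y ∈ (g .e).ran)
  cls : ∀ a, IsMax (π a) → orderTheoryOf {y // π y = π a} = S₀

theorem IsFunSystem.dom_iff_of_sim {e f : M →. M} (hf : IsFunSystem e f) {x y : M}
    (h : Sim e x y) : (f x).Dom ↔ (f y).Dom := by
  rcases h with rfl | ⟨h1, h2, h3, -⟩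
  · exact Iff.rfl
  · rw [hf.dom_e x h1, hf.dom_e y h2, h3]

/-- On `E_≥` the function factors through `e`, which is constant on a class; off its domain `total`
is the identity. -/
theorem IsFunSystem.sim_total {e f : M →. M} (hf : IsFunSystem e f) {x y : M}
    (h : Sim e x y) : Sim e (total f x) (total f y) := by
  by_cases hx : (f x).Dom
  · have hy := (hf.dom_iff_of_sim h).1 hx
    rcases h with rfl | ⟨h1, h2, h3, -⟩
    · exact Sim.refl _
    · rw [hf.eq_e x h1 hx, hf.eq_e y h2 hy, h3]
      exact Sim.refl _
  · rw [total_of_not_dom hx, total_of_not_dom fun hy => hx ((hf.dom_iff_of_sim h).2 hy)]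
    exact h

theorem LeBar.congr {e : M →. M} (hM : IsGoodTree M) {x x' y y' : M} (hx : Sim e x x')
    (hy : Sim e y y') : LeBar e x y ↔ LeBar e x' y' :=
  ⟨fun ⟨a, b, ha, hb, hab⟩ => ⟨a, b, ha.trans hM hx, hb.trans hM hy, hab⟩,
    fun ⟨a, b, ha, hb, hab⟩ => ⟨a, b, ha.trans hM hx.symm, hb.trans hM hy.symm, hab⟩⟩

/-- The structure of the quotient modulo `∼`. -/
@[reducible]
noncomputable def quotientStructure (g : AddE ι → M →. M) (s : Setoid M) :
    (treeLang ι).Structure (Quotient s) where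
  funMap := fun {_} F => match F with
    | .meet => fun v => ⟦(v 0).out ⊓ (v 1).out⟧
    | .fn i => fun v => ⟦total (g (.old i)) (v 0).out⟧
  RelMap := fun {_} R => match R with
    | .le => fun v => LeBar (g .e) (v 0).out (v 1).out
    | .node => fun v => ∃ y z, ¬ Sim (g .e) y z ∧ Sim (g .e) (v 0).out (y ⊓ z)
    | .leaf => fun v => ∀ y, LeBar (g .e) (v 0).out y → Sim (g .e) y (v 0).out
    | .dom i => fun v => ∃ y, Sim (g .e) y (v 0).out ∧ (g (.old i) y).Dom
    | .im i => fun v => ∃ y, Sim (g .e) y (v 0).out ∧ y ∈ (g (.old i)).ran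

theorem exists_isQuotient {g : AddE ι → M →. M} (hM : IsGoodTree M)
    (hinf : ∀ x x' y : M, Sim (g .e) x x' → Sim (g .e) (x ⊓ y) (x' ⊓ y))
    (hf : ∀ i, IsFunSystem (g .e) (g (.old i))) :
    ∃ (Q : Type u) (_ : (treeLang ι).Structure Q) (π : M → Q), IsQuotient g π := by
  let s : Setoid M := ⟨Sim (g .e), Sim.refl, Sim.symm, fun h h' => h.trans hM h'⟩
  have hout : ∀ x : M, Sim (g .e) (Quotient.mk s x).out x := fun x => Quotient.mk_out (s := s) x
  refine ⟨Quotient s, quotientStructure g s, Quotient.mk s,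
    @IsQuotient.mk _ _ _ _ _ (quotientStructure g s) _ Quotient.mk_surjective ?_ ?_ ?_ ?_ ?_ ?_ ?_ ?_⟩
  · exact fun x y => (Quotient.eq (r := s)).symm
  · intro x y
    refine Quotient.sound (s := s) ?_
    change Sim (g .e) ((Quotient.mk s x).out ⊓ (Quotient.mk s y).out) (x ⊓ y)
    refine (hinf _ _ _ (hout x)).trans hM ?_
    rw [inf_comm x, inf_comm x]
    exact hinf _ _ _ (hout y)
  · exact fun i x => Quotient.sound (s := s) ((hf i).sim_total (hout x))
  · exact fun x y => LeBar.congr hM (hout x) (hout y)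
  · refine fun x => forall_congr' fun y => imp_congr (LeBar.congr hM (hout x) (Sim.refl y)) ?_
    exact ⟨fun h => h.trans hM (hout x), fun h => h.trans hM (hout x).symm⟩
  · refine fun x => exists₂_congr fun y z => and_congr_right fun _ => ?_
    exact ⟨fun h => (hout x).symm.trans hM h, fun h => (hout x).trans hM h⟩
  · refine fun i x => exists_congr fun y => and_congr_left fun _ => ?_
    exact ⟨fun h => h.trans hM (hout x), fun h => h.trans hM (hout x).symm⟩
  · refine fun i x => exists_congr fun y => and_congr_left fun _ => ?_
    exact ⟨fun h => h.trans hM (hout x), fun h => h.trans hM (hout x).symm⟩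

section TreeQuotient

variable {Q : Type v} [SemilatticeInf Q] {g : AddE ι → M →. M} {h : ι → Q →. Q} {π : M → Q}
  (hπ : @IsQuotient _ _ _ g _ (treeStructure h) π)

include hπ

theorem IsQuotient.le_iff_leBar (x y : M) : π x ≤ π y ↔ LeBar (g .e) x y :=
  (relMap_le h _ _).symm.trans (@IsQuotient.le _ _ _ _ _ (treeStructure h) _ hπ x y)

theorem IsQuotient.sim_iff (x y : M) : Sim (g .e) x y ↔ π x = π y :=
  @IsQuotient.sim _ _ _ _ _ (treeStructure h) _ hπ x y

theorem IsQuotient.map_inf (x y : M) : π (x ⊓ y) = π x ⊓ π y :=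
  (@IsQuotient.meet _ _ _ _ _ (treeStructure h) _ hπ x y).symm.trans (funMap_meet h _ _)

theorem IsQuotient.total_map (i : ι) (x : M) : total (h i) (π x) = π (total (g (.old i)) x) :=
  (funMap_fn h i _).symm.trans (@IsQuotient.fn _ _ _ _ _ (treeStructure h) _ hπ i x)

theorem IsQuotient.isMax_iff (x : M) :
    IsMax (π x) ↔ ∀ y, LeBar (g .e) x y → Sim (g .e) y x :=
  (relMap_leaf h _).symm.trans (@IsQuotient.leaf _ _ _ _ _ (treeStructure h) _ hπ x)

theorem IsQuotient.dom_iff (i : ι) (x : M) :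
    (h i (π x)).Dom ↔ ∃ y, Sim (g .e) y x ∧ (g (.old i) y).Dom :=
  (relMap_dom h i _).symm.trans (@IsQuotient.dom _ _ _ _ _ (treeStructure h) _ hπ i x)

theorem IsQuotient.ran_iff (i : ι) (x : M) :
    π x ∈ (h i).ran ↔ ∃ y, Sim (g .e) y x ∧ y ∈ (g (.old i)).ran :=
  (relMap_im h i _).symm.trans (@IsQuotient.im _ _ _ _ _ (treeStructure h) _ hπ i x)

theorem IsQuotient.covBy_iff (x y : M) : ((LeBar (g .e) x y ∧ ¬ Sim (g .e) x y) ∧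
    ∀ z, LeBar (g .e) x z → LeBar (g .e) z y → Sim (g .e) z x ∨ Sim (g .e) z y) ↔ π x ⋖ π y := by
  simp only [← hπ.le_iff_leBar, hπ.sim_iff]
  rw [covBy_iff_lt_and_eq_or_eq, lt_iff_le_and_ne,
    (@IsQuotient.surjective _ _ _ _ _ (treeStructure h) _ hπ).forall]

theorem IsQuotient.mem_predLeaves_iff (x : M) :
    (∃ y, (∀ z, LeBar (g .e) y z → Sim (g .e) z y) ∧ (LeBar (g .e) x y ∧ ¬ Sim (g .e) x y) ∧
    ∀ z, LeBar (g .e) x z → LeBar (g .e) z y → Sim (g .e) z x ∨ Sim (g .e) z y) ↔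
    π x ∈ predLeaves Q := by
  simp only [hπ.covBy_iff, ← hπ.isMax_iff]
  exact ((@IsQuotient.surjective _ _ _ _ _ (treeStructure h) _ hπ).exists
    (p := fun β => IsMax β ∧ π x ⋖ β)).symm

end TreeQuotient

/-- The quotient has the theory of `T`, so it is a good tree with partial functions. Its leaves are
the leaf classes, and `Rooted M` means that `T₀` has a root; with this each axiom becomes a clause
of `Decomp`. -/
theorem exists_decomp {T : Type v} [SemilatticeInf T] (hT : IsGoodTree T) {f : ι → T →. T}
    {T₀ : Type w} [SemilatticeInf T₀] (hT₀ : IsOneColored T₀) [Nonempty M] (hM : IsGoodTree M)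
    {g : AddE ι → M →. M}
    (hmod : @Theory.Model _ M (treeStructure g) (sigma' (theoryOf f) (orderTheoryOf T₀))) :
    ∃ (Q : Type u) (_ : SemilatticeInf Q) (h : ι → Q →. Q) (π : M → Q), IsGoodTree Q ∧
      @ElementarilyEquivalent (treeLang ι) Q T (treeStructure h) (treeStructure f) ∧
      @IsQuotient _ _ _ g _ (treeStructure h) π ∧
      Decomp g h π (orderTheoryOf T₀) (HasRoot T₀) := by
  obtain ⟨⟨⟨⟨he, hcl⟩, hq⟩, hnr⟩, hf⟩ := (model_sigma'_iff g).1 hmod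
  replace he := (model_sigma2_iff g hM).1 he
  replace hcl := (model_classAxioms_iff g).1 hcl
  replace hnr := (model_noRootAxioms_iff g).1 hnr
  replace hf := fun i => (model_funAxioms_iff g i).1 (hf i)
  obtain ⟨Q, str, π, hπ⟩ := exists_isQuotient hM
    (fun x x' y h => he.sim_inf_right hM hT₀ hcl y h) hf
  have hQ := (model_quotientAxioms_iff g hπ _).1 hq
  have hQT := @elementarilyEquivalent_of_model_completeTheory _ _ _ (treeStructure f) str hQ
  have hax : ∀ S : (treeLang ι).Theory, @Theory.Model _ T (treeStructure f) S → Q ⊨ S := by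
    intro S hS
    exact (@ElementarilyEquivalent.theory_model_iff _ Q T str (treeStructure f) S hQT).2 hS
  obtain ⟨sl, h, hgood, rfl⟩ := exists_eq_treeStructure (hax _ (model_goodTreeAxioms f hT))
    fun i => hax _ (model_partialFunAxioms f i)
  have hrt : Rooted M ↔ HasRoot T₀ := ⟨he.hasRoot_of_rooted hM hcl, he.rooted_of_hasRoot hM hT₀ hcl⟩
  have hmax : ∀ x, IsMax (π x) ↔ IsLeafClass (g .e) x := fun x =>
    (hπ.isMax_iff x).trans (he.leafBar_iff hM hT₀ hcl)
  have hsurj := @IsQuotient.surjective _ _ _ _ _ (treeStructure h) _ hπ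
  have hfd : ∀ i x, (h i (π x)).Dom ↔ (g (.old i) x).Dom := fun i x =>
    (hπ.dom_iff i x).trans ⟨fun ⟨z, hz, hz'⟩ => ((hf i).dom_iff_of_sim hz).1 hz',
      fun hx => ⟨x, Sim.refl x, hx⟩⟩
  refine ⟨Q, sl, h, π, hgood, hQT, hπ, ⟨hsurj, ?_, hπ.map_inf, ?_, ?_, ?_, ?_, ?_, ?_, hfd, hπ.total_map, ?_, he.dom_iff, ?_, ?_, ?_⟩⟩
  · intro a b
    rw [hπ.le_iff_leBar, he.leBar_iff hM hT₀ hcl, hπ.sim_iff]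
  · intro a b ha hab
    exact he.eq_of_sim (fun h => ha ((hmax a).2 h)) ((hπ.sim_iff a b).2 hab)
  · intro hr a
    have hR := hrt.2 hr
    rw [hmax]
    simp only [← hπ.sim_iff]
    constructor
    · intro ha
      have hda := he.total_of_mem ha
      refine ⟨⟨hda.1, Or.inl hR⟩, ?_⟩
      rintro b (rfl | ⟨h1, h2, h3, -⟩)
      · exact le_rfl
      · rw [hda.2] at h3
        exact h3 ▸ he.le b h1
    · rintro ⟨hlc, hmin⟩
      have hda := he.total_of_mem (he.mem a hlc.1)
      have := (hmin _ (Or.inr ⟨hda.1, hlc.1, hda.2, Or.inl hR⟩)).antisymm (he.le a hlc.1)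
      rw [this]
      exact he.mem a hlc.1
  · intro hr a
    have hR := fun h => hr (hrt.1 h)
    rw [← hπ.mem_predLeaves_iff, ← (hnr hR).2 a]
    refine ⟨fun ha => ⟨a, Sim.refl a, ha⟩, ?_⟩
    rintro ⟨u, hu, huE⟩
    -- When `Rooted` fails, an element of `E` is alone in its class, so the image of `E` in the
    -- quotient determines `E`.
    rwa [he.eq_of_sim (fun hlc => hlc.2.elim hR fun h => h huE) hu] at huE
  · intro a
    rw [hmax, IsLeafClass, hrt]
  · intro a b
    rw [← hπ.sim_iff, Sim, hrt]
  · intro hr c hc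
    obtain ⟨a, rfl⟩ := hsurj c
    obtain ⟨y, hy⟩ := (hnr fun h => hr (hrt.1 h)).1 a ((hπ.isMax_iff a).1 hc)
    exact ⟨π y, (hπ.covBy_iff y a).1 hy⟩
  · intro i x
    simp only [hπ.ran_iff, hπ.sim_iff]
  · intro x y
    rw [mem_iff_total]
    constructor
    · rintro ⟨hd, rfl⟩
      exact ⟨he.mem x hd, he.le x hd, he.greatest x hd⟩
    · rintro ⟨h1, h2, h3⟩
      have hd := (he.dom_iff x).2 ⟨y, h1, h2⟩
      exact ⟨hd, (h3 _ (he.mem x hd) (he.le x hd)).antisymm (he.greatest x hd y h1 h2)⟩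
  · intro i x y
    have hE : (¬ IsMax (π y) ∨ y ∈ (g .e).ran) ↔ (¬ (g .e y).Dom ∨ y ∈ (g .e).ran) := by
      rw [hmax, IsLeafClass]
      tauto
    rw [hE, mem_iff_total, mem_iff_total, hπ.total_map, hfd, ← hπ.sim_iff, and_assoc]
    refine and_congr_right fun hx => ?_
    -- The axiom on values speaks of elements of `E_≤` only; `x'` will be `e(x)` if `e` is defined
    -- at `x` and `x` otherwise, which does not change the value of `f`.
    have key : ∀ x', ¬ (g .e x').Dom ∨ x' ∈ (g .e).ran → (g (.old i) x').Dom →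
        total (g (.old i)) x' = total (g (.old i)) x → (total (g (.old i)) x = y ↔
        Sim (g .e) (total (g (.old i)) x) y ∧ (¬ (g .e y).Dom ∨ y ∈ (g .e).ran)) := by
      intro x' hx' hd' htot
      have h1 := (hf i).eq_iff x' hx' hd'
      rw [htot] at h1
      constructor
      · rintro rfl
        exact ⟨Sim.refl _, ((h1 _).2 rfl).1⟩
      · rintro ⟨h2, h3⟩
        exact ((h1 y).1 ⟨h3, x', ⟨Sim.refl _, hd'⟩, htot ▸ h2⟩).symm
    by_cases hxe : (g .e x).Dom
    · exact key (total (g .e) x) (Or.inr (he.mem x hxe)) (((hf i).dom_e x hxe).1 hx)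
        ((hf i).eq_e x hxe hx).symm
    · exact key x (Or.inl hxe) hx rfl
  · intro a ha
    rw [← hcl a ((hmax a).1 ha)]
    have : (fun y => π y = π a) = fun y => Sim (g .e) y a := by
      ext y; rw [hπ.sim_iff]
    rw [this]

end Decomposition

/-! ## Back-and-forth systems between decomposed trees -/

section FiberSystem

variable {M N : Type u} [SemilatticeInf M] [SemilatticeInf N] {Q : Type v} {Q' : Type w}
  [SemilatticeInf Q] [SemilatticeInf Q'] {π : M → Q} {π' : N → Q'}

/-- The meet of a fiber. -/
@[reducible]
def fiberInf (hπ : ∀ a b, π (a ⊓ b) = π a ⊓ π b) (c : Q) : SemilatticeInf {y // π y = c} :=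
  Subtype.semilatticeInf fun {a b} ha hb => by rw [hπ, ha, hb, inf_idem]

/-- The part of a relation lying over a pair of points. -/
def fiberRel (π : M → Q) (π' : N → Q') (c : Q) (c' : Q') (s : Set (M × N)) :
    Set ({y // π y = c} × {y // π' y = c'}) :=
  (fun p => (p.1.1, p.2.1)) ⁻¹' s

omit [SemilatticeInf M] [SemilatticeInf N] [SemilatticeInf Q] [SemilatticeInf Q'] in
theorem fiberRel_insert {c : Q} {c' : Q'} (s : Set (M × N)) (a : {y // π y = c})
    (b : {y // π' y = c'}) :
    fiberRel π π' c c' (insert (a.1, b.1) s) = insert (a, b) (fiberRel π π' c c' s) := by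
  ext ⟨x, y⟩
  simp [fiberRel, Subtype.ext_iff]

omit [SemilatticeInf M] [SemilatticeInf N] [SemilatticeInf Q] [SemilatticeInf Q'] in
theorem fiberRel_insert_of_not {c : Q} {c' : Q'} (s : Set (M × N)) {a : M} {b : N}
    (h : ¬ (π a = c ∧ π' b = c')) :
    fiberRel π π' c c' (insert (a, b) s) = fiberRel π π' c c' s := by
  ext ⟨x, y⟩
  simp only [fiberRel, Set.mem_preimage, Set.mem_insert_iff, Prod.mk.injEq, or_iff_right_iff_imp]
  rintro ⟨rfl, rfl⟩
  exact absurd ⟨x.2, y.2⟩ h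

variable {ι : Type}

/-- A relation preserving the order, the leaves and `E`, and closed under meets and predecessors of
leaves. -/
structure IsExtIso (g : AddE ι → M →. M) (g' : AddE ι → N →. N) (r : Set (M × N)) : Prop where
  le : ∀ p ∈ r, ∀ q ∈ r, p.1 ≤ q.1 ↔ p.2 ≤ q.2
  inf : ∀ p ∈ r, ∀ q ∈ r, p ⊓ q ∈ r
  max : ∀ p ∈ r, IsMax p.1 ↔ IsMax p.2
  ran : ∀ p ∈ r, p.1 ∈ (g .e).ran ↔ p.2 ∈ (g' .e).ran
  pred : ∀ p ∈ r, IsMax p.1 → ∀ q : M × N, q.1 ⋖ p.1 → q.2 ⋖ p.2 → q ∈ r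

variable {g : AddE ι → M →. M} {g' : AddE ι → N →. N} {h : ι → Q →. Q} {h' : ι → Q' →. Q'}
  {T₀ : Type w'} [SemilatticeInf T₀]

section Fiber

variable {rt : Prop} {S₀ : Language.order.Theory} (hd : Decomp g h π S₀ rt)

include hd

theorem Decomp.mono {a b : M} (hab : a ≤ b) : π a ≤ π b := (hd.le_iff a b).2 (Or.inl hab)

theorem Decomp.isMax_fiber {c : Q} (hc : IsMax c) (a : {y // π y = c}) :
    IsMax a ↔ IsMax a.1 := by
  constructor
  · intro ha b hb
    exact ha (show a ≤ ⟨b, hc.eq_of_ge (a.2 ▸ hd.mono hb)⟩ from hb)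
  · exact fun ha b hb => ha hb

theorem Decomp.covBy_fiber {c : Q} {a b : {y // π y = c}} (hab : a ⋖ b) :
    a.1 ⋖ b.1 :=
  ⟨hab.1, fun z haz hzb => hab.2 (c := ⟨z, le_antisymm (b.2 ▸ hd.mono hzb.le)
    (a.2 ▸ hd.mono haz.le)⟩) haz hzb⟩

end Fiber

variable (hT₀ : IsOneColored T₀) (hd : Decomp g h π (orderTheoryOf T₀) (HasRoot T₀))
  (hd' : Decomp g' h' π' (orderTheoryOf T₀) (HasRoot T₀))

include hd

theorem Decomp.isBot_fiber {c : Q} (hc : IsMax c) (a : {y // π y = c}) :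
    IsBot a ↔ HasRoot T₀ ∧ a.1 ∈ (g .e).ran := by
  obtain ⟨a, rfl⟩ := a
  by_cases hr : HasRoot T₀
  · rw [hd.ran_of_root hr]
    simp only [hr, hc, true_and]
    exact ⟨fun ha b hb => ha ⟨b, hb⟩, fun ha b => ha b.1 b.2⟩
  · simp only [hr, false_and, iff_false]
    exact fun ha => hr (hasRoot_transfer (hd.cls a hc) ⟨_, ha⟩)

include hT₀ hd'

/-- Leaves and covers of a class over a leaf are leaves and covers of the whole tree, and its root,
if any, is its element of `E`. So partial isomorphisms of the models restrict to ones between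
classes. -/
theorem Decomp.exists_fiberSystem {c : Q} {c' : Q'} (hc : IsMax c) (hc' : IsMax c') :
    ∃ K : Set ({y // π y = c} × {y // π' y = c'}) → Prop, IsBackForth K ∧ K ∅ ∧
      (∀ s, K s → ∀ p ∈ s, ∀ q ∈ s, p.1 ≤ q.1 ↔ p.2 ≤ q.2) ∧
      ∀ r s, IsExtIso g g' r → s ⊆ r → s.Finite → K (fiberRel π π' c c' s) := by
  let _ := fiberInf hd.inf c
  let _ := fiberInf hd'.inf c'
  obtain ⟨a, rfl⟩ := hd.surjective c
  obtain ⟨b, rfl⟩ := hd'.surjective c'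
  obtain ⟨K, hK⟩ := exists_isClassSystem hT₀ (hd.cls a hc) (hd'.cls b hc')
  refine ⟨K, hK.backForth, hK.empty, hK.preservesLE, fun r s hr hsr hs => ?_⟩
  refine hK.of_isTreeIso (fiberRel π π' _ _ r) _ ⟨?_, ?_, ?_, ?_, ?_⟩ (Set.preimage_mono hsr)
    (hs.preimage ?_)
  · exact fun p hp q hq => hr.le _ hp _ hq
  · exact fun p hp q hq => hr.inf _ hp _ hq
  · intro p hp
    rw [hd.isMax_fiber hc, hd'.isMax_fiber hc']
    exact hr.max _ hp
  · intro p hp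
    rw [hd.isBot_fiber hc, hd'.isBot_fiber hc']
    exact and_congr Iff.rfl (hr.ran _ hp)
  · intro p hp hm q h1 h2
    exact hr.pred _ hp ((hd.isMax_fiber hc _).1 hm) _ (hd.covBy_fiber h1) (hd'.covBy_fiber h2)
  · intro p _ q _ hpq
    simp only [Prod.mk.injEq] at hpq
    exact Prod.ext (Subtype.ext hpq.1) (Subtype.ext hpq.2)

/-- `S` decides the class of the partner, and the system of that pair of classes decides the partner
inside it. Over a point that is not a leaf there is no choice. -/
theorem Decomp.exists_isBackForth {S : Set (Q × Q') → Prop} (hS : IsBackForth S)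
    (hle : PreservesLE S)
    (hfn : ∀ s, S s → ∀ i, ∀ p ∈ s, ∀ q ∈ s, q.1 ∈ h i p.1 ↔ q.2 ∈ h' i p.2) :
    ∃ R : Set (M × N) → Prop, IsBackForth R ∧ PreservesLE R ∧
      (∀ s, R s → ∀ i, ∀ p ∈ s, ∀ q ∈ s, q.1 ∈ g i p.1 ↔ q.2 ∈ g' i p.2) ∧
      (S ∅ → R ∅) ∧
      ∀ r s, IsExtIso g g' r → s ⊆ r → s.Finite → S (Prod.map π π' '' s) → R s := by
  have hK : ∀ c c', ∃ K : Set ({y // π y = c} × {y // π' y = c'}) → Prop, IsMax c → IsMax c' →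
      IsBackForth K ∧ K ∅ ∧ (∀ s, K s → ∀ p ∈ s, ∀ q ∈ s, p.1 ≤ q.1 ↔ p.2 ≤ q.2) ∧
      ∀ r s, IsExtIso g g' r → s ⊆ r → s.Finite → K (fiberRel π π' c c' s) := by
    intro c c'
    by_cases hc : IsMax c ∧ IsMax c'
    · obtain ⟨K, hK⟩ := hd.exists_fiberSystem hT₀ hd' hc.1 hc.2
      exact ⟨K, fun _ _ => hK⟩
    -- No system is needed here; any value serves.
    · exact ⟨fun _ => True, fun h1 h2 => absurd ⟨h1, h2⟩ hc⟩
  choose K hK using hK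
  let R : Set (M × N) → Prop := fun s => S (Prod.map π π' '' s) ∧
    ∀ c c', IsMax c → IsMax c' → K c c' (fiberRel π π' c c' s)
  have himage : ∀ s a b, Prod.map π π' '' (insert (a, b) s) =
      insert (π a, π' b) (Prod.map π π' '' s) := fun s a b => Set.image_insert_eq
  -- A new pair changes the trace over one pair of points only.
  have hins : ∀ s a b, R s → S (insert (π a, π' b) (Prod.map π π' '' s)) →
      (∀ (hc : IsMax (π a)) (hc' : IsMax (π' b)),
        K (π a) (π' b) (insert (⟨a, rfl⟩, ⟨b, rfl⟩) (fiberRel π π' (π a) (π' b) s))) →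
      R (insert (a, b) s) := by
    intro s a b hs hS₁ hK₁
    refine ⟨by rwa [himage], fun c c' hc hc' => ?_⟩
    by_cases hcc : π a = c ∧ π' b = c'
    · obtain ⟨rfl, rfl⟩ := hcc
      rw [fiberRel_insert s ⟨a, rfl⟩ ⟨b, rfl⟩]
      exact hK₁ hc hc'
    · rw [fiberRel_insert_of_not s hcc]
      exact hs.2 c c' hc hc'
  have hmem : ∀ {s : Set (M × N)} {p}, p ∈ s → (π p.1, π' p.2) ∈ Prod.map π π' '' s :=
    fun hp => ⟨_, hp, rfl⟩
  have hmax : ∀ s, R s → ∀ p ∈ s, IsMax (π p.1) ↔ IsMax (π' p.2) := fun s hs p hp =>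
    hS.isMax_iff hle hs.1 (hmem hp)
  have heq : ∀ s, R s → ∀ p ∈ s, ∀ q ∈ s, π p.1 = π q.1 ↔ π' p.2 = π' q.2 := fun s hs p hp q hq =>
    hle.eq_iff hs.1 (hmem hp) (hmem hq)
  have hR : IsBackForth R := by
    refine ⟨fun s hs a => ?_, fun s hs b => ?_⟩
    · obtain ⟨c', hc'⟩ := hS.forth _ hs.1 (π a)
      have hm : IsMax (π a) ↔ IsMax c' := hS.isMax_iff hle hc' (Set.mem_insert _ _)
      by_cases hc : IsMax (π a)
      · obtain ⟨⟨b, rfl⟩, hb⟩ := (hK (π a) c' hc (hm.1 hc)).1.forth _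
          (hs.2 (π a) c' hc (hm.1 hc)) ⟨a, rfl⟩
        exact ⟨b, hins s a b hs hc' fun _ _ => hb⟩
      · obtain ⟨b, rfl⟩ := hd'.surjective c'
        exact ⟨b, hins s a b hs hc' fun h => absurd h hc⟩
    · obtain ⟨c, hc'⟩ := hS.back _ hs.1 (π' b)
      have hm : IsMax c ↔ IsMax (π' b) := hS.isMax_iff hle hc' (Set.mem_insert _ _)
      by_cases hc : IsMax (π' b)
      · obtain ⟨⟨a, rfl⟩, ha⟩ := (hK c (π' b) (hm.2 hc) hc).1.back _
          (hs.2 c (π' b) (hm.2 hc) hc) ⟨b, rfl⟩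
        exact ⟨a, hins s a b hs hc' fun _ _ => ha⟩
      · obtain ⟨a, rfl⟩ := hd.surjective c
        exact ⟨a, hins s a b hs hc' fun _ h => absurd h hc⟩
  -- Between different classes the order is that of the quotients; inside a class it is equality, or
  -- over a leaf it is governed by the class system.
  have hRle : PreservesLE R := by
    intro s hs p hp q hq
    by_cases hpq : π p.1 = π q.1
    · have hpq' := (heq s hs p hp q hq).1 hpq
      by_cases hc : IsMax (π q.1)
      · have hc' := (hmax s hs q hq).1 hc
        exact (hK _ _ hc hc').2.2.1 _ (hs.2 _ _ hc hc') (⟨p.1, hpq⟩, ⟨p.2, hpq'⟩) hp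
          (⟨q.1, rfl⟩, ⟨q.2, rfl⟩) hq
      · have h1 := hd.inj _ _ (hpq ▸ hc) hpq
        have h2 := hd'.inj _ _ (hpq' ▸ mt (hmax s hs q hq).2 hc) hpq'
        rw [h1, h2]
        simp
    · have hpq' := mt (heq s hs p hp q hq).2 hpq
      have h1 := hd.le_iff p.1 q.1
      have h2 := hd'.le_iff p.2 q.2
      rw [or_iff_left hpq] at h1
      rw [or_iff_left hpq'] at h2
      rw [← h1, ← h2]
      exact hle _ hs.1 _ (hmem hp) _ (hmem hq)
  -- `E` is defined with one quantifier: over the model, as the least elements of leaf classes, if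
  -- `T₀` has a root; over the quotient, as the points above which a leaf sits, if not.
  have hran : ∀ s, R s → ∀ p ∈ s, p.1 ∈ (g .e).ran ↔ p.2 ∈ (g' .e).ran := by
    intro s hs p hp
    by_cases hr : HasRoot T₀
    · rw [hd.ran_of_root hr, hd'.ran_of_root hr, hmax s hs p hp]
      refine and_congr_right fun _ => hR.forall_iff hs fun a b hab => ?_
      have hp' : p ∈ insert (a, b) s := Set.mem_insert_of_mem _ hp
      rw [heq _ hab (a, b) (Set.mem_insert _ _) p hp', hRle _ hab p hp' (a, b) (Set.mem_insert _ _)]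
    · rw [hd.ran_of_not_root hr, hd'.ran_of_not_root hr]
      refine hS.exists_iff hs.1 fun α β hαβ => ?_
      have hα : (α, β) ∈ insert (α, β) (Prod.map π π' '' s) := Set.mem_insert _ _
      rw [hS.isMax_iff hle hαβ hα,
        hS.covBy_iff hle hαβ (Set.mem_insert_of_mem _ (hmem hp)) hα]
  refine ⟨R, hR, hRle, ?_, ?_, ?_⟩
  · rintro s hs (i | _) p hp q hq
    · rw [hd.fn_iff, hd'.fn_iff, hmax s hs q hq, hran s hs q hq,
        hfn _ hs.1 i _ (hmem hp) _ (hmem hq)]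
    · rw [hd.e_iff, hd'.e_iff, hran s hs q hq, hRle s hs q hq p hp]
      refine and_congr_right fun _ => and_congr_right fun _ => hR.forall_iff hs fun a b hab => ?_
      have hp' : p ∈ insert (a, b) s := Set.mem_insert_of_mem _ hp
      have hq' : q ∈ insert (a, b) s := Set.mem_insert_of_mem _ hq
      have ha : (a, b) ∈ insert (a, b) s := Set.mem_insert _ _
      rw [hran _ hab _ ha, hRle _ hab _ ha _ hp', hRle _ hab _ ha _ hq']
  · intro h0
    refine ⟨by rwa [Set.image_empty], fun c c' hc hc' => (hK c c' hc hc').2.1⟩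
  · exact fun r s hr hsr hs hS₁ => ⟨hS₁, fun c c' hc hc' => (hK c c' hc hc').2.2.2 r s hr hsr hs⟩

end FiberSystem

/-! ## Partial isomorphisms closed under the functions -/

section TreeClosed

variable {M : Type u} {N : Type v} [SemilatticeInf M] [SemilatticeInf N] {κ : Type}

/-- A relation preserving the order, the leaves, the domains and the images, and closed under the
functions. -/
structure IsTreeClosed (g : κ → M →. M) (h : κ → N →. N) (r : Set (M × N)) : Prop where
  le : ∀ p ∈ r, ∀ q ∈ r, p.1 ≤ q.1 ↔ p.2 ≤ q.2
  inf : ∀ p ∈ r, ∀ q ∈ r, p ⊓ q ∈ r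
  max : ∀ p ∈ r, IsMax p.1 ↔ IsMax p.2
  dom : ∀ i, ∀ p ∈ r, (g i p.1).Dom ↔ (h i p.2).Dom
  ran : ∀ i, ∀ p ∈ r, p.1 ∈ (g i).ran ↔ p.2 ∈ (h i).ran
  total : ∀ i, ∀ p ∈ r, (total (g i) p.1, total (h i) p.2) ∈ r

theorem IsTreeClosed.eq {g : κ → M →. M} {h : κ → N →. N} {r : Set (M × N)}
    (hr : IsTreeClosed g h r) {p q : M × N} (hp : p ∈ r) (hq : q ∈ r) : p.1 = q.1 ↔ p.2 = q.2 := by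
  rw [le_antisymm_iff, le_antisymm_iff, hr.le p hp q hq, hr.le q hq p hp]

theorem IsTreeClosed.lt {g : κ → M →. M} {h : κ → N →. N} {r : Set (M × N)}
    (hr : IsTreeClosed g h r) {p q : M × N} (hp : p ∈ r) (hq : q ∈ r) : p.1 < q.1 ↔ p.2 < q.2 := by
  rw [lt_iff_le_not_ge, lt_iff_le_not_ge, hr.le p hp q hq, hr.le q hq p hp]

theorem isClosedPartialIso_iff (hM : IsGoodTree M) (hN : IsGoodTree N) {g : κ → M →. M}
    {h : κ → N →. N} {r : Set (M × N)} :
    @IsClosedPartialIso _ _ (treeLang κ) (treeStructure g) (treeStructure h) r ↔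
      IsTreeClosed g h r := by
  let _ := treeStructure g
  let _ := treeStructure h
  constructor
  · intro hr
    have h1 : ∀ p ∈ r, ∀ i : Fin 1, (![p] : Fin 1 → M × N) i ∈ r := by
      intro p hp i; fin_cases i; exact hp
    have h2 : ∀ p ∈ r, ∀ q ∈ r, ∀ i : Fin 2, (![p, q] : Fin 2 → M × N) i ∈ r := by
      intro p hp q hq i; fin_cases i <;> assumption
    exact ⟨fun p hp q hq => hr.rel (n := 2) TreeRel.le ![p, q] (h2 p hp q hq),
      fun p hp q hq => hr.fn (n := 2) TreeFunc.meet ![p, q] (h2 p hp q hq),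
      fun p hp => hr.rel (n := 1) TreeRel.leaf ![p] (h1 p hp),
      fun i p hp => hr.rel (n := 1) (TreeRel.dom i) ![p] (h1 p hp),
      fun i p hp => hr.rel (n := 1) (TreeRel.im i) ![p] (h1 p hp),
      fun i p hp => hr.fn (n := 1) (TreeFunc.fn i) ![p] (h1 p hp)⟩
  · intro hr
    refine ⟨fun p hp q hq => hr.eq hp hq, fun R x hx => ?_, fun F x hx => ?_⟩
    · cases R with
      | le => exact hr.le _ (hx 0) _ (hx 1)
      | node =>
        change IsNode (x 0).1 ↔ IsNode (x 0).2
        rw [isNode_iff hM, isNode_iff hN, hr.max _ (hx 0)]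
      | leaf => exact hr.max _ (hx 0)
      | dom i => exact hr.dom i _ (hx 0)
      | im i => exact hr.ran i _ (hx 0)
    · cases F with
      | meet => exact hr.inf _ (hx 0) _ (hx 1)
      | fn i => exact hr.total i _ (hx 0)

end TreeClosed

/-! ### Predecessors in the quotient. -/

section DecompPred

variable {M : Type u} [SemilatticeInf M] {Q : Type v} [SemilatticeInf Q] {ι : Type}
  {g : AddE ι → M →. M} {h : ι → Q →. Q} {π : M → Q} {rt : Prop} {S₀ : Language.order.Theory}
  (hd : Decomp g h π S₀ rt)

include hd

theorem Decomp.e_spec {a : M} (ha : (g .e a).Dom) : total (g .e) a ∈ (g .e).ran ∧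
    total (g .e) a ≤ a ∧ ∀ z ∈ (g .e).ran, z ≤ a → z ≤ total (g .e) a :=
  (hd.e_iff _ _).1 (mem_iff_total.2 ⟨ha, rfl⟩)

theorem Decomp.e_of_mem_ran {a : M} (ha : a ∈ (g .e).ran) :
    (g .e a).Dom ∧ total (g .e) a = a :=
  mem_iff_total.1 ((hd.e_iff a a).2 ⟨ha, le_rfl, fun _ _ h => h⟩)

theorem Decomp.lt_iff {a b : M} (h : π a ≠ π b) : π a < π b ↔ a < b := by
  rw [lt_iff_le_and_ne, lt_iff_le_and_ne, hd.le_iff, or_iff_left h]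
  exact and_congr_right fun _ => ⟨fun _ => fun hab => h (hab ▸ rfl), fun _ => h⟩

theorem Decomp.lt_of_lt {a b : M} (h : π a < π b) : a < b := (hd.lt_iff h.ne).1 h

theorem Decomp.le_of_not_isMax {a : M} (ha : ¬ IsMax (π a)) : ∀ y, π y = π a → a ≤ y :=
  fun _ hy => (hd.inj _ _ ha hy.symm).le

theorem Decomp.map_e (hr : rt) {a : M} (ha : (g .e a).Dom) : π (total (g .e) a) = π a := by
  have h1 := hd.e_of_mem_ran (hd.e_spec ha).1
  exact (hd.eq_iff _ _).2 (Or.inr ⟨h1.1, ha, h1.2, Or.inl hr⟩)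

theorem Decomp.e_le (hr : rt) {a : M} (ha : IsMax (π a)) :
    ∀ y, π y = π (total (g .e) a) → total (g .e) a ≤ y :=
  ((hd.ran_of_root hr _).1 (hd.e_spec ((hd.isMax_iff a).1 ha).1).1).2

/-- What lies strictly below `m` is outside its class, hence not over a leaf and alone in its class.
So strictly below `m` and strictly below `π m` the trees agree. -/
theorem Decomp.covBy_iff {m : M} (hm : ∀ y, π y = π m → m ≤ y) (c : Q) :
    c ⋖ π m ↔ ∃ b, b ⋖ m ∧ π b = c := by
  constructor
  · intro hc
    obtain ⟨b, rfl⟩ := hd.surjective c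
    refine ⟨b, ⟨hd.lt_of_lt hc.lt, fun z hbz hzm => ?_⟩, rfl⟩
    have h1 : π b ≠ π z := fun h => hbz.ne (hd.inj _ _ hc.lt.not_isMax h)
    have h2 : π z ≠ π m := fun h => hzm.not_ge (hm z h)
    exact hc.2 ((hd.lt_iff h1).2 hbz) ((hd.lt_iff h2).2 hzm)
  · rintro ⟨b, hb, rfl⟩
    have h1 : π b ≠ π m := fun h => hb.lt.not_ge (hm b h)
    refine ⟨(hd.lt_iff h1).2 hb.lt, fun c h2 h3 => ?_⟩
    obtain ⟨z, rfl⟩ := hd.surjective c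
    exact hb.2 (hd.lt_of_lt h2) (hd.lt_of_lt h3)

variable (hM : IsGoodTree M) (hQ : IsGoodTree Q)

include hM hQ

/-- Applied to `m = a` when `π a` is not a leaf, and to `m = e(a)` when it is one and the classes
have roots. -/
theorem Decomp.pred_of_least {m : M} (hm : ∀ y, π y = π m → m ≤ y) :
    ((pred Q (π m)).Dom ↔ (pred M m).Dom) ∧ total (pred Q) (π m) = π (total (pred M) m) := by
  have h1 : (pred Q (π m)).Dom ↔ (pred M m).Dom := by
    rw [pred_dom, pred_dom]
    constructor
    · rintro ⟨c, hc⟩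
      obtain ⟨b, hb, -⟩ := (hd.covBy_iff hm c).1 hc
      exact ⟨b, hb⟩
    · rintro ⟨b, hb⟩
      exact ⟨_, (hd.covBy_iff hm _).2 ⟨b, hb, rfl⟩⟩
  refine ⟨h1, ?_⟩
  by_cases hp : (pred M m).Dom
  · have h2 := (mem_pred hM).1 (mem_iff_total.2 ⟨hp, rfl⟩)
    exact total_of_mem ((mem_pred hQ).2 ((hd.covBy_iff hm _).2 ⟨_, h2, rfl⟩))
  · rw [total_of_not_dom hp, total_of_not_dom (mt h1.1 hp)]

-- Without roots, `E` is the set of elements over predecessors of leaves, and `e(a)` is the largest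
-- of them below `a`; so it lies over the predecessor of `π a`.
omit hM in
theorem Decomp.pred_of_isMax_of_not_root (hr : ¬ rt) {a : M} (ha : IsMax (π a)) :
    (pred Q (π a)).Dom ∧ total (pred Q) (π a) = π (total (g .e) a) := by
  obtain ⟨c, hc⟩ := hd.exists_pred hr _ ha
  obtain ⟨b, rfl⟩ := hd.surjective c
  obtain ⟨h1, h2, h3⟩ := hd.e_spec ((hd.isMax_iff a).1 ha).1
  have h4 : ¬ IsMax (π (total (g .e) a)) := fun h => ((hd.isMax_iff _).1 h).2.elim hr (· h1)
  have h5 : π (total (g .e) a) < π a := ((hd.le_iff _ _).2 (Or.inl h2)).lt_of_ne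
    fun h => h4 (h ▸ ha)
  have h6 : b ≤ total (g .e) a :=
    h3 b ((hd.ran_of_not_root hr b).2 ⟨_, ha, hc⟩) (hd.lt_of_lt hc.lt).le
  have h7 : π b = π (total (g .e) a) :=
    ((hd.le_iff _ _).2 (Or.inl h6)).eq_or_lt.resolve_right fun h => hc.2 h h5
  exact mem_iff_total.1 ((mem_pred hQ).2 (h7 ▸ hc))

/-- A cover of `π a` in `Q` lifts to a cover of `a` by the least element of the class above it. If
that class has no least element, `a` belongs to `E` instead. -/
theorem Decomp.map_mem_ran_pred_iff (a : M) : π a ∈ (pred Q).ran ↔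
    ¬ IsMax (π a) ∧ (a ∈ (g .e).ran ∨ a ∈ (pred M).ran) := by
  have hQr : π a ∈ (pred Q).ran ↔ ∃ y, π a ⋖ π y :=
    (exists_congr fun c => mem_pred hQ).trans hd.surjective.exists
  have hMr : a ∈ (pred M).ran ↔ ∃ y, a ⋖ y := exists_congr fun y => mem_pred hM
  rw [hQr, hMr]
  constructor
  · rintro ⟨y, hy⟩
    refine ⟨hy.lt.not_isMax, ?_⟩
    by_cases hm : IsMax (π y)
    · by_cases hr : rt
      · right
        rw [← hd.map_e hr ((hd.isMax_iff y).1 hm).1] at hy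
        obtain ⟨b, hb, hba⟩ := (hd.covBy_iff (hd.e_le hr hm) _).1 hy
        rw [hd.inj a b hy.lt.not_isMax hba.symm]
        exact ⟨_, hb⟩
      · exact Or.inl ((hd.ran_of_not_root hr a).2 ⟨_, hm, hy⟩)
    · right
      obtain ⟨b, hb, hba⟩ := (hd.covBy_iff (hd.le_of_not_isMax hm) _).1 hy
      rw [hd.inj a b hy.lt.not_isMax hba.symm]
      exact ⟨_, hb⟩
  · rintro ⟨hm, h⟩
    by_cases hE : a ∈ (g .e).ran
    · have hr : ¬ rt := fun hr => hm ((hd.ran_of_root hr a).1 hE).1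
      obtain ⟨c, -, hc⟩ := (hd.ran_of_not_root hr a).1 hE
      obtain ⟨y, rfl⟩ := hd.surjective c
      exact ⟨y, hc⟩
    obtain ⟨y, hy⟩ := h.resolve_left hE
    refine ⟨y, (hd.covBy_iff ?_ _).2 ⟨a, hy, rfl⟩⟩
    by_cases hym : IsMax (π y)
    swap
    · exact hd.le_of_not_isMax hym
    have hyd := (hd.isMax_iff y).1 hym
    obtain ⟨h1, h2, h3⟩ := hd.e_spec hyd.1
    -- If `e(y) ≤ a`, then `a` is in `E_≥` but not in `E`, hence over a leaf. So `a < e(y) ≤ y`, and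
    -- the cover forces `y = e(y)`, the root of its class.
    have hey : ¬ total (g .e) y ≤ a := by
      intro hle
      exact hm ((hd.isMax_iff a).2 ⟨(hd.dom_e_iff a).2 ⟨_, h1, hle⟩, Or.inr hE⟩)
    have hlt : a < total (g .e) y := lt_of_chain hM.chain_below h2 hy.le hey
    have hye : total (g .e) y = y := h2.eq_or_lt.resolve_right fun h => hy.2 hlt h
    have hr : rt := hyd.2.resolve_right fun h => h (hye ▸ h1)
    exact hye ▸ hd.e_le hr hym

end DecompPred

/-! ### Projection of closed relations to the quotients. -/

section MapClosed

variable {M N : Type u} [SemilatticeInf M] [SemilatticeInf N] {Q : Type v} {Q' : Type w}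
  [SemilatticeInf Q] [SemilatticeInf Q'] {π : M → Q} {π' : N → Q'} {ι : Type}
  {g : AddE ι → M →. M} {g' : AddE ι → N →. N} {h : ι → Q →. Q} {h' : ι → Q' →. Q'}
  {rt : Prop} {S₀ : Language.order.Theory}

/-- Values of `f` are not over leaves or belong to `E`. So a value in the class of `a` is `a` itself
or, if classes have roots, `e(a)`. -/
theorem Decomp.map_mem_ran_iff (hd : Decomp g h π S₀ rt) (i : ι) (a : M) :
    π a ∈ (h i).ran ↔ a ∈ (g (.old i)).ran ∨
      rt ∧ (g .e a).Dom ∧ total (g .e) a ∈ (g (.old i)).ran := by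
  rw [hd.ran_iff]
  constructor
  · rintro ⟨y, hy, hyr⟩
    obtain ⟨x, hx⟩ := id hyr
    rcases (hd.eq_iff y a).1 hy with rfl | ⟨h1, h2, h3, h4⟩
    · exact Or.inl hyr
    rcases ((hd.fn_iff i x y).1 hx).2 with hm | hE
    · left
      rwa [← hd.inj y a hm hy]
    · rw [(hd.e_of_mem_ran hE).2] at h3 h4
      exact Or.inr ⟨h4.resolve_right fun h => inf_le_left.not_gt h, h2, h3 ▸ hyr⟩
  · rintro (ha | ⟨hr, ha, hr'⟩)
    · exact ⟨a, rfl, ha⟩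
    · exact ⟨_, hd.map_e hr ha, hr'⟩

theorem IsTreeClosed.isExtIso (hM : IsGoodTree M) (hN : IsGoodTree N) {r : Set (M × N)}
    (hr : IsTreeClosed (withPred g) (withPred g') r) : IsExtIso g g' r where
  le := hr.le
  inf := hr.inf
  max := hr.max
  ran := hr.ran (.old .e)
  pred p hp _ q h1 h2 := by
    have := hr.total .p p hp
    rwa [show GoodTree.total (withPred g .p) p.1 = q.1 from total_of_mem ((mem_pred hM).2 h1),
      show GoodTree.total (withPred g' .p) p.2 = q.2 from total_of_mem ((mem_pred hN).2 h2)] at this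

/-- Equality of classes, the order, the `f̄` and the predecessor of `Q` are all read off from `e`,
`p`, the `f` and meets on representatives, and `r` is closed under these. This is why elimination
for `Σ'` uses exactly these symbols. -/
theorem Decomp.isTreeClosed_map (hM : IsGoodTree M) (hN : IsGoodTree N) (hQ : IsGoodTree Q)
    (hQ' : IsGoodTree Q') (hd : Decomp g h π S₀ rt) (hd' : Decomp g' h' π' S₀ rt)
    {r : Set (M × N)} (hr : IsTreeClosed (withPred g) (withPred g') r) :
    IsTreeClosed (withPred h) (withPred h') (Prod.map π π' '' r) := by
  have hdom : ∀ p ∈ r, (g .e p.1).Dom ↔ (g' .e p.2).Dom := hr.dom (.old .e)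
  have hran : ∀ p ∈ r, p.1 ∈ (g .e).ran ↔ p.2 ∈ (g' .e).ran := hr.ran (.old .e)
  have htot : ∀ p ∈ r, (total (g .e) p.1, total (g' .e) p.2) ∈ r := hr.total (.old .e)
  have hmax : ∀ p ∈ r, IsMax (π p.1) ↔ IsMax (π' p.2) := fun p hp => by
    rw [hd.isMax_iff, hd'.isMax_iff, hdom p hp, hran p hp]
  have heq : ∀ p ∈ r, ∀ q ∈ r, π p.1 = π q.1 ↔ π' p.2 = π' q.2 := fun p hp q hq => by
    have h1 := hr.lt (htot p hp) (hr.inf p hp q hq)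
    simp only [Prod.fst_inf, Prod.snd_inf] at h1
    have h2 := hr.eq (htot p hp) (htot q hq)
    dsimp only at h2
    rw [hd.eq_iff, hd'.eq_iff, hr.eq hp hq, hdom p hp, hdom q hq, h1, h2]
  refine ⟨?_, ?_, ?_, ?_, ?_, ?_⟩
  · rintro _ ⟨p, hp, rfl⟩ _ ⟨q, hq, rfl⟩
    change π p.1 ≤ π q.1 ↔ π' p.2 ≤ π' q.2
    rw [hd.le_iff, hd'.le_iff, hr.le p hp q hq, heq p hp q hq]
  · rintro _ ⟨p, hp, rfl⟩ _ ⟨q, hq, rfl⟩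
    exact ⟨_, hr.inf p hp q hq, Prod.ext (hd.inf _ _) (hd'.inf _ _)⟩
  · rintro _ ⟨p, hp, rfl⟩
    exact hmax p hp
  · rintro (i | _) _ ⟨p, hp, rfl⟩
    · change (h i (π p.1)).Dom ↔ (h' i (π' p.2)).Dom
      rw [hd.dom_iff, hd'.dom_iff]
      exact hr.dom (.old (.old i)) p hp
    · change (pred Q (π p.1)).Dom ↔ (pred Q' (π' p.2)).Dom
      by_cases hm : IsMax (π p.1)
      · have hm' := (hmax p hp).1 hm
        by_cases hrt : rt
        · rw [← hd.map_e hrt ((hd.isMax_iff _).1 hm).1,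
            ← hd'.map_e hrt ((hd'.isMax_iff _).1 hm').1,
            (hd.pred_of_least hM hQ (hd.e_le hrt hm)).1,
            (hd'.pred_of_least hN hQ' (hd'.e_le hrt hm')).1]
          exact hr.dom .p _ (htot p hp)
        · exact iff_of_true (hd.pred_of_isMax_of_not_root hQ hrt hm).1
            (hd'.pred_of_isMax_of_not_root hQ' hrt hm').1
      · have hm' := mt (hmax p hp).2 hm
        rw [(hd.pred_of_least hM hQ (hd.le_of_not_isMax hm)).1,
          (hd'.pred_of_least hN hQ' (hd'.le_of_not_isMax hm')).1]
        exact hr.dom .p p hp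
  · rintro (i | _) _ ⟨p, hp, rfl⟩
    · change π p.1 ∈ (h i).ran ↔ π' p.2 ∈ (h' i).ran
      have h1 := hr.ran (.old (.old i)) p hp
      have h2 := hr.ran (.old (.old i)) _ (htot p hp)
      dsimp only [withPred] at h1 h2
      rw [hd.map_mem_ran_iff, hd'.map_mem_ran_iff, h1, h2, hdom p hp]
    · change π p.1 ∈ (pred Q).ran ↔ π' p.2 ∈ (pred Q').ran
      have h1 := hr.ran .p p hp
      dsimp only [withPred] at h1
      rw [hd.map_mem_ran_pred_iff hM hQ, hd'.map_mem_ran_pred_iff hN hQ', hmax p hp, hran p hp, h1]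
  · rintro (i | _) _ ⟨p, hp, rfl⟩
    · exact ⟨_, hr.total (.old (.old i)) p hp,
        Prod.ext (hd.total_map i p.1).symm (hd'.total_map i p.2).symm⟩
    · change (total (pred Q) (π p.1), total (pred Q') (π' p.2)) ∈ _
      by_cases hm : IsMax (π p.1)
      · have hm' := (hmax p hp).1 hm
        by_cases hrt : rt
        · rw [← hd.map_e hrt ((hd.isMax_iff _).1 hm).1,
            ← hd'.map_e hrt ((hd'.isMax_iff _).1 hm').1,
            (hd.pred_of_least hM hQ (hd.e_le hrt hm)).2,
            (hd'.pred_of_least hN hQ' (hd'.e_le hrt hm')).2]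
          exact ⟨_, hr.total .p _ (htot p hp), rfl⟩
        · rw [(hd.pred_of_isMax_of_not_root hQ hrt hm).2,
            (hd'.pred_of_isMax_of_not_root hQ' hrt hm').2]
          exact ⟨_, htot p hp, rfl⟩
      · have hm' := mt (hmax p hp).2 hm
        rw [(hd.pred_of_least hM hQ (hd.le_of_not_isMax hm)).2,
          (hd'.pred_of_least hN hQ' (hd'.le_of_not_isMax hm')).2]
        exact ⟨_, hr.total .p p hp, rfl⟩

end MapClosed

/-! ## The theory `Σ'` -/

section Main

theorem model_completeTheory {L : FirstOrder.Language.{0, 0}} (M : Type u) [L.Structure M] :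
    M ⊨ L.completeTheory M :=
  Theory.model_iff_subset_completeTheory.2 subset_rfl

variable {ι : Type} {T : Type v} [SemilatticeInf T] (hT : IsGoodTree T) {f : ι → T →. T}
  {T₀ : Type w} [SemilatticeInf T₀] (hT₀ : IsOneColored T₀)

theorem exists_tree_of_model {S : (treeLang ι).Theory} {S₀ : Language.order.Theory} {M : Type u}
    [str : (treeLang (AddE ι)).Structure M] (hM : M ⊨ sigma' S S₀) :
    ∃ (_ : SemilatticeInf M) (g : AddE ι → M →. M), IsGoodTree M ∧ str = treeStructure g := by
  refine exists_eq_treeStructure (hM.mono fun φ hφ => ?_) fun i => hM.mono fun φ hφ => ?_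
  · exact Or.inl (Or.inl (Or.inl (Or.inl (Or.inl (Or.inl hφ)))))
  · cases i with
    | e => exact Or.inl (Or.inl (Or.inl (Or.inl (Or.inl (Or.inr hφ)))))
    | old i => exact Or.inr (Set.mem_iUnion.2 ⟨i, Or.inl hφ⟩)

theorem Decomp.nonempty {M : Type u} [SemilatticeInf M] [Nonempty M] {Q : Type v}
    [SemilatticeInf Q] {π : M → Q} {g : AddE ι → M →. M} {h : ι → Q →. Q} {rt : Prop}
    {S₀ : Language.order.Theory} (_ : Decomp g h π S₀ rt) : Nonempty Q := ‹Nonempty M›.map π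

include hT hT₀

/-- Both quotients are saturated and equivalent to `T`, so equality of types between them is a
system containing the empty relation; it is glued with the class systems. -/
theorem elementarilyEquivalent_of_isSaturated {M N : Type u} [SemilatticeInf M]
    [SemilatticeInf N] [Nonempty M] [Nonempty N] (hM : IsGoodTree M) (hN : IsGoodTree N)
    {g : AddE ι → M →. M} {g' : AddE ι → N →. N}
    (hMm : @Theory.Model _ M (treeStructure g) (sigma' (theoryOf f) (orderTheoryOf T₀)))
    (hNm : @Theory.Model _ N (treeStructure g') (sigma' (theoryOf f) (orderTheoryOf T₀)))
    (hMs : @IsSaturated _ M (treeStructure g)) (hNs : @IsSaturated _ N (treeStructure g')) :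
    @ElementarilyEquivalent (treeLang (AddE ι)) M N (treeStructure g) (treeStructure g') := by
  obtain ⟨Q, _, h, π, hQ, hQT, hπ, hd⟩ := exists_decomp hT hT₀ hM hMm
  obtain ⟨Q', _, h', π', hQ', hQT', hπ', hd'⟩ := exists_decomp hT hT₀ hN hNm
  let _ := treeStructure h
  let _ := treeStructure h'
  let _ := treeStructure g
  let _ := treeStructure g'
  have hbf := isBackForth_sameType (hπ.isSaturated hMs) (hπ'.isSaturated hNs)
  obtain ⟨R, hR, hRle, hRfn, hR0, -⟩ := hd.exists_isBackForth hT₀ hd' hbf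
    (fun s hs p hp q hq => hs.preservesAtoms.le_iff hp hq)
    fun s hs i p hp q hq => hs.preservesAtoms.mem_iff i hp hq
  exact hR.elementarilyEquivalent (hR.preservesAtoms_tree hRle hM hN hRfn)
    (hR0 (sameType_empty (Eq.trans hQT (Eq.symm hQT'))))

theorem elementarilyEquivalent_of_model [Countable ι] {M N : Type u}
    [str : (treeLang (AddE ι)).Structure M] [str' : (treeLang (AddE ι)).Structure N] [Nonempty M]
    [Nonempty N] (hM : M ⊨ sigma' (theoryOf f) (orderTheoryOf T₀))
    (hN : N ⊨ sigma' (theoryOf f) (orderTheoryOf T₀)) : M ≅[treeLang (AddE ι)] N := by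
  obtain ⟨_, g, hMg, rfl⟩ := exists_tree_of_model hM
  obtain ⟨_, g', hNg, rfl⟩ := exists_tree_of_model hN
  obtain ⟨M', _, h, j, hM', hs⟩ := exists_isSaturated_tree hMg g
  obtain ⟨N', _, h', j', hN', hs'⟩ := exists_isSaturated_tree hNg g'
  have hj := elementarilyEquivalent_of_withPred (@ElementaryEmbedding.elementarilyEquivalent _ _ _
    (treeStructure (withPred g)) (treeStructure (withPred h)) j)
  have hj' := elementarilyEquivalent_of_withPred (@ElementaryEmbedding.elementarilyEquivalent _ _ _
    (treeStructure (withPred g')) (treeStructure (withPred h')) j')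
  have : Nonempty M' := ‹Nonempty M›.map (@ElementaryEmbedding.toFun _ _ _
    (treeStructure (withPred g)) (treeStructure (withPred h)) j)
  have : Nonempty N' := ‹Nonempty N›.map (@ElementaryEmbedding.toFun _ _ _
    (treeStructure (withPred g')) (treeStructure (withPred h')) j')
  refine Eq.trans hj (Eq.trans (elementarilyEquivalent_of_isSaturated (f := f) hT hT₀ hM' hN' ?_ ?_
    (isSaturated_of_withPred hs) (isSaturated_of_withPred hs')) (Eq.symm hj'))
  · exact (@ElementarilyEquivalent.theory_model_iff _ M M' (treeStructure g) (treeStructure h) _ hj).1 hM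
  · exact (@ElementarilyEquivalent.theory_model_iff _ N N' (treeStructure g') (treeStructure h') _ hj').1 hN

theorem isComplete_sigma' [Countable ι]
    (hsat : (sigma' (theoryOf f) (orderTheoryOf T₀)).IsSatisfiable) :
    (sigma' (theoryOf f) (orderTheoryOf T₀)).IsComplete := by
  rw [Theory.IsComplete.isComplete_iff_models_elementarily_equivalent]
  exact ⟨hsat, fun M N => elementarilyEquivalent_of_model hT hT₀ M.is_model N.is_model⟩

omit hT hT₀

/-- The finite subsets of the graph of an isomorphism form a back-and-forth system. -/
theorem exists_isBackForth_of_equiv {Q Q' : Type u} [SemilatticeInf Q] [SemilatticeInf Q']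
    {h : ι → Q →. Q} {h' : ι → Q' →. Q'}
    (F : @Language.Equiv (treeLang ι) Q Q' (treeStructure h) (treeStructure h')) :
    ∃ S : Set (Q × Q') → Prop, IsBackForth S ∧ S ∅ ∧
      ∀ s, S s → @PreservesAtoms _ _ (treeLang ι) (treeStructure h) (treeStructure h') s := by
  let _ := treeStructure h
  let _ := treeStructure h'
  refine ⟨fun s => ∀ p ∈ s, F p.1 = p.2, ⟨fun s hs a => ⟨F a, ?_⟩, fun s hs b => ⟨F.symm b, ?_⟩⟩,
    by simp, fun s hs => ⟨fun p hp q hq => ?_, fun R x hx => ?_, fun G x hx p hp => ?_⟩⟩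
  · rintro p (rfl | hp)
    exacts [rfl, hs p hp]
  · rintro p (rfl | hp)
    exacts [F.apply_symm_apply b, hs p hp]
  · rw [← hs p hp, ← hs q hq]
    exact F.injective.eq_iff.symm
  · rw [show (fun i => (x i).2) = F ∘ fun i => (x i).1 from funext fun i => (hs _ (hx i)).symm]
    exact (F.map_rel R _).symm
  · rw [show (fun i => (x i).2) = F ∘ fun i => (x i).1 from funext fun i => (hs _ (hx i)).symm,
      ← hs p hp, ← F.map_fun]
    exact F.injective.eq_iff.symm

include hT hT₀

theorem nonempty_equiv_of_model (hcat : (Cardinal.aleph0.{0}).Categorical (theoryOf f))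
    {M N : Type} [str : (treeLang (AddE ι)).Structure M] [str' : (treeLang (AddE ι)).Structure N]
    [Nonempty M] [Nonempty N] [Countable M] [Countable N]
    (hMm : M ⊨ sigma' (theoryOf f) (orderTheoryOf T₀))
    (hNm : N ⊨ sigma' (theoryOf f) (orderTheoryOf T₀)) : Nonempty (M ≃[treeLang (AddE ι)] N) := by
  obtain ⟨_, g, hM, rfl⟩ := exists_tree_of_model hMm
  obtain ⟨_, g', hN, rfl⟩ := exists_tree_of_model hNm
  obtain ⟨Q, _, h, π, hQ, hQT, hπ, hd⟩ := exists_decomp hT hT₀ hM hMm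
  obtain ⟨Q', _, h', π', hQ', hQT', hπ', hd'⟩ := exists_decomp hT hT₀ hN hNm
  have := hd.nonempty
  have := hd'.nonempty
  have : Countable Q := hd.surjective.countable
  have : Countable Q' := hd'.surjective.countable
  let _ := treeStructure h
  let _ := treeStructure h'
  have hQQ' : Q ≅[treeLang ι] Q' := Eq.trans hQT (Eq.symm hQT')
  obtain ⟨S, hS, hS0, hSa⟩ : ∃ S : Set (Q × Q') → Prop, IsBackForth S ∧ S ∅ ∧
      ∀ s, S s → PreservesAtoms (treeLang ι) s := by
    -- Categoricity says nothing about finite quotients, but these are saturated.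
    rcases finite_or_infinite Q with hfin | hinf
    · have : Finite Q' := by
        by_contra hcon
        rw [not_finite_iff_infinite, ← hQQ'.infinite_iff] at hcon
        exact not_finite Q
      exact ⟨_, isBackForth_sameType (isSaturated_of_finite _ _) (isSaturated_of_finite _ _),
        sameType_empty hQQ', fun s hs => hs.preservesAtoms⟩
    · have := hQQ'.infinite_iff.1 hinf
      let _ := treeStructure f
      have h1 : Q ⊨ theoryOf f :=
        (ElementarilyEquivalent.theory_model_iff hQT).2 (model_completeTheory T)
      have h2 : Q' ⊨ theoryOf f :=
        (ElementarilyEquivalent.theory_model_iff hQT').2 (model_completeTheory T)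
      obtain ⟨F⟩ := hcat (Theory.ModelType.of (theoryOf f) Q) (Theory.ModelType.of (theoryOf f) Q')
        (Cardinal.mk_eq_aleph0 Q) (Cardinal.mk_eq_aleph0 Q')
      exact exists_isBackForth_of_equiv F
  obtain ⟨R, hR, hRle, hRfn, hR0, -⟩ := hd.exists_isBackForth hT₀ hd' hS
    (fun s hs p hp q hq => (hSa s hs).le_iff hp hq)
    fun s hs i p hp q hq => (hSa s hs).mem_iff i hp hq
  let _ := treeStructure g
  let _ := treeStructure g'
  exact hR.nonempty_equiv (hR.preservesAtoms_tree hRle hM hN hRfn) (hR0 hS0)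

theorem categorical_sigma' (hcat : (Cardinal.aleph0.{0}).Categorical (theoryOf f)) :
    (Cardinal.aleph0.{0}).Categorical (sigma' (theoryOf f) (orderTheoryOf T₀)) := by
  intro M N hM hN
  have : Countable M := Cardinal.mk_le_aleph0_iff.1 hM.le
  have : Countable N := Cardinal.mk_le_aleph0_iff.1 hN.le
  exact nonempty_equiv_of_model hT hT₀ hcat M.is_model N.is_model

omit hT hT₀

theorem EliminatesQuantifiers.realize_iff {L : FirstOrder.Language.{0, 0}} {S : L.Theory}
    (hS : EliminatesQuantifiers S) {M N : Type} [L.Structure M] [L.Structure N] [Nonempty M]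
    [Nonempty N] (hM : M ⊨ S) (hN : N ⊨ S) {r : Set (M × N)} (hr : IsClosedPartialIso L r) {n : ℕ}
    (φ : L.Formula (Fin n)) (x : Fin n → M × N) (hx : ∀ i, x i ∈ r) :
    φ.Realize (fun i => (x i).1) ↔ φ.Realize fun i => (x i).2 := by
  obtain ⟨ψ, hψ, hφψ⟩ := hS n φ
  have h1 := BoundedFormula.realize_iff.1
    (hφψ (Theory.ModelType.of S M) (fun i => (x i).1) default)
  have h2 := BoundedFormula.realize_iff.1
    (hφψ (Theory.ModelType.of S N) (fun i => (x i).2) default)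
  exact h1.trans ((hr.realize_iff hψ x hx).trans h2.symm)

theorem realize_withPred_iff {M : Type u} [SemilatticeInf M] {κ : Type} (g : κ → M →. M) {n : ℕ}
    (φ : (treeLang κ).Formula (Fin n)) (x : Fin n → M) :
    @Formula.Realize _ M (treeStructure (withPred g)) _ ((treeMap AddP.old).onFormula φ) x ↔
      @Formula.Realize _ M (treeStructure g) _ φ x := by
  let _ := treeStructure (withPred g)
  rw [realize_onFormula_iff, reduct_withPred]

theorem model_withPred_iff {M : Type u} [SemilatticeInf M] {κ : Type} (g : κ → M →. M)
    (S : (treeLang κ).Theory) :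
    @Theory.Model _ M (treeStructure (withPred g)) ((treeMap AddP.old).onTheory S) ↔
      @Theory.Model _ M (treeStructure g) S := by
  let _ := treeStructure (withPred g)
  rw [model_onTheory_iff, reduct_withPred]

theorem exists_tree_of_model_addPred {S : (treeLang ι).Theory} {S₀ : Language.order.Theory}
    {M : Type u} [str : (treeLang (AddP (AddE ι))).Structure M]
    (hM : M ⊨ addPred (sigma' S S₀)) :
    ∃ (_ : SemilatticeInf M) (g : AddE ι → M →. M), IsGoodTree M ∧
      str = treeStructure (withPred g) ∧
      @Theory.Model _ M (treeStructure g) (sigma' S S₀) := by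
  have h1 : M ⊨ (treeMap AddP.old).onTheory (sigma' S S₀) := hM.mono Set.subset_union_left
  have h2 : M ⊨ predAxioms (AddE ι) := hM.mono Set.subset_union_right
  obtain ⟨sl, g, hg, hred⟩ := @exists_tree_of_model _ _ _ M ((treeMap AddP.old).reduct M)
    ((model_onTheory_iff _ _).1 h1)
  obtain rfl := eq_treeStructure_withPred hg g hred h2
  exact ⟨sl, g, hg, rfl, (model_withPred_iff g _).1 h1⟩

include hT hT₀

/-- The values of common terms form a closed relation whose projection is closed too. Elimination
for `T` upgrades the projection to equality of types, so the glued system contains the given tuples.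
-/
theorem realize_iff_of_isSaturated [Countable ι] [Nonempty T]
    (hqe : EliminatesQuantifiers (theoryOf (withPred f))) {M N : Type}
    [SemilatticeInf M] [SemilatticeInf N] [Nonempty M] [Nonempty N] (hM : IsGoodTree M)
    (hN : IsGoodTree N) {g : AddE ι → M →. M} {g' : AddE ι → N →. N}
    (hMm : @Theory.Model _ M (treeStructure g) (sigma' (theoryOf f) (orderTheoryOf T₀)))
    (hNm : @Theory.Model _ N (treeStructure g') (sigma' (theoryOf f) (orderTheoryOf T₀)))
    (hMs : @IsSaturated _ M (treeStructure g)) (hNs : @IsSaturated _ N (treeStructure g'))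
    {n : ℕ} (a : Fin n → M) (b : Fin n → N)
    (hab : ∀ ψ : (treeLang (AddP (AddE ι))).Formula (Fin n), BoundedFormula.IsQF ψ →
      (@Formula.Realize _ M (treeStructure (withPred g)) _ ψ a ↔
        @Formula.Realize _ N (treeStructure (withPred g')) _ ψ b))
    (φ : (treeLang (AddP (AddE ι))).Formula (Fin n)) :
    @Formula.Realize _ M (treeStructure (withPred g)) _ φ a ↔
      @Formula.Realize _ N (treeStructure (withPred g')) _ φ b := by
  obtain ⟨Q, _, h, π, hQ, hQT, hπ, hd⟩ := exists_decomp hT hT₀ hM hMm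
  obtain ⟨Q', _, h', π', hQ', hQT', hπ', hd'⟩ := exists_decomp hT hT₀ hN hNm
  have := hd.nonempty
  have := hd'.nonempty
  have hr := @isClosedPartialIso_of_qf _ _ _ (treeStructure (withPred g))
    (treeStructure (withPred g')) n a b hab
  rw [isClosedPartialIso_iff hM hN] at hr
  set r := {p : M × N | ∃ t : (treeLang (AddP (AddE ι))).Term (Fin n),
    p = (@Term.realize _ _ (treeStructure (withPred g)) _ a t,
      @Term.realize _ _ (treeStructure (withPred g')) _ b t)} with hrdef
  have hmem : ∀ i, (a i, b i) ∈ r := fun i => ⟨.var i, rfl⟩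
  have hmap := (isClosedPartialIso_iff hQ hQ').2 (hd.isTreeClosed_map hM hN hQ hQ' hd' hr)
  have hQp := elementarilyEquivalent_withPred hQ hT hQT
  have hQp' := elementarilyEquivalent_withPred hQ' hT hQT'
  have hTm := @model_completeTheory (treeLang (AddP ι)) T (treeStructure (withPred f))
  -- Elimination is available in the language with `p`; its conclusion is needed only for formulas
  -- without `p`, since the system between the quotients lives in `ℒ`.
  have hreal : ∀ ψ : (treeLang ι).Formula (Fin n),
      @Formula.Realize _ _ (treeStructure h) _ ψ (fun i => π (a i)) ↔
        @Formula.Realize _ _ (treeStructure h') _ ψ fun i => π' (b i) := by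
    intro ψ
    rw [← realize_withPred_iff h, ← realize_withPred_iff h']
    exact @EliminatesQuantifiers.realize_iff _ _ hqe _ _ (treeStructure (withPred h))
      (treeStructure (withPred h')) _ _
      ((@ElementarilyEquivalent.theory_model_iff _ _ _ (treeStructure (withPred h))
        (treeStructure (withPred f)) _ hQp).2 hTm)
      ((@ElementarilyEquivalent.theory_model_iff _ _ _ (treeStructure (withPred h'))
        (treeStructure (withPred f)) _ hQp').2 hTm)
      _ hmap _ _ (fun i => (π (a i), π' (b i))) fun i => ⟨_, hmem i, rfl⟩
  let _ := treeStructure h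
  let _ := treeStructure h'
  have hbf := isBackForth_sameType (hπ.isSaturated hMs) (hπ'.isSaturated hNs)
  obtain ⟨R, hR, hRle, hRfn, -, hRr⟩ := hd.exists_isBackForth hT₀ hd' hbf
    (fun s hs p hp q hq => hs.preservesAtoms.le_iff hp hq)
    fun s hs i p hp q hq => hs.preservesAtoms.mem_iff i hp hq
  -- The relation `r` may be infinite; only its finite part given by the tuples enters the system.
  have hRab : R (Set.range fun i => (a i, b i)) := by
    refine hRr r _ (hr.isExtIso hM hN) ?_ (Set.finite_range _) ?_
    · rintro _ ⟨i, rfl⟩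
      exact hmem i
    · rw [← Set.range_comp]
      exact sameType_of_tuple _ _ hreal
  exact @IsBackForth.realize_formula_iff _ _ _ (treeStructure (withPred g))
    (treeStructure (withPred g')) _ hR (hR.preservesAtoms_withPred hRle hM hN hRfn) _ φ a b hRab

theorem realize_iff_of_model [Countable ι] [Nonempty T]
    (hqe : EliminatesQuantifiers (theoryOf (withPred f))) {M N : Type}
    [str : (treeLang (AddP (AddE ι))).Structure M] [str' : (treeLang (AddP (AddE ι))).Structure N]
    [hMn : Nonempty M] [hNn : Nonempty N]
    (hMm : M ⊨ addPred (sigma' (theoryOf f) (orderTheoryOf T₀)))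
    (hNm : N ⊨ addPred (sigma' (theoryOf f) (orderTheoryOf T₀)))
    {n : ℕ} (a : Fin n → M) (b : Fin n → N)
    (hab : ∀ ψ : (treeLang (AddP (AddE ι))).Formula (Fin n), BoundedFormula.IsQF ψ →
      (ψ.Realize a ↔ ψ.Realize b))
    (φ : (treeLang (AddP (AddE ι))).Formula (Fin n)) : φ.Realize a ↔ φ.Realize b := by
  obtain ⟨_, g, hMg, rfl, hMm'⟩ := exists_tree_of_model_addPred hMm
  obtain ⟨_, g', hNg, rfl, hNm'⟩ := exists_tree_of_model_addPred hNm
  obtain ⟨M', _, h, j, hM', hs⟩ := exists_isSaturated_tree hMg g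
  obtain ⟨N', _, h', j', hN', hs'⟩ := exists_isSaturated_tree hNg g'
  let _ := treeStructure (withPred g)
  let _ := treeStructure (withPred g')
  let _ := treeStructure (withPred h)
  let _ := treeStructure (withPred h')
  have : Nonempty M' := hMn.map j
  have : Nonempty N' := hNn.map j'
  have hj := elementarilyEquivalent_of_withPred j.elementarilyEquivalent
  have hj' := elementarilyEquivalent_of_withPred j'.elementarilyEquivalent
  have hM'm := (@ElementarilyEquivalent.theory_model_iff _ M M' (treeStructure g) (treeStructure h)
    (sigma' (theoryOf f) (orderTheoryOf T₀)) hj).1 hMm'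
  have hN'm := (@ElementarilyEquivalent.theory_model_iff _ N N' (treeStructure g') (treeStructure h')
    (sigma' (theoryOf f) (orderTheoryOf T₀)) hj').1 hNm'
  have key := realize_iff_of_isSaturated hT hT₀ hqe hM' hN' hM'm hN'm (isSaturated_of_withPred hs)
    (isSaturated_of_withPred hs') (j ∘ a) (j' ∘ b) (fun ψ hψ => by
      rw [j.map_formula, j'.map_formula]
      exact hab ψ hψ) φ
  rw [j.map_formula, j'.map_formula] at key
  exact key

theorem eliminatesQuantifiers_sigma' [Countable ι] [Nonempty T]
    (hqe : EliminatesQuantifiers (theoryOf (withPred f))) :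
    EliminatesQuantifiers (addPred (sigma' (theoryOf f) (orderTheoryOf T₀))) :=
  eliminatesQuantifiers_of_qf _ fun M N _ a b hab φ =>
    (realize_iff_of_model hT hT₀ hqe M.is_model N.is_model a b hab φ).1

end Main

/-! ## The extension is a model -/

section OfGraph

theorem mem_ofGraph {A : Type u} {B : Type v} {R : A → B → Prop} {a : A}
    (h : ∀ b b', R a b → R a b' → b = b') {b : B} : b ∈ ofGraph R a ↔ R a b := by
  constructor
  · rintro ⟨hd, rfl⟩
    exact hd.choose_spec
  · intro hb
    exact ⟨⟨b, hb⟩, h _ _ (Exists.choose_spec (⟨b, hb⟩ : ∃ b, R a b)) hb⟩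

end OfGraph

section OrderIso

theorem orderTheoryOf_eq_of_orderIso {X : Type u} {Y : Type v} [LE X] [LE Y] (F : X ≃o Y) :
    orderTheoryOf X = orderTheoryOf Y := by
  let _ := orderStructure X
  let _ := orderStructure Y
  let F' : X ≃[Language.order] Y :=
    { toEquiv := F.toEquiv
      map_fun' := fun f _ => Empty.elim f
      map_rel' := fun R x => by
        cases R
        exact F.le_iff_le }
  exact F'.toElementaryEmbedding.elementarilyEquivalent

end OrderIso

namespace Ext

variable {T : Type u} {T₀ : Type v} [SemilatticeInf T] [SemilatticeInf T₀]

theorem not_copy_le_node {x α : T} {hx : ¬ IsMax x} {hα : IsMax α} {t : T₀} :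
    ¬ (copy α hα t : Ext T T₀) ≤ node x hx := id

theorem copy_inf_copy {α : T} {hα : IsMax α} (t s : T₀) :
    (copy α hα t : Ext T T₀) ⊓ copy α hα s = copy α hα (t ⊓ s) := dif_pos rfl

theorem copy_inf_copy_of_ne {α β : T} {hα : IsMax α} {hβ : IsMax β} (t s : T₀) (h : α ≠ β) :
    (copy α hα t : Ext T T₀) ⊓ copy β hβ s = node (α ⊓ β) (not_isMax_inf_of_ne h) := dif_neg h

theorem base_mono {a b : Ext T T₀} (h : a ≤ b) : a.base ≤ b.base := by
  cases a <;> cases b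
  · exact h
  · exact h
  · exact h.elim
  · exact h.1.le

theorem base_inf (a b : Ext T T₀) : (a ⊓ b).base = a.base ⊓ b.base := by
  cases a with
  | node x hx => cases b <;> rfl
  | copy α hα t =>
    cases b with
    | node y hy => exact inf_comm y α
    | copy β hβ s =>
      by_cases h : α = β
      · subst h
        rw [copy_inf_copy]
        exact (inf_idem α).symm
      · rw [copy_inf_copy_of_ne t s h]
        rfl

omit [SemilatticeInf T₀] in
theorem eq_of_base_eq {a b : Ext T T₀} (ha : ¬ IsMax a.base) (h : a.base = b.base) : a = b := by
  cases a with
  | copy α hα t => exact absurd hα ha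
  | node x hx =>
    cases b with
    | copy β hβ s =>
      change x = β at h
      exact absurd (h ▸ hβ) hx
    | node y hy =>
      change x = y at h
      subst h
      rfl

omit [SemilatticeInf T₀] in
theorem eq_node {a : Ext T T₀} (ha : ¬ IsMax a.base) : a = node a.base ha := eq_of_base_eq ha rfl

omit [SemilatticeInf T₀] in
theorem exists_eq_copy {a : Ext T T₀} (ha : IsMax a.base) : ∃ t, a = copy a.base ha t := by
  cases a with
  | copy α hα t => exact ⟨t, rfl⟩
  | node x hx => exact absurd ha hx

theorem base_le_base_iff (a b : Ext T T₀) : a.base ≤ b.base ↔ a ≤ b ∨ a.base = b.base := by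
  refine ⟨fun h => ?_, fun h => h.elim base_mono le_of_eq⟩
  by_cases ha : IsMax a.base
  · exact Or.inr (ha.eq_of_le h)
  · left
    rw [eq_node ha]
    cases b <;> exact h

omit [SemilatticeInf T₀] in
theorem base_surjective [Nonempty T₀] : Function.Surjective (base : Ext T T₀ → T) := by
  intro x
  by_cases hx : IsMax x
  · exact ⟨copy x hx (Classical.arbitrary T₀), rfl⟩
  · exact ⟨node x hx, rfl⟩

theorem isMax_copy {α : T} {hα : IsMax α} {t : T₀} :
    IsMax (copy α hα t : Ext T T₀) ↔ IsMax t := by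
  constructor
  · intro h s hs
    exact (h (show (copy α hα t : Ext T T₀) ≤ copy α hα s from ⟨rfl, hs⟩)).2
  · rintro h (⟨y, hy⟩ | ⟨β, hβ, s⟩) hle
    · exact hle.elim
    · obtain ⟨rfl, hts⟩ := hle
      exact ⟨rfl, h hts⟩

theorem copy_covBy_copy {α : T} {hα : IsMax α} {s t : T₀} (h : s ⋖ t) :
    (copy α hα s : Ext T T₀) ⋖ copy α hα t := by
  refine ⟨⟨⟨rfl, h.le⟩, fun h' => h.lt.not_ge h'.2⟩, ?_⟩
  rintro (⟨y, hy⟩ | ⟨β, hβ, r⟩) h1 h2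
  · exact h1.le.elim
  · obtain ⟨rfl, h3⟩ := h1.le
    exact h.2 (h3.lt_of_not_ge fun h4 => h1.not_ge ⟨rfl, h4⟩)
      (h2.le.2.lt_of_not_ge fun h4 => h2.not_ge ⟨rfl, h4⟩)

theorem isGoodTree (hT : IsGoodTree T) (hT₀ : IsGoodTree T₀) [Nonempty T₀] :
    IsGoodTree (Ext T T₀) where
  chain_below a b c hb hc := by
    rcases hT.chain_below _ _ _ (base_mono hb) (base_mono hc) with h | h
    · rcases (base_le_base_iff b c).1 h with h | h
      · exact Or.inl h
      · by_cases hm : IsMax b.base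
        · obtain ⟨t, ht⟩ := exists_eq_copy hm
          obtain ⟨s, hs⟩ := exists_eq_copy (h ▸ hm : IsMax c.base)
          obtain ⟨r, hr⟩ := exists_eq_copy (hm.mono (base_mono hb))
          rw [ht, hr] at hb
          rw [hs, hr] at hc
          rw [ht, hs]
          exact (hT₀.chain_below r t s hb.2 hc.2).imp (fun h' => ⟨h, h'⟩) fun h' => ⟨h.symm, h'⟩
        · exact Or.inl (eq_of_base_eq hm h).le
    · rcases (base_le_base_iff c b).1 h with h | h
      · exact Or.inr h
      · by_cases hm : IsMax b.base
        · obtain ⟨t, ht⟩ := exists_eq_copy hm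
          obtain ⟨s, hs⟩ := exists_eq_copy (h ▸ hm : IsMax c.base)
          obtain ⟨r, hr⟩ := exists_eq_copy (hm.mono (base_mono hb))
          rw [ht, hr] at hb
          rw [hs, hr] at hc
          rw [ht, hs]
          exact (hT₀.chain_below r t s hb.2 hc.2).imp (fun h' => ⟨h.symm, h'⟩) fun h' => ⟨h, h'⟩
        · exact Or.inl (eq_of_base_eq hm h.symm).le
  leaf_above a := by
    cases a with
    | node x hx =>
      obtain ⟨α, hxα, hα⟩ := hT.leaf_above x
      obtain ⟨t, -, ht⟩ := hT₀.leaf_above (Classical.arbitrary T₀)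
      exact ⟨copy α hα t, hxα, isMax_copy.2 ht⟩
    | copy α hα t =>
      obtain ⟨s, hts, hs⟩ := hT₀.leaf_above t
      exact ⟨copy α hα s, ⟨rfl, hts⟩, isMax_copy.2 hs⟩
  leaf_or_node a := by
    cases a with
    | node x hx =>
      right
      obtain ⟨y, z, hyz, rfl⟩ := (hT.leaf_or_node x).resolve_left hx
      obtain ⟨b, rfl⟩ := base_surjective (T₀ := T₀) y
      obtain ⟨c, rfl⟩ := base_surjective (T₀ := T₀) z
      exact ⟨b, c, fun h => hyz (h ▸ rfl), eq_of_base_eq hx (base_inf b c).symm⟩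
    | copy α hα t =>
      rcases hT₀.leaf_or_node t with ht | ⟨y, z, hyz, rfl⟩
      · exact Or.inl (isMax_copy.2 ht)
      · refine Or.inr ⟨copy α hα y, copy α hα z, fun h => hyz ?_, (copy_inf_copy y z).symm⟩
        simpa using h

/-- If `T₀` has a root, the predecessors of leaves are the roots of the copies, which are pairwise
incomparable. If not, either no leaf of a copy has a predecessor, or some predecessors of leaves are
comparable. -/
theorem rooted_iff (hT : IsGoodTree T) [Nonempty T] (hT₀ : IsOneColored T₀) :
    Rooted (Ext T T₀) ↔ HasRoot T₀ := by
  have hne : Nonempty T₀ := hT₀.nontrivial.to_nonempty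
  obtain ⟨α, -, hα⟩ := hT.leaf_above (Classical.arbitrary T)
  have hG := isGoodTree hT hT₀.good
  constructor
  · intro hr
    by_contra h₀
    obtain ⟨iso, μ, m, hd, hm, hu⟩ := hT₀.isDenseTree h₀
    obtain ⟨t, -, ht⟩ := hd.leaf_above (Classical.arbitrary T₀)
    by_cases hi : iso
    · obtain ⟨q, hq⟩ := hd.pred hi t ht
      obtain ⟨z, hz⟩ := hd.no_bot q
      -- By `1 ≤ m` every node is the predecessor of a leaf, in particular `z`, below the
      -- predecessor `q` of `t`.
      have hne : {α : T₀ | IsMax α ∧ z ⋖ α}.Nonempty := by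
        rw [← Set.encard_pos, (hu z hz.not_isMax).2]
        exact zero_lt_one.trans_le (hm hi)
      obtain ⟨s, hs, hzs⟩ := hne
      exact hr.2 _ _ _ _ (isMax_copy (hα := hα).2 hs) (isMax_copy (hα := hα).2 ht)
        (copy_covBy_copy hzs) (copy_covBy_copy hq) ⟨⟨rfl, hz.le⟩, fun h => hz.not_ge h.2⟩
    · obtain ⟨c, hc⟩ := hr.1 _ (isMax_copy (hα := hα).2 ht)
      obtain ⟨s, hs⟩ := hd.no_bot t
      have hsc : (copy α hα s : Ext T T₀) ≤ c := by
        by_contra hcon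
        exact hc.2 (lt_of_chain hG.chain_below (show (copy α hα s : Ext T T₀) ≤ copy α hα t from
          ⟨rfl, hs.le⟩) hc.le hcon)
          ⟨⟨rfl, hs.le⟩, fun h => hs.not_ge h.2⟩
      rcases c with ⟨y, hy⟩ | ⟨β, hβ, r⟩
      · exact hsc
      · obtain ⟨rfl, -⟩ := hsc
        have hrt : r < t := hc.le.2.lt_of_not_ge fun h => hc.lt.not_ge ⟨rfl, h⟩
        obtain ⟨z, hz, hz'⟩ := hd.dense_leaf hi r t hrt ht
        exact hc.2 (c := copy α hα z) ⟨⟨rfl, hz.le⟩, fun h => hz.not_ge h.2⟩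
          ⟨⟨rfl, hz'.le⟩, fun h => hz'.not_ge h.2⟩
  · intro h₀
    have hh := hT₀.height h₀
    obtain ⟨r, hr⟩ := h₀
    have hnt := hT₀.nontrivial
    have hcov : ∀ t : T₀, IsMax t → r ⋖ t := by
      intro t ht
      refine ⟨(hr t).lt_of_ne ?_, fun c h1 h2 => hh _ _ _ h1 h2⟩
      rintro rfl
      obtain ⟨x, hx⟩ := exists_ne r
      exact hx (ht.eq_of_le (hr x)).symm
    have key : ∀ a : Ext T T₀, IsMax a → ∃ β hβ, (copy β hβ r : Ext T T₀) ⋖ a := by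
      rintro (⟨y, hy⟩ | ⟨β, hβ, t⟩) ha
      · obtain ⟨γ, hyγ, hγ⟩ := hT.leaf_above y
        exact absurd (ha (show (node y hy : Ext T T₀) ≤ copy γ hγ r from hyγ)) not_copy_le_node
      · exact ⟨β, hβ, copy_covBy_copy (hcov t (isMax_copy.1 ha))⟩
    refine ⟨fun a ha => ?_, fun a b q q' ha hb hq hq' hlt => ?_⟩
    · obtain ⟨β, hβ, h⟩ := key a ha
      exact ⟨_, h⟩
    · obtain ⟨β, hβ, h⟩ := key a ha
      obtain ⟨γ, hγ, h'⟩ := key b hb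
      obtain rfl := covBy_unique hG h hq
      obtain rfl := covBy_unique hG h' hq'
      obtain ⟨rfl, -⟩ := hlt.le
      exact lt_irrefl _ hlt

end Ext

/-! ### The axioms of `Σ'` in `T ⋊ T₀`. -/

section ExtModel

namespace Ext

variable {T : Type u} {T₀ : Type v} [SemilatticeInf T] [SemilatticeInf T₀]

theorem base_lt_base {a b : Ext T T₀} (ha : ¬ IsMax a.base) : a.base < b.base ↔ a < b := by
  constructor
  · intro h
    refine lt_of_le_of_ne (((base_le_base_iff a b).1 h.le).resolve_right h.ne) ?_
    rintro rfl
    exact lt_irrefl _ h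
  · intro h
    exact (base_mono h.le).lt_of_ne fun h' => h.ne (eq_of_base_eq ha h')

theorem isMax_base [Nonempty T₀] {a : Ext T T₀} (ha : IsMax a) : IsMax a.base := by
  by_contra h
  obtain ⟨c, hc⟩ := not_isMax_iff.1 h
  obtain ⟨b, rfl⟩ := base_surjective (T₀ := T₀) c
  exact ha.not_lt ((base_lt_base h).1 hc)

end Ext

open Ext

variable {T : Type u} {T₀ : Type v} [SemilatticeInf T] [SemilatticeInf T₀] {ι : Type}
  {f : ι → T →. T}

theorem Compatible.isolated (hc : Compatible T T₀) (h₀ : ¬ HasRoot T₀) (α : T) (hα : IsMax α) :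
    Isolated α := by_contra fun h => h₀ (hc.star₂ ⟨α, hα, h⟩)

theorem not_isMax_of_mem_predLeaves {x : T} (hx : x ∈ predLeaves T) : ¬ IsMax x := by
  obtain ⟨α, -, h⟩ := hx
  exact h.lt.not_isMax

theorem le_of_covBy (hT : IsGoodTree T) {x q α : T} (hq : q ⋖ α) (hx : x < α) : x ≤ q := by
  by_contra h
  exact hq.2 (lt_of_chain hT.chain_below hx.le hq.le h) hx

theorem eGraph_unique (hT : IsGoodTree T) (a b b' : Ext T T₀) (h : eGraph a b)
    (h' : eGraph a b') : b = b' := by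
  cases a with
  | node x hx => exact h.2.2.trans h'.2.2.symm
  | copy α hα t =>
    rcases h with ⟨r, hr, rfl⟩ | ⟨h₀, q, hq, hqα, rfl⟩ <;>
      rcases h' with ⟨r', hr', rfl⟩ | ⟨h₀', q', hq', hqα', rfl⟩
    · rw [(hr r').antisymm (hr' r)]
    · exact absurd ⟨r, hr⟩ h₀'
    · exact absurd ⟨r', hr'⟩ h₀
    · obtain rfl := covBy_unique hT hqα hqα'
      rfl

theorem mem_ext_e (hT : IsGoodTree T) {a b : Ext T T₀} : b ∈ extFun f .e a ↔ eGraph a b :=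
  mem_ofGraph (eGraph_unique hT a)

theorem mem_ext_e_of_isBot (hT : IsGoodTree T) {r : T₀} (hr : IsBot r) {a b : Ext T T₀} :
    b ∈ extFun f .e a ↔ ∃ h : IsMax a.base, b = copy a.base h r := by
  rw [mem_ext_e hT]
  cases a with
  | node x hx => exact ⟨fun h => absurd ⟨r, hr⟩ h.1, fun ⟨h, _⟩ => absurd h hx⟩
  | copy α hα t =>
    constructor
    · rintro (⟨r', hr', rfl⟩ | ⟨h₀, -⟩)
      · exact ⟨hα, by rw [(hr r').antisymm (hr' r)]; rfl⟩
      · exact absurd ⟨r, hr⟩ h₀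
    · rintro ⟨h, rfl⟩
      exact Or.inl ⟨r, hr, rfl⟩

theorem mem_ext_e_of_not_hasRoot (hT : IsGoodTree T) (h₀ : ¬ HasRoot T₀) {a b : Ext T T₀} :
    b ∈ extFun f .e a ↔
      (IsMax a.base ∧ b.base ⋖ a.base) ∨ (a.base ∈ predLeaves T ∧ b = a) := by
  rw [mem_ext_e hT]
  cases a with
  | node x hx =>
    constructor
    · rintro ⟨-, h, rfl⟩
      exact Or.inr ⟨h, rfl⟩
    · rintro (⟨h, -⟩ | ⟨h, rfl⟩)
      · exact absurd h hx
      · exact ⟨h₀, h, rfl⟩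
  | copy α hα t =>
    constructor
    · rintro (⟨r', hr', -⟩ | ⟨-, q, hq, hqα, rfl⟩)
      · exact absurd ⟨r', hr'⟩ h₀
      · exact Or.inl ⟨hα, hqα⟩
    · rintro (⟨-, h⟩ | ⟨h, -⟩)
      · exact Or.inr ⟨h₀, b.base, h.lt.not_isMax, h, eq_node _⟩
      · exact absurd hα (not_isMax_of_mem_predLeaves h)

theorem ext_e_dom_of_isBot (hT : IsGoodTree T) {r : T₀} (hr : IsBot r) {a : Ext T T₀} :
    (extFun f .e a).Dom ↔ IsMax a.base := by
  simp [Part.dom_iff_mem, mem_ext_e_of_isBot hT hr]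

theorem mem_ext_e_ran_of_isBot (hT : IsGoodTree T) {r : T₀} (hr : IsBot r) {b : Ext T T₀} :
    b ∈ (extFun f .e).ran ↔ ∃ α hα, b = copy α hα r := by
  constructor
  · rintro ⟨a, ha⟩
    obtain ⟨h, rfl⟩ := (mem_ext_e_of_isBot hT hr).1 ha
    exact ⟨_, h, rfl⟩
  · rintro ⟨α, hα, rfl⟩
    exact ⟨copy α hα r, (mem_ext_e_of_isBot hT hr).2 ⟨hα, rfl⟩⟩

theorem mem_ext_e_ran_of_not_hasRoot (hT : IsGoodTree T) (h₀ : ¬ HasRoot T₀) {b : Ext T T₀} :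
    b ∈ (extFun f .e).ran ↔ b.base ∈ predLeaves T := by
  constructor
  · rintro ⟨a, ha⟩
    rcases (mem_ext_e_of_not_hasRoot hT h₀).1 ha with ⟨h, h'⟩ | ⟨h, rfl⟩
    · exact ⟨_, h, h'⟩
    · exact h
  · intro h
    exact ⟨b, (mem_ext_e_of_not_hasRoot hT h₀).2 (Or.inr ⟨h, rfl⟩)⟩

theorem ext_e_dom_of_not_hasRoot (hT : IsGoodTree T) (hc : Compatible T T₀) (h₀ : ¬ HasRoot T₀)
    [Nonempty T₀] {a : Ext T T₀} :
    (extFun f .e a).Dom ↔ IsMax a.base ∨ a.base ∈ predLeaves T := by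
  simp only [Part.dom_iff_mem, mem_ext_e_of_not_hasRoot hT h₀]
  constructor
  · rintro ⟨b, ⟨h, -⟩ | ⟨h, -⟩⟩
    exacts [Or.inl h, Or.inr h]
  · rintro (h | h)
    · obtain ⟨q, hq⟩ := hc.isolated h₀ _ h
      obtain ⟨b, rfl⟩ := base_surjective (T₀ := T₀) q
      exact ⟨b, Or.inl ⟨h, hq⟩⟩
    · exact ⟨a, Or.inr ⟨h, rfl⟩⟩

theorem total_ext_e_of_isBot (hT : IsGoodTree T) {r : T₀} (hr : IsBot r) {a : Ext T T₀}
    (h : IsMax a.base) : total (extFun f .e) a = copy a.base h r :=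
  total_of_mem ((mem_ext_e_of_isBot hT hr).2 ⟨h, rfl⟩)

theorem isESystem_ext_of_isBot (hT : IsGoodTree T) (hn : Nontrivial T₀) {r : T₀} (hr : IsBot r) :
    IsESystem (extFun f .e : Ext T T₀ →. Ext T T₀) where
  convex x y z hx hz hxy hyz := by
    obtain ⟨α, hα, rfl⟩ := (mem_ext_e_ran_of_isBot hT hr).1 hx
    obtain ⟨β, hβ, rfl⟩ := (mem_ext_e_ran_of_isBot hT hr).1 hz
    obtain ⟨rfl, -⟩ := (hxy.trans hyz).le
    exact absurd (hxy.trans hyz) (lt_irrefl _)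
  dom_iff x := by
    rw [ext_e_dom_of_isBot hT hr]
    constructor
    · intro h
      refine ⟨_, (mem_ext_e_ran_of_isBot hT hr).2 ⟨_, h, rfl⟩, ?_⟩
      obtain ⟨t, ht⟩ := exists_eq_copy h
      conv_rhs => rw [ht]
      exact ⟨rfl, hr t⟩
    · rintro ⟨y, hy, hyx⟩
      obtain ⟨α, hα, rfl⟩ := (mem_ext_e_ran_of_isBot hT hr).1 hy
      exact hα.mono (base_mono hyx)
  leaf_dom x hx := (ext_e_dom_of_isBot hT hr).2 (isMax_base hx)
  not_max x hx hm := by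
    obtain ⟨α, hα, rfl⟩ := (mem_ext_e_ran_of_isBot hT hr).1 hx
    obtain ⟨t, ht⟩ := exists_ne r
    exact ht ((isMax_copy.1 hm).eq_of_le (hr t)).symm
  mem x hx := by
    rw [total_ext_e_of_isBot hT hr ((ext_e_dom_of_isBot hT hr).1 hx)]
    exact (mem_ext_e_ran_of_isBot hT hr).2 ⟨_, _, rfl⟩
  le x hx := by
    have h := (ext_e_dom_of_isBot hT hr).1 hx
    rw [total_ext_e_of_isBot hT hr h]
    obtain ⟨t, ht⟩ := exists_eq_copy h
    conv_rhs => rw [ht]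
    exact ⟨rfl, hr t⟩
  greatest x hx y hy hyx := by
    obtain ⟨α, hα, rfl⟩ := (mem_ext_e_ran_of_isBot hT hr).1 hy
    rw [total_ext_e_of_isBot hT hr ((ext_e_dom_of_isBot hT hr).1 hx)]
    exact ⟨hα.eq_of_le (base_mono hyx), le_rfl⟩

theorem isESystem_ext_of_not_hasRoot (hT : IsGoodTree T) [Nonempty T₀] (hc : Compatible T T₀)
    (h₀ : ¬ HasRoot T₀) : IsESystem (extFun f .e : Ext T T₀ →. Ext T T₀) := by
  have hran : ∀ b : Ext T T₀, b ∈ (extFun f .e).ran ↔ b.base ∈ predLeaves T := fun b =>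
    mem_ext_e_ran_of_not_hasRoot hT h₀
  have hdom : ∀ a : Ext T T₀, (extFun f .e a).Dom ↔ IsMax a.base ∨ a.base ∈ predLeaves T :=
    fun a => ext_e_dom_of_not_hasRoot hT hc h₀
  have hmem : ∀ a : Ext T T₀, (extFun f .e a).Dom → total (extFun f .e) a ∈ extFun f .e a :=
    fun a ha => mem_iff_total.2 ⟨ha, rfl⟩
  have hle : ∀ a : Ext T T₀, (extFun f .e a).Dom → total (extFun f .e) a ≤ a := by
    intro a ha
    rcases (mem_ext_e_of_not_hasRoot hT h₀).1 (hmem a ha) with ⟨-, h⟩ | ⟨-, h⟩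
    · exact ((base_lt_base h.lt.not_isMax).1 h.lt).le
    · exact h.le
  refine ⟨?_, ?_, ?_, ?_, fun a ha => ⟨a, hmem a ha⟩, hle, ?_⟩
  · intro x y z hx hz hxy hyz
    rw [hran] at hx hz ⊢
    have hz' := not_isMax_of_mem_predLeaves hz
    have hy' : ¬ IsMax y.base := fun h => hz' (h.mono (base_mono hyz.le))
    exact hc.star₃ (hc.isolated h₀) _ _ _ hx hz
      ((base_lt_base (not_isMax_of_mem_predLeaves hx)).2 hxy) ((base_lt_base hy').2 hyz)
  · intro x
    refine ⟨fun h => ⟨_, ⟨x, hmem x h⟩, hle x h⟩, ?_⟩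
    rintro ⟨y, hy, hyx⟩
    rw [hran] at hy
    rw [hdom, or_iff_not_imp_left]
    intro hx
    -- If `x` does not project to a leaf, its projection lies between that of `y` and the
    -- predecessor of a leaf above it, and convexity of `p(L_T)` applies.
    obtain ⟨β, hxβ, hβ⟩ := hT.leaf_above x.base
    obtain ⟨q, hq⟩ := hc.isolated h₀ β hβ
    have hxq := le_of_covBy hT hq (hxβ.lt_of_ne fun h => hx (h ▸ hβ))
    have hqL : q ∈ predLeaves T := ⟨β, hβ, hq⟩
    rcases (base_mono hyx).eq_or_lt with h | h
    · exact h ▸ hy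
    rcases hxq.eq_or_lt with h' | h'
    · exact h' ▸ hqL
    · exact hc.star₃ (hc.isolated h₀) _ _ _ hy hqL h h'
  · exact fun x hx => (hdom x).2 (Or.inl (isMax_base hx))
  · exact fun x hx hm => not_isMax_of_mem_predLeaves ((hran x).1 hx) (isMax_base hm)
  · intro x hx y hy hyx
    rw [hran] at hy
    have hy' := not_isMax_of_mem_predLeaves hy
    rcases (mem_ext_e_of_not_hasRoot hT h₀).1 (hmem x hx) with ⟨h, h'⟩ | ⟨-, h⟩
    · have hlt := le_of_covBy hT h' ((base_lt_base hy').2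
        (hyx.lt_of_ne fun h'' => hy' (h'' ▸ h)))
      refine ((base_le_base_iff _ _).1 hlt).elim id fun h'' => (eq_of_base_eq hy' h'').le
    · rwa [h]

variable (hT : IsGoodTree T) (hT₀ : IsOneColored T₀) (hc : Compatible T T₀) [Nonempty T]

include hT hT₀ hc

omit [Nonempty T] in
theorem isESystem_ext : IsESystem (extFun f .e : Ext T T₀ →. Ext T T₀) := by
  by_cases h₀ : HasRoot T₀
  · obtain ⟨r, hr⟩ := h₀
    exact isESystem_ext_of_isBot hT hT₀.nontrivial hr
  · have := hT₀.nontrivial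
    exact isESystem_ext_of_not_hasRoot hT hc h₀

theorem ext_isLeafClass_iff {x : Ext T T₀} : IsLeafClass (extFun f .e) x ↔ IsMax x.base := by
  have := hT₀.nontrivial
  rw [IsLeafClass, rooted_iff hT hT₀]
  by_cases h₀ : HasRoot T₀
  · obtain ⟨r, hr⟩ := id h₀
    rw [ext_e_dom_of_isBot hT hr]
    exact and_iff_left (Or.inl h₀)
  · rw [ext_e_dom_of_not_hasRoot hT hc h₀, mem_ext_e_ran_of_not_hasRoot hT h₀]
    have := @not_isMax_of_mem_predLeaves _ _ x.base
    tauto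

/-- With a root, `e(a)` determines the leaf of `T`. Without one, `e(a)` is only its predecessor, and
the condition `e(a) < a ⊓ b` separates the leaves sharing it. -/
theorem ext_sim_iff {a b : Ext T T₀} : Sim (extFun f .e) a b ↔ a.base = b.base := by
  have := hT₀.nontrivial
  by_cases ha : IsMax a.base
  swap
  · refine ⟨fun h => ?_, fun h => Or.inl (eq_of_base_eq ha h)⟩
    rw [(isESystem_ext hT hT₀ hc).eq_of_sim
      (fun h => ha ((ext_isLeafClass_iff hT hT₀ hc).1 h)) h]
  rw [Sim, rooted_iff hT hT₀]
  by_cases h₀ : HasRoot T₀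
  · obtain ⟨r, hr⟩ := id h₀
    rw [ext_e_dom_of_isBot hT hr, ext_e_dom_of_isBot hT hr]
    constructor
    · rintro (rfl | ⟨h1, h2, h3, -⟩)
      · rfl
      · rw [total_ext_e_of_isBot hT hr h1, total_ext_e_of_isBot hT hr h2] at h3
        have h4 := congrArg base h3
        exact h4
    · intro h
      have hb : IsMax b.base := h ▸ ha
      refine Or.inr ⟨ha, hb, ?_, Or.inl h₀⟩
      rw [total_ext_e_of_isBot hT hr ha, total_ext_e_of_isBot hT hr hb]
      simp only [h]
  · have htot : ∀ {a : Ext T T₀}, IsMax a.base →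
        (extFun f .e a).Dom ∧ (total (extFun f .e) a).base ⋖ a.base := by
      intro a ha
      have hd := (ext_e_dom_of_not_hasRoot (f := f) hT hc h₀).2 (Or.inl ha)
      refine ⟨hd, ?_⟩
      rcases (mem_ext_e_of_not_hasRoot hT h₀).1 (mem_iff_total.2 ⟨hd, rfl⟩) with h | h
      · exact h.2
      · exact absurd ha (not_isMax_of_mem_predLeaves h.1)
    obtain ⟨hd, hcov⟩ := htot ha
    have hm := hcov.lt.not_isMax
    constructor
    · rintro (rfl | ⟨-, h2, h3, h4⟩)
      · rfl
      · have h5 := (base_lt_base hm).2 (h4.resolve_left h₀)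
        rw [base_inf] at h5
        -- The meet of the two leaves is strictly above the predecessor of one of them, hence equal
        -- to that leaf.
        have h6 := inf_le_left.eq_or_lt.resolve_right (hcov.2 h5)
        exact ha.eq_of_le (inf_eq_left.1 h6)
    · intro h
      have hb : IsMax b.base := h ▸ ha
      obtain ⟨hd', hcov'⟩ := htot hb
      refine Or.inr ⟨hd, hd', eq_of_base_eq hm (covBy_unique hT hcov (h ▸ hcov')), Or.inr ?_⟩
      rw [← base_lt_base hm, base_inf, ← h, inf_idem]
      exact hcov.lt

theorem ext_leBar_iff {a b : Ext T T₀} : LeBar (extFun f .e) a b ↔ a.base ≤ b.base := by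
  simp only [LeBar, ext_sim_iff hT hT₀ hc]
  constructor
  · rintro ⟨a', b', h, h', hle⟩
    rw [← h, ← h']
    exact base_mono hle
  · intro h
    rcases (base_le_base_iff a b).1 h with h | h
    · exact ⟨a, b, rfl, rfl, h⟩
    · exact ⟨a, a, rfl, h, le_rfl⟩

theorem ext_class_theory {x : Ext T T₀} (hx : IsMax x.base) :
    orderTheoryOf {y // Sim (extFun f .e) y x} = orderTheoryOf T₀ := by
  let φ : T₀ ↪o {y // Sim (extFun f .e) y x} :=
    OrderEmbedding.ofMapLEIff (fun t => ⟨copy x.base hx t, (ext_sim_iff hT hT₀ hc).2 rfl⟩)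
      fun s t => ⟨fun h => h.2, fun h => ⟨rfl, h⟩⟩
  refine (orderTheoryOf_eq_of_orderIso (RelIso.ofSurjective φ ?_)).symm
  rintro ⟨y, hy⟩
  rw [ext_sim_iff hT hT₀ hc] at hy
  obtain ⟨t, ht⟩ := exists_eq_copy (hy ▸ hx : IsMax y.base)
  refine ⟨t, Subtype.ext (Eq.trans ?_ ht.symm)⟩
  change copy x.base hx t = _
  simp only [hy]

omit hT hT₀ hc [Nonempty T]

variable (hf : FourStar f)

include hf

theorem mem_extFun_old (i : ι) {x y : Ext T T₀} :
    y ∈ extFun f (.old i) x ↔ y.base ∈ f i x.base := by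
  refine (mem_ofGraph ?_).trans ⟨?_, fun h => ?_⟩
  · rintro b b' ⟨y, hy, h, rfl⟩ ⟨y', hy', h', rfl⟩
    obtain rfl := Part.mem_unique h h'
    rfl
  · rintro ⟨y, hy, h, rfl⟩
    exact h
  · have := hf.ran_not_leaf i _ ⟨_, h⟩
    exact ⟨_, this, h, eq_node this⟩

variable [Nonempty T₀]

theorem extFun_old_dom (i : ι) {x : Ext T T₀} : (extFun f (.old i) x).Dom ↔ (f i x.base).Dom := by
  simp only [Part.dom_iff_mem, mem_extFun_old hf]
  exact (base_surjective.exists (p := fun y => y ∈ f i x.base)).symm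

theorem mem_extFun_old_ran (i : ι) {y : Ext T T₀} :
    y ∈ (extFun f (.old i)).ran ↔ y.base ∈ (f i).ran := by
  constructor
  · rintro ⟨x, hx⟩
    exact ⟨_, (mem_extFun_old hf i).1 hx⟩
  · rintro ⟨x, hx⟩
    obtain ⟨x, rfl⟩ := base_surjective (T₀ := T₀) x
    exact ⟨x, (mem_extFun_old hf i).2 hx⟩

theorem base_total_extFun_old (i : ι) (x : Ext T T₀) :
    (total (extFun f (.old i)) x).base = total (f i) x.base := by
  by_cases h : (extFun f (.old i) x).Dom
  · exact (total_of_mem ((mem_extFun_old hf i).1 (mem_iff_total.2 ⟨h, rfl⟩))).symm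
  · rw [total_of_not_dom h, total_of_not_dom fun h' => h ((extFun_old_dom hf i).2 h')]

include hT hT₀ hc

variable [Nonempty T]

theorem isQuotient_base : @IsQuotient _ _ _ (extFun (T₀ := T₀) f) _ (treeStructure f) base := by
  have hsim : ∀ a b : Ext T T₀, Sim (extFun f .e) a b ↔ a.base = b.base := fun a b =>
    ext_sim_iff hT hT₀ hc
  have hle : ∀ a b : Ext T T₀, LeBar (extFun f .e) a b ↔ a.base ≤ b.base := fun a b =>
    ext_leBar_iff hT hT₀ hc
  have hsurj := base_surjective (T := T) (T₀ := T₀)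
  refine @IsQuotient.mk _ _ _ _ _ (treeStructure f) _ hsurj hsim ?_ ?_ ?_ ?_ ?_ ?_ ?_
  · intro x y
    rw [funMap_meet, base_inf]
  · intro i x
    rw [funMap_fn, base_total_extFun_old hf]
  · intro x y
    rw [relMap_le, hle]
  · intro x
    rw [relMap_leaf]
    simp only [hsim, hle]
    constructor
    · exact fun h y hy => (h.eq_of_le hy).symm
    · intro h z hz
      obtain ⟨y, rfl⟩ := hsurj z
      exact (h y hz).le
  · intro x
    rw [relMap_node, IsNode]
    simp only [hsim, base_inf, hsurj.exists]
  · intro i x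
    rw [relMap_dom]
    simp only [hsim, extFun_old_dom hf]
    exact ⟨fun h => ⟨x, rfl, h⟩, fun ⟨y, h, h'⟩ => h ▸ h'⟩
  · intro i x
    rw [relMap_im]
    simp only [hsim, mem_extFun_old_ran hf]
    exact ⟨fun h => ⟨x, rfl, h⟩, fun ⟨y, h, h'⟩ => h ▸ h'⟩

-- The projections of `x` and `e(x)` can differ only when `T₀` has no root; they are then a leaf and
-- its predecessor, which `hfp` makes indistinguishable for `f`.
omit hT₀ hc hf [Nonempty T] [Nonempty T₀] in
theorem apply_base_total_e
    (hfp : ¬ HasRoot T₀ → ∀ i, ∀ α q : T, IsMax α → q ⋖ α → f i α = f i q) (i : ι)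
    {x : Ext T T₀} (hx : (extFun f .e x).Dom) :
    f i (total (extFun f .e) x).base = f i x.base := by
  by_cases h₀ : HasRoot T₀
  · obtain ⟨r, hr⟩ := h₀
    rw [total_ext_e_of_isBot hT hr ((ext_e_dom_of_isBot hT hr).1 hx)]
    rfl
  · rcases (mem_ext_e_of_not_hasRoot hT h₀).1 (mem_iff_total.2 ⟨hx, rfl⟩) with h | h
    · exact (hfp h₀ i _ _ h.1 h.2).symm
    · rw [h.2]

theorem isFunSystem_ext
    (hfp : ¬ HasRoot T₀ → ∀ i, ∀ α q : T, IsMax α → q ⋖ α → f i α = f i q) (i : ι) :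
    IsFunSystem (extFun f .e : Ext T T₀ →. Ext T T₀) (extFun f (.old i)) := by
  have hsim : ∀ a b : Ext T T₀, Sim (extFun f .e) a b ↔ a.base = b.base := fun a b =>
    ext_sim_iff hT hT₀ hc
  have hmax : ∀ x : Ext T T₀, (extFun f (.old i) x).Dom →
      ¬ IsMax (total (extFun f (.old i)) x).base := by
    intro x hx
    exact hf.ran_not_leaf i _ ⟨_, (mem_extFun_old hf i).1 (mem_iff_total.2 ⟨hx, rfl⟩)⟩
  refine ⟨?_, ?_, ?_, ?_⟩
  · intro x _
    simp only [hsim, extFun_old_dom hf]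
    exact ⟨fun h => ⟨x, rfl, h⟩, fun ⟨y, h, h'⟩ => h ▸ h'⟩
  · intro x _ hd y
    simp only [hsim]
    constructor
    · rintro ⟨-, z, ⟨h1, -⟩, h3⟩
      refine (eq_of_base_eq (hmax x hd) ?_).symm
      rw [← h3, base_total_extFun_old hf, base_total_extFun_old hf, h1]
    · rintro rfl
      refine ⟨?_, x, ⟨rfl, hd⟩, rfl⟩
      have := mt (ext_isLeafClass_iff (f := f) hT hT₀ hc).1 (hmax x hd)
      rw [IsLeafClass] at this
      tauto
  · intro x hx
    rw [extFun_old_dom hf, extFun_old_dom hf, apply_base_total_e hT hfp i hx]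
  · intro x hx hd
    refine eq_of_base_eq (hmax x hd) ?_
    have hd' := (extFun_old_dom hf i).1 hd
    rw [base_total_extFun_old hf, base_total_extFun_old hf]
    refine total_of_mem ?_
    rw [← apply_base_total_e hT hfp i hx] at hd' ⊢
    exact mem_iff_total.2 ⟨hd', rfl⟩

/-- The projection on `T` is the quotient map, so the axioms on the quotient hold because they hold
in `T`; the classes over leaves are isomorphic to `T₀`. -/
theorem model_sigma'_ext
    (hfp : ¬ HasRoot T₀ → ∀ i, ∀ α q : T, IsMax α → q ⋖ α → f i α = f i q) :
    @Theory.Model _ (Ext T T₀) (treeStructure (extFun f))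
      (sigma' (theoryOf f) (orderTheoryOf T₀)) := by
  have hq := isQuotient_base hT hT₀ hc hf
  rw [model_sigma'_iff]
  refine ⟨⟨⟨⟨(model_sigma2_iff _ (isGoodTree hT hT₀.good)).2 (isESystem_ext hT hT₀ hc),
    (model_classAxioms_iff _).2 fun x hx =>
      ext_class_theory hT hT₀ hc ((ext_isLeafClass_iff hT hT₀ hc).1 hx)⟩,
    (@model_quotientAxioms_iff _ _ _ _ _ (treeStructure f) _ hq _).2
      (@model_completeTheory _ T (treeStructure f))⟩,
    (model_noRootAxioms_iff _).2 fun hr => ?_⟩,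
    fun i => (model_funAxioms_iff _ i).2 (isFunSystem_ext hT hT₀ hc hf hfp i)⟩
  rw [rooted_iff hT hT₀] at hr
  constructor
  · intro x hx
    rw [← hq.isMax_iff] at hx
    obtain ⟨q, h⟩ := hc.isolated hr _ hx
    obtain ⟨y, rfl⟩ := base_surjective (T₀ := T₀) q
    exact ⟨y, (hq.covBy_iff y x).2 h⟩
  · intro x
    rw [hq.mem_predLeaves_iff]
    simp only [mem_ext_e_ran_of_not_hasRoot hT hr, ext_sim_iff hT hT₀ hc]
    exact ⟨fun ⟨y, h, h'⟩ => h ▸ h', fun h => ⟨x, rfl, h⟩⟩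

end ExtModel

end GoodTree

theorem proposition5 {𝓕 : Type} [Finite 𝓕]
    {T : Type*} [SemilatticeInf T] {T₀ : Type*} [SemilatticeInf T₀]
    (hT : GoodTree.IsGoodTree T) (hTn : Nontrivial T) (hT₀ : GoodTree.IsOneColored T₀)
    (hc : GoodTree.Compatible T T₀)
    (f : 𝓕 → T →. T) (hf : GoodTree.FourStar f)
    (hfp : ¬ GoodTree.HasRoot T₀ → ∀ i, ∀ α q : T, IsMax α → q ⋖ α → f i α = f i q) :
    -- `Σ'` is a complete axiomatization of `T ⋊ T₀`
    (GoodTree.sigma' (GoodTree.theoryOf f) (GoodTree.orderTheoryOf T₀) ⊆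
        GoodTree.theoryOf (GoodTree.extFun (T₀ := T₀) f) ∧
      (GoodTree.sigma' (GoodTree.theoryOf f) (GoodTree.orderTheoryOf T₀)).IsComplete) ∧
    -- transfer of `ℵ₀`-categoricity
    ((Cardinal.aleph0.{0}).Categorical (GoodTree.theoryOf f) →
      (Cardinal.aleph0.{0}).Categorical
        (GoodTree.sigma' (GoodTree.theoryOf f) (GoodTree.orderTheoryOf T₀))) ∧
    -- transfer of quantifier elimination
    (GoodTree.EliminatesQuantifiers (GoodTree.theoryOf (GoodTree.withPred f)) →
      GoodTree.EliminatesQuantifiers (GoodTree.addPred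
        (GoodTree.sigma' (GoodTree.theoryOf f) (GoodTree.orderTheoryOf T₀)))) := by
  have hTne := hTn.to_nonempty
  have hT₀ne := hT₀.nontrivial.to_nonempty
  have hExt : Nonempty (GoodTree.Ext T T₀) :=
    (GoodTree.Ext.base_surjective (T := T) (T₀ := T₀)).nonempty
  have hcount : Countable 𝓕 := Finite.to_countable
  let _ := GoodTree.treeStructure (GoodTree.extFun (T₀ := T₀) f)
  have hmod := GoodTree.model_sigma'_ext hT hT₀ hc hf hfp
  exact ⟨⟨FirstOrder.Language.Theory.model_iff_subset_completeTheory.1 hmod,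
    GoodTree.isComplete_sigma' hT hT₀
      (FirstOrder.Language.Theory.Model.isSatisfiable (GoodTree.Ext T T₀))⟩,
    GoodTree.categorical_sigma' hT hT₀, GoodTree.eliminatesQuantifiers_sigma' hT hT₀⟩
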